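/- **Theorem.** Let $\mathcal{T}^\omega=\mathcal{A}^\omega[X,\langle\cdot,\cdot\rangle,A,J^A]$ be the formal system for a monotone operator $A$ with total resolvents on a real inner product space $X$ described below. Then the following seven sentences are pairwise provably equivalent over $\mathcal{T}^\omega$, i.e. $\mathcal{T}^\omega\vdash(i)\leftrightarrow(j)$ for all $i,j\in\{1,\dots,7\}$: 1. (extensionality of $A$) $\forall x^X,y^X,x'^X,y'^X\,(x=_Xx'\wedge y=_Xy'\rightarrow\chi_Axy=_0\chi_Ax'y')$; 2. (strong resolvent axiom) $\forall x^X,p^X,\gamma^1\,(\gamma>_{\mathbb R}0\wedge p=_XJ^A_\gamma x\rightarrow\gamma^{-1}(x-_Xp)\in Ap)$; 3. (maximal accretivity) $\forall x^X,u^X\,\bigl(\forall y^X,v^X,\lambda^1\,(v\in Ay\rightarrow\|x-_Xy+_X|\lambda|(u-_Xv)\|_X\ge_{\mathbb R}\|x-_Xy\|_X)\rightarrow u\in Ax\bigr)$; 4. (strong resolvent axiom for $\gamma=1$) $\forall x^X,p^X\,(p=_XJ^A_1x\rightarrow(x-_Xp)\in Ap)$; 5. (maximal accretivity for $\lambda=1$)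 $\forall x^X,u^X\,\bigl(\forall y^X,v^X\,(v\in Ay\rightarrow\|x-_Xy+_X(u-_Xv)\|_X\ge_{\mathbb R}\|x-_Xy\|_X)\rightarrow u\in Ax\bigr)$; 6. (closure of the graph) $\forall x^X,y^X,x_{(\cdot)}^{X(0)},y_{(\cdot)}^{X(0)}\,(x_n\to_Xx\wedge y_n\to_Xy\wedge\forall n^0(y_n\in Ax_n)\rightarrow y\in Ax)$, where $x_n\to_Xx$ stands for $\forall k^0\exists N^0\forall m\ge_0N\,(\|x_m-_Xx\|_X\le_{\mathbb R}2^{-k})$; 7. (maximal monotonicity) $\forall x^X,u^X\,\bigl(\forall y^X,v^X\,(v\in Ay\rightarrow\langle x-_Xy,u-_Xv\rangle_X\ge_{\mathbb R}0)\rightarrow u\in Ax\bigr)$. **The system.** The types are generated from $0$ (natural numbers) and $X$ by $\rho,\tau\mapsto\tau(\rho)$ (functions from $\rho$ to $\tau$); $1$ is $0(0)$. The constants are $0$, $S$, the combinators $\Pi,\Sigma$, simultaneous primitive recursors at all tuples of types; $0_X,1_X,+_X,-_X,\cdot_X,\|\cdot\|_X$ of types $X$, $X$, $X(X)(X)$,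 $X(X)$, $X(X)(1)$, $1(X)$; $\chi_A$ of type $0(X)(X)$, $J^{\chi_A}$ of type $X(X)(1)$, $\tilde\gamma$ of type $1$, $m_{\tilde\gamma}$ of type $0$ and $c_X$ of type $X$. Terms are formed by application; the only relation symbol is $=_0$; formulas are built with $\wedge,\vee,\rightarrow$ and quantifiers over all types. Here $y\in Ax$ stands for $\chi_Axy=_00$, $J^A_\gamma$ for $J^{\chi_A}\gamma$, and $x-_Xy$ for $x+_X(-_Xy)$. Rationals are coded by natural numbers through the Cantor pairing function; every type $1$ object represents a real number via a fast converging Cauchy sequence (modulus $2^{-n}$) of rationals; $=_{\mathbb R},<_{\mathbb R},\le_{\mathbb R}$ are the corresponding formulas ($\Pi^0_1$, $\Sigma^0_1$, $\Pi^0_1$), and $+,-,\cdot,|\cdot|$ and $(\gamma)^{-1}_l$ are closed terms, where $(\gamma)^{-1}_l$ represents $\gamma^{-1}$ whenever $|\gamma|>2^{-l}$. A formula $\gamma>_{\mathbb R}0\wedge\dots\rightarrow\dots\gamma^{-1}\dots$ stands for $\forall l^0(\gamma>_{\mathbb R}2^{-l}\wedge\dots\rightarrow\dots(\gamma)^{-1}_l\dots)$.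 Equality $=_X$ stands for $\|x-_Xy\|_X=_{\mathbb R}0$, equality at function types is pointwise, and $\langle x,y\rangle_X:=\frac14(\|x+_Xy\|_X^2-\|x-_Xy\|_X^2)$. $\mathcal{T}^\omega$ is based on classical many-sorted logic and consists of - weakly extensional Peano arithmetic in all these types: equality axioms for $=_0$, successor axioms, full induction, the defining equations of combinators and recursors, and, instead of extensionality axioms, only the rule of quantifier-free extensionality: from a proof of $A_0\rightarrow s=_\rho t$ infer $A_0\rightarrow r[s/x^\rho]=_\tau r[t/x^\rho]$, for $A_0$ quantifier-free; - quantifier-free choice $\forall\underline x\exists\underline y\,A_0(\underline x,\underline y)\rightarrow\exists\underline Y\forall\underline x\,A_0(\underline x,\underline Y\underline x)$ ($A_0$ quantifier-free) and dependent choice $\forall x^0,\underline y\,\exists\underline z\,B(x,\underline y,\underline z)\rightarrow\exists\underline f\,\forall x^0\,B(x,\underline f(x),\underline f(Sx))$ ($B$ arbitrary), for tuples of all types; - axioms stating that $X$ is a real normed vector space (with $=_X$ as equality) with $\|1_X\|_X=_{\mathbb R}1$ in which all operations are extensional, together with the parallelogram law; - the axioms (I) $\forall x^X,y^X(\chi_Axy\le_01)$;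 (II) $\forall\gamma^1,x^X(\gamma>_{\mathbb R}0\rightarrow\gamma^{-1}(x-_XJ^A_\gamma x)\in A(J^A_\gamma x))$; (III) $\forall x^X,y^X,u^X,v^X,\lambda^1(u\in Ax\wedge v\in Ay\rightarrow\|x-_Xy+_X|\lambda|(u-_Xv)\|_X\ge_{\mathbb R}\|x-_Xy\|_X)$; (IV) $\tilde\gamma\ge_{\mathbb R}2^{-m_{\tilde\gamma}}$. -/

import Mathlib

namespace FiniteType

/-! ### Types, variables, constants, terms -/

/-- The finite types over the two ground types `0` (natural numbers) and `X` (the abstract space);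
`fn ρ τ` is the type `τ(ρ)` of functions from `ρ` to `τ`. -/
inductive Ty : Type
  | nat : Ty
  | X : Ty
  | fn (ρ τ : Ty) : Ty

/-- The type `1 = 0(0)`. -/
abbrev Ty.one : Ty := Ty.fn Ty.nat Ty.nat

/-- `arrows [ρ₁, …, ρₖ] τ` is the type of functions taking arguments of types `ρ₁, …, ρₖ` to `τ`. -/
def arrows : List Ty → Ty → Ty
  | [], τ => τ
  | ρ :: ρs, τ => Ty.fn ρ (arrows ρs τ)

/-- The type of the step functional producing the component of type `τ` in a simultaneous
recursion over the types `ρs`. -/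
abbrev stepTy (ρs : List Ty) (τ : Ty) : Ty := arrows ρs (Ty.fn Ty.nat τ)

/-- `Var Γ τ`: the variables of type `τ` in the context `Γ` (de Bruijn indices). Also used to
point at a component of type `τ` of a tuple of types `Γ`. -/
inductive Var : List Ty → Ty → Type
  | zero {Γ : List Ty} {ρ : Ty} : Var (ρ :: Γ) ρ
  | succ {Γ : List Ty} {ρ τ : Ty} : Var Γ τ → Var (ρ :: Γ) τ

/-- The component of a mapped tuple corresponding to a component of the original tuple. -/
def Var.map (f : Ty → Ty) : {Γ : List Ty} → {τ : Ty} → Var Γ τ → Var (Γ.map f) (f τ)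
  | _, _, .zero => .zero
  | _, _, .succ x => .succ (Var.map f x)

/-- The constants of the language. -/
inductive Cst : Ty → Type
  /-- zero and successor -/
  | zero : Cst Ty.nat
  | succ : Cst Ty.one
  /-- the combinators `Π` and `Σ` -/
  | proj (ρ τ : Ty) : Cst (Ty.fn ρ (Ty.fn τ ρ))
  | comb (δ ρ τ : Ty) :
      Cst (Ty.fn (Ty.fn δ (Ty.fn ρ τ)) (Ty.fn (Ty.fn δ ρ) (Ty.fn δ τ)))
  /-- the simultaneous recursors `(R_i)_ρs` -/
  | recur (ρs : List Ty) {τ : Ty} (i : Var ρs τ) :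
      Cst (Ty.fn Ty.nat (arrows ρs (arrows (ρs.map (stepTy ρs)) τ)))
  /-- the operations of the normed space -/
  | zeroX : Cst Ty.X
  | oneX : Cst Ty.X
  | addX : Cst (Ty.fn Ty.X (Ty.fn Ty.X Ty.X))
  | negX : Cst (Ty.fn Ty.X Ty.X)
  | smulX : Cst (Ty.fn Ty.one (Ty.fn Ty.X Ty.X))
  | normX : Cst (Ty.fn Ty.X Ty.one)
  /-- the characteristic function `χ_A` of the operator and its resolvent `J^{χ_A}` -/
  | chi : Cst (Ty.fn Ty.X (Ty.fn Ty.X Ty.nat))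
  | res : Cst (Ty.fn Ty.one (Ty.fn Ty.X Ty.X))
  /-- the constants `γ̃`, `m_γ̃` and `c_X` -/
  | gammaTilde : Cst Ty.one
  | mTilde : Cst Ty.nat
  | pointX : Cst Ty.X

/-- Terms in context `Γ`: built from variables and constants by application only. -/
inductive Tm (Γ : List Ty) : Ty → Type
  | var {τ : Ty} (x : Var Γ τ) : Tm Γ τ
  | cst {τ : Ty} (c : Cst τ) : Tm Γ τ
  | app {ρ τ : Ty} (s : Tm Γ (Ty.fn ρ τ)) (t : Tm Γ ρ) : Tm Γ τ

variable {Γ Δ : List Ty} {ρ σ τ δ : Ty}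

/-! ### Renaming and substitution in terms -/

/-- Renamings of variables. -/
abbrev Ren (Γ Δ : List Ty) : Type := ∀ τ : Ty, Var Γ τ → Var Δ τ

/-- Substitutions: a term in context `Δ` for each variable of `Γ`. A `Sub ρs Δ` is also a tuple
of terms of types `ρs`. -/
abbrev Sub (Γ Δ : List Ty) : Type := ∀ τ : Ty, Var Γ τ → Tm Δ τ

def Ren.lift (f : Ren Γ Δ) : Ren (ρ :: Γ) (ρ :: Δ)
  | _, .zero => .zero
  | _, .succ x => .succ (f _ x)

def Tm.rename (f : Ren Γ Δ) : {τ : Ty} → Tm Γ τ → Tm Δ τ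
  | _, .var x => .var (f _ x)
  | _, .cst c => .cst c
  | _, .app s t => .app (Tm.rename f s) (Tm.rename f t)

/-- Weakening by one fresh variable. -/
def Tm.wk (t : Tm Γ τ) : Tm (ρ :: Γ) τ := t.rename (fun _ x => .succ x)

/-- The renaming of the empty context. -/
def Ren.empty : Ren [] Γ := fun _ x => nomatch x

/-- A closed term, viewed in an arbitrary context. -/
def Tm.closed (t : Tm [] τ) : Tm Γ τ := t.rename Ren.empty

def Sub.lift (f : Sub Γ Δ) : Sub (ρ :: Γ) (ρ :: Δ)
  | _, .zero => .var .zero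
  | _, .succ x => (f _ x).wk

def Tm.subst (f : Sub Γ Δ) : {τ : Ty} → Tm Γ τ → Tm Δ τ
  | _, .var x => f _ x
  | _, .cst c => .cst c
  | _, .app s t => .app (Tm.subst f s) (Tm.subst f t)

def Sub.cons (t : Tm Δ ρ) (f : Sub Γ Δ) : Sub (ρ :: Γ) Δ
  | _, .zero => t
  | _, .succ x => f _ x

/-- The substitution of `t` for the variable with index `0`. -/
def Sub.single (t : Tm Γ ρ) : Sub (ρ :: Γ) Γ := Sub.cons t (fun _ x => .var x)

/-- Concatenation of tuples of terms. -/
def Sub.append : {Γ₁ Γ₂ : List Ty} → Sub Γ₁ Δ → Sub Γ₂ Δ → Sub (Γ₁ ++ Γ₂) Δ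
  | [], _, _, g => g
  | _ :: _, _, f, g => Sub.cons (f _ .zero) (Sub.append (fun _ x => f _ (.succ x)) g)

/-- The variables of the left and of the right part of a concatenated context. -/
def Var.inl : {Γ₁ : List Ty} → {τ : Ty} → Var Γ₁ τ → Var (Γ₁ ++ Δ) τ
  | _ :: _, _, .zero => .zero
  | _ :: _, _, .succ x => .succ (Var.inl x)

def Var.inr : (Γ₁ : List Ty) → {τ : Ty} → Var Δ τ → Var (Γ₁ ++ Δ) τ
  | [], _, x => x
  | _ :: Γ₁, _, x => .succ (Var.inr Γ₁ x)

/-- Application of a term to a tuple of arguments. -/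
def Tm.apps : {ρs : List Ty} → {τ : Ty} → Tm Γ (arrows ρs τ) → Sub ρs Γ → Tm Γ τ
  | [], _, t, _ => t
  | _ :: _, _, t, f => Tm.apps (.app t (f _ .zero)) (fun _ x => f _ (.succ x))

/-- Lambda abstraction of the variable with index `0`, defined through the combinators. -/
def Tm.lam : {τ : Ty} → Tm (ρ :: Γ) τ → Tm Γ (Ty.fn ρ τ)
  | _, .var .zero =>
      .app (.app (.cst (.comb ρ (Ty.fn ρ ρ) ρ)) (.cst (.proj ρ (Ty.fn ρ ρ)))) (.cst (.proj ρ ρ))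
  | _, .var (.succ x) => .app (.cst (.proj _ ρ)) (.var x)
  | _, .cst c => .app (.cst (.proj _ ρ)) (.cst c)
  | _, .app s t => .app (.app (.cst (.comb ρ _ _)) (Tm.lam s)) (Tm.lam t)

abbrev Tm.app2 (f : Tm Γ (Ty.fn ρ (Ty.fn σ τ))) (a : Tm Γ ρ) (b : Tm Γ σ) : Tm Γ τ :=
  .app (.app f a) b

abbrev Tm.app3 (f : Tm Γ (Ty.fn ρ (Ty.fn σ (Ty.fn δ τ)))) (a : Tm Γ ρ) (b : Tm Γ σ)
    (c : Tm Γ δ) : Tm Γ τ :=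
  .app (.app (.app f a) b) c

/-! Variables by index. -/
section Indices
variable {a b c d e : Ty}
abbrev v0 : Tm (a :: Γ) a := .var .zero
abbrev v1 : Tm (a :: b :: Γ) b := .var (.succ .zero)
abbrev v2 : Tm (a :: b :: c :: Γ) c := .var (.succ (.succ .zero))
abbrev v3 : Tm (a :: b :: c :: d :: Γ) d := .var (.succ (.succ (.succ .zero)))
abbrev v4 : Tm (a :: b :: c :: d :: e :: Γ) e := .var (.succ (.succ (.succ (.succ .zero))))
end Indices

/-! ### Primitive recursive functions on the natural numbers -/

abbrev Tm.zero : Tm Γ Ty.nat := .cst .zero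
abbrev Tm.suc (t : Tm Γ Ty.nat) : Tm Γ Ty.nat := .app (.cst .succ) t

/-- Recursion at type `0`: value `a` at `0`; `step` may use the argument `v0` and the previous
value `v1`. -/
def recN (a : Tm Γ Ty.nat) (step : Tm (Ty.nat :: Ty.nat :: Γ) Ty.nat) (n : Tm Γ Ty.nat) :
    Tm Γ Ty.nat :=
  .app3 (.cst (.recur [Ty.nat] .zero)) n a (Tm.lam (Tm.lam step))

/-- Addition. -/
def plusC : Tm [] (Ty.fn Ty.nat Ty.one) := .lam (.lam (recN v1 (.suc v1) v0))
def plus (a b : Tm Γ Ty.nat) : Tm Γ Ty.nat := .app2 plusC.closed a b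

/-- Multiplication. -/
def timesC : Tm [] (Ty.fn Ty.nat Ty.one) := .lam (.lam (recN .zero (plus v1 v3) v0))
def times (a b : Tm Γ Ty.nat) : Tm Γ Ty.nat := .app2 timesC.closed a b

/-- Predecessor. -/
def predC : Tm [] Ty.one := .lam (recN .zero v0 v0)
def pred (a : Tm Γ Ty.nat) : Tm Γ Ty.nat := .app predC.closed a

/-- Truncated subtraction. -/
def monusC : Tm [] (Ty.fn Ty.nat Ty.one) := .lam (.lam (recN v1 (pred v1) v0))
def monus (a b : Tm Γ Ty.nat) : Tm Γ Ty.nat := .app2 monusC.closed a b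

/-- `cond c a b` is `a` if `c = 0` and `b` otherwise. -/
def condC : Tm [] (Ty.fn Ty.nat (Ty.fn Ty.nat Ty.one)) := .lam (.lam (.lam (recN v1 v2 v2)))
def cond (c a b : Tm Γ Ty.nat) : Tm Γ Ty.nat := .app3 condC.closed c a b

/-- Bounded search: `mu p b` is the least `u ≤ b` with `p u = 0` if there is one, else `0`. -/
def muC : Tm [] (Ty.fn Ty.one Ty.one) :=
  .lam (.lam (recN .zero
    (cond (.app v3 v1) v1 (cond (.app v3 (.suc v0)) (.suc v0) .zero)) v0))
def mu (p : Tm Γ Ty.one) (b : Tm Γ Ty.nat) : Tm Γ Ty.nat := .app2 muC.closed p b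

/-- The term `(n + m)² + 3n + m`. -/
def cantorSum (n m : Tm Γ Ty.nat) : Tm Γ Ty.nat :=
  plus (plus (times (plus n m) (plus n m)) (plus n (plus n n))) m

/-- The pairing function `j(n, m)`: the least `u ≤ (n+m)² + 3n + m` with
`2u = (n+m)² + 3n + m` if it exists, else `0`. -/
def pairC : Tm [] (Ty.fn Ty.nat Ty.one) :=
  .lam (.lam (mu
    (.lam (plus (monus (plus v0 v0) (cantorSum v2 v1)) (monus (cantorSum v2 v1) (plus v0 v0))))
    (cantorSum v1 v0)))
def pair (n m : Tm Γ Ty.nat) : Tm Γ Ty.nat := .app2 pairC.closed n m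

/-- The two steps along the enumeration of pairs by `j`: the pair after `(a, b)` is
`(0, a + 1)` if `b = 0` and `(a + 1, b - 1)` otherwise. -/
def unpairStep₁ : Tm [] (stepTy [Ty.nat, Ty.nat] Ty.nat) :=
  .lam (.lam (.lam (cond v1 .zero (.suc v2))))
def unpairStep₂ : Tm [] (stepTy [Ty.nat, Ty.nat] Ty.nat) :=
  .lam (.lam (.lam (cond v1 (.suc v2) (pred v1))))

/-- The projections `j₁`, `j₂` inverse to `j`, by simultaneous recursion. -/
def fstC : Tm [] Ty.one :=
  .lam (.app2 (.app3 (.cst (.recur [Ty.nat, Ty.nat] .zero)) v0 .zero .zero)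
    unpairStep₁.closed unpairStep₂.closed)
def sndC : Tm [] Ty.one :=
  .lam (.app2 (.app3 (.cst (.recur [Ty.nat, Ty.nat] (.succ .zero))) v0 .zero .zero)
    unpairStep₁.closed unpairStep₂.closed)
def fst (z : Tm Γ Ty.nat) : Tm Γ Ty.nat := .app fstC.closed z
def snd (z : Tm Γ Ty.nat) : Tm Γ Ty.nat := .app sndC.closed z

/-- Remainder and quotient of the division by two. -/
def parityC : Tm [] Ty.one := .lam (recN .zero (monus (.suc .zero) v1) v0)
def parity (a : Tm Γ Ty.nat) : Tm Γ Ty.nat := .app parityC.closed a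
def halfC : Tm [] Ty.one := .lam (recN .zero (plus v1 (parity v0)) v0)
def half (a : Tm Γ Ty.nat) : Tm Γ Ty.nat := .app halfC.closed a

/-- `2 ^ n`. -/
def pow2C : Tm [] Ty.one := .lam (recN (.suc .zero) (plus v1 v1) v0)
def pow2 (a : Tm Γ Ty.nat) : Tm Γ Ty.nat := .app pow2C.closed a

/-! ### Rational numbers

The number `j(n, m)` codes `(n/2)/(m+1)` if `n` is even and `-((n+1)/2)/(m+1)` if `n` is odd.
Every rational `q` is thus `(posQ q - negQ q) / denQ q`, where at most one of the natural numbers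
`posQ q`, `negQ q` is nonzero. -/

def posQC : Tm [] Ty.one :=
  .lam (times (monus (.suc .zero) (parity (fst v0))) (half (fst v0)))
def posQ (q : Tm Γ Ty.nat) : Tm Γ Ty.nat := .app posQC.closed q
def negQC : Tm [] Ty.one := .lam (times (parity (fst v0)) (.suc (half (fst v0))))
def negQ (q : Tm Γ Ty.nat) : Tm Γ Ty.nat := .app negQC.closed q
def denQ (q : Tm Γ Ty.nat) : Tm Γ Ty.nat := .suc (snd q)

/-- The code of `(p - n) / d`, for `d > 0`. -/
def mkQC : Tm [] (Ty.fn Ty.nat (Ty.fn Ty.nat Ty.one)) :=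
  .lam (.lam (.lam (pair
    (plus (plus (monus v2 v1) (monus v2 v1))
      (pred (plus (monus v1 v2) (monus v1 v2))))
    (pred v0))))
def mkQ (p n d : Tm Γ Ty.nat) : Tm Γ Ty.nat := .app3 mkQC.closed p n d

def addQC : Tm [] (Ty.fn Ty.nat Ty.one) :=
  .lam (.lam (mkQ (plus (times (posQ v1) (denQ v0)) (times (posQ v0) (denQ v1)))
    (plus (times (negQ v1) (denQ v0)) (times (negQ v0) (denQ v1)))
    (times (denQ v1) (denQ v0))))
def addQ (p q : Tm Γ Ty.nat) : Tm Γ Ty.nat := .app2 addQC.closed p q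

def negateQC : Tm [] Ty.one := .lam (mkQ (negQ v0) (posQ v0) (denQ v0))
def negateQ (q : Tm Γ Ty.nat) : Tm Γ Ty.nat := .app negateQC.closed q

def subQ (p q : Tm Γ Ty.nat) : Tm Γ Ty.nat := addQ p (negateQ q)

def mulQC : Tm [] (Ty.fn Ty.nat Ty.one) :=
  .lam (.lam (mkQ (plus (times (posQ v1) (posQ v0)) (times (negQ v1) (negQ v0)))
    (plus (times (posQ v1) (negQ v0)) (times (negQ v1) (posQ v0)))
    (times (denQ v1) (denQ v0))))
def mulQ (p q : Tm Γ Ty.nat) : Tm Γ Ty.nat := .app2 mulQC.closed p q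

def absQC : Tm [] Ty.one := .lam (mkQ (plus (posQ v0) (negQ v0)) .zero (denQ v0))
def absQ (q : Tm Γ Ty.nat) : Tm Γ Ty.nat := .app absQC.closed q

/-- Reciprocal, with value `0` at `0`. -/
def invQC : Tm [] Ty.one :=
  .lam (mkQ (cond (posQ v0) .zero (denQ v0)) (cond (negQ v0) .zero (denQ v0))
    (plus (posQ v0) (negQ v0)))
def invQ (q : Tm Γ Ty.nat) : Tm Γ Ty.nat := .app invQC.closed q

/-- The rational number given by a natural number. -/
def natQ (n : Tm Γ Ty.nat) : Tm Γ Ty.nat := mkQ n .zero (.suc .zero)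

/-- The rational number `2 ^ (-n)`. -/
def twoPowNegQ (n : Tm Γ Ty.nat) : Tm Γ Ty.nat := mkQ (.suc .zero) .zero (pow2 n)

/-- Characteristic terms of the order: they vanish exactly if `p ≤ q`, respectively `p < q`. -/
def leQC : Tm [] (Ty.fn Ty.nat Ty.one) :=
  .lam (.lam (monus (plus (times (posQ v1) (denQ v0)) (times (negQ v0) (denQ v1)))
    (plus (times (posQ v0) (denQ v1)) (times (negQ v1) (denQ v0)))))
def leQChar (p q : Tm Γ Ty.nat) : Tm Γ Ty.nat := .app2 leQC.closed p q
def ltQC : Tm [] (Ty.fn Ty.nat Ty.one) :=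
  .lam (.lam (monus (.suc (plus (times (posQ v1) (denQ v0)) (times (negQ v0) (denQ v1))))
    (plus (times (posQ v0) (denQ v1)) (times (negQ v1) (denQ v0)))))
def ltQChar (p q : Tm Γ Ty.nat) : Tm Γ Ty.nat := .app2 ltQC.closed p q

/-! ### Real numbers

A type `1` object `f` represents the limit of the sequence of rationals `f̂`, where `f̂ n = f n` as
long as `|f k - f (k+1)| < 2^(-k-1)` for all `k < n`, and `f̂` is constant from the first violation
of this condition on. -/

/-- `defect f n = 0` iff `|f k - f (k+1)| < 2^(-k-1)` for all `k < n`. -/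
def defectC : Tm [] (Ty.fn Ty.one Ty.one) :=
  .lam (.lam (recN .zero
    (plus v1 (ltQChar (absQ (subQ (.app v3 v0) (.app v3 (.suc v0)))) (twoPowNegQ (.suc v0))))
    v0))
def defect (f : Tm Γ Ty.one) (n : Tm Γ Ty.nat) : Tm Γ Ty.nat := .app2 defectC.closed f n

/-- `f̂ n`. -/
def hatC : Tm [] (Ty.fn Ty.one Ty.one) :=
  .lam (.lam (recN (.app v1 .zero)
    (cond (defect v3 (.suc v0)) (.app v3 (.suc v0)) v1) v0))
def hat (f : Tm Γ Ty.one) (n : Tm Γ Ty.nat) : Tm Γ Ty.nat := .app2 hatC.closed f n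

/-- The real number given by a rational: the constant sequence. -/
def constR (q : Tm Γ Ty.nat) : Tm Γ Ty.one := .app (.cst (.proj Ty.nat Ty.nat)) q

def zeroR : Tm Γ Ty.one := constR (natQ .zero)
def oneR : Tm Γ Ty.one := constR (natQ (.suc .zero))
def twoR : Tm Γ Ty.one := constR (natQ (.suc (.suc .zero)))
def twoPowNegR (n : Tm Γ Ty.nat) : Tm Γ Ty.one := constR (twoPowNegQ n)

/-- `(f + g)(n) = f̂(n+1) + ĝ(n+1)`. -/
def addRC : Tm [] (Ty.fn Ty.one (Ty.fn Ty.one Ty.one)) :=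
  .lam (.lam (.lam (addQ (hat v2 (.suc v0)) (hat v1 (.suc v0)))))
def addR (f g : Tm Γ Ty.one) : Tm Γ Ty.one := .app2 addRC.closed f g

/-- `(-f)(n) = -f̂(n)`. -/
def negRC : Tm [] (Ty.fn Ty.one Ty.one) := .lam (.lam (negateQ (hat v1 v0)))
def negR (f : Tm Γ Ty.one) : Tm Γ Ty.one := .app negRC.closed f

def subR (f g : Tm Γ Ty.one) : Tm Γ Ty.one := addR f (negR g)

/-- `|f|(n) = |f̂(n)|`. -/
def absRC : Tm [] (Ty.fn Ty.one Ty.one) := .lam (.lam (absQ (hat v1 v0)))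
def absR (f : Tm Γ Ty.one) : Tm Γ Ty.one := .app absRC.closed f

/-- A natural number `k` with `2^k ≥ |f(0)| + |g(0)| + 2`. -/
def mulShift (f g : Tm Γ Ty.one) : Tm Γ Ty.nat :=
  .suc (plus (plus (posQ (.app f .zero)) (negQ (.app f .zero)))
    (plus (posQ (.app g .zero)) (negQ (.app g .zero))))

/-- `(f · g)(n) = f̂(n+k) · ĝ(n+k)`, where `2^k ≥ |f(0)| + |g(0)| + 2`. -/
def mulRC : Tm [] (Ty.fn Ty.one (Ty.fn Ty.one Ty.one)) :=
  .lam (.lam (.lam (mulQ (hat v2 (plus v0 (mulShift v2 v1))) (hat v1 (plus v0 (mulShift v2 v1))))))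
def mulR (f g : Tm Γ Ty.one) : Tm Γ Ty.one := .app2 mulRC.closed f g

/-- `(f)⁻¹_l (n) = (f̂(n + 2l + 2))⁻¹`; it represents the reciprocal of `f` if `|f| > 2^(-l)`. -/
def invRC : Tm [] (Ty.fn Ty.nat (Ty.fn Ty.one Ty.one)) :=
  .lam (.lam (.lam (invQ (hat v1 (plus v0 (.suc (.suc (plus v2 v2))))))))
def invR (l : Tm Γ Ty.nat) (f : Tm Γ Ty.one) : Tm Γ Ty.one := .app2 invRC.closed l f

/-! ### The abstract space -/

abbrev zeroX : Tm Γ Ty.X := .cst .zeroX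
abbrev oneX : Tm Γ Ty.X := .cst .oneX
abbrev addX (x y : Tm Γ Ty.X) : Tm Γ Ty.X := .app2 (.cst .addX) x y
abbrev negX (x : Tm Γ Ty.X) : Tm Γ Ty.X := .app (.cst .negX) x
abbrev subX (x y : Tm Γ Ty.X) : Tm Γ Ty.X := addX x (negX y)
abbrev smulX (α : Tm Γ Ty.one) (x : Tm Γ Ty.X) : Tm Γ Ty.X := .app2 (.cst .smulX) α x
abbrev normX (x : Tm Γ Ty.X) : Tm Γ Ty.one := .app (.cst .normX) x
abbrev normSqX (x : Tm Γ Ty.X) : Tm Γ Ty.one := mulR (normX x) (normX x)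

/-- `⟨x, y⟩ = (1/4) (‖x + y‖² - ‖x - y‖²)`. -/
def innerX (x y : Tm Γ Ty.X) : Tm Γ Ty.one :=
  mulR (twoPowNegR (.suc (.suc .zero))) (subR (normSqX (addX x y)) (normSqX (subX x y)))

/-- `J^A_γ x`. -/
abbrev resolvent (γ : Tm Γ Ty.one) (x : Tm Γ Ty.X) : Tm Γ Ty.X := .app2 (.cst .res) γ x

/-! ### Formulas -/

/-- Formulas in context `Γ`. Equality at type `0` is the only relation symbol. -/
inductive Fm : List Ty → Type
  | eq {Γ : List Ty} (s t : Tm Γ Ty.nat) : Fm Γ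
  | and {Γ : List Ty} (φ ψ : Fm Γ) : Fm Γ
  | or {Γ : List Ty} (φ ψ : Fm Γ) : Fm Γ
  | imp {Γ : List Ty} (φ ψ : Fm Γ) : Fm Γ
  | all {Γ : List Ty} (ρ : Ty) (φ : Fm (ρ :: Γ)) : Fm Γ
  | ex {Γ : List Ty} (ρ : Ty) (φ : Fm (ρ :: Γ)) : Fm Γ

/-- Falsity is `0 = 1`. -/
def Fm.bot : Fm Γ := .eq .zero (.suc .zero)
def Fm.neg (φ : Fm Γ) : Fm Γ := .imp φ .bot
def Fm.iff (φ ψ : Fm Γ) : Fm Γ := .and (.imp φ ψ) (.imp ψ φ)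

/-- Quantifier-free formulas. -/
def Fm.QF : {Γ : List Ty} → Fm Γ → Prop
  | _, .eq _ _ => True
  | _, .and φ ψ => φ.QF ∧ ψ.QF
  | _, .or φ ψ => φ.QF ∧ ψ.QF
  | _, .imp φ ψ => φ.QF ∧ ψ.QF
  | _, .all _ _ => False
  | _, .ex _ _ => False

def Fm.rename : {Γ Δ : List Ty} → Ren Γ Δ → Fm Γ → Fm Δ
  | _, _, f, .eq s t => .eq (s.rename f) (t.rename f)
  | _, _, f, .and φ ψ => .and (φ.rename f) (ψ.rename f)
  | _, _, f, .or φ ψ => .or (φ.rename f) (ψ.rename f)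
  | _, _, f, .imp φ ψ => .imp (φ.rename f) (ψ.rename f)
  | _, _, f, .all ρ φ => .all ρ (φ.rename f.lift)
  | _, _, f, .ex ρ φ => .ex ρ (φ.rename f.lift)

def Fm.subst : {Γ Δ : List Ty} → Sub Γ Δ → Fm Γ → Fm Δ
  | _, _, f, .eq s t => .eq (s.subst f) (t.subst f)
  | _, _, f, .and φ ψ => .and (φ.subst f) (ψ.subst f)
  | _, _, f, .or φ ψ => .or (φ.subst f) (ψ.subst f)
  | _, _, f, .imp φ ψ => .imp (φ.subst f) (ψ.subst f)
  | _, _, f, .all ρ φ => .all ρ (φ.subst f.lift)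
  | _, _, f, .ex ρ φ => .ex ρ (φ.subst f.lift)

/-- Weakening by one fresh variable. -/
def Fm.wk (φ : Fm Γ) : Fm (ρ :: Γ) := φ.rename (fun _ x => .succ x)

/-- Substitution of a term for the variable with index `0`. -/
def Fm.inst (φ : Fm (ρ :: Γ)) (t : Tm Γ ρ) : Fm Γ := φ.subst (Sub.single t)

/-- Quantification over all variables of a tuple. -/
def Fm.alls : (ρs : List Ty) → {Γ : List Ty} → Fm (ρs ++ Γ) → Fm Γ
  | [], _, φ => φ
  | ρ :: ρs, _, φ => Fm.alls ρs (.all ρ φ)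

def Fm.exs : (ρs : List Ty) → {Γ : List Ty} → Fm (ρs ++ Γ) → Fm Γ
  | [], _, φ => φ
  | ρ :: ρs, _, φ => Fm.exs ρs (.ex ρ φ)

/-! ### Defined relations -/

/-- `a ≤₀ b`. -/
def leN (a b : Tm Γ Ty.nat) : Fm Γ := .eq (monus a b) .zero
def leQ (p q : Tm Γ Ty.nat) : Fm Γ := .eq (leQChar p q) .zero
def ltQ (p q : Tm Γ Ty.nat) : Fm Γ := .eq (ltQChar p q) .zero

/-- `f =_ℝ g :≡ ∀ n, |f̂(n+1) - ĝ(n+1)| < 2^(-n)`. -/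
def eqR (f g : Tm Γ Ty.one) : Fm Γ :=
  .all Ty.nat (ltQ (absQ (subQ (hat f.wk (.suc v0)) (hat g.wk (.suc v0)))) (twoPowNegQ v0))

/-- `f <_ℝ g :≡ ∃ n, ĝ(n+1) - f̂(n+1) ≥ 2^(-n)`. -/
def ltR (f g : Tm Γ Ty.one) : Fm Γ :=
  .ex Ty.nat (leQ (twoPowNegQ v0) (subQ (hat g.wk (.suc v0)) (hat f.wk (.suc v0))))

/-- `f ≤_ℝ g :≡ ¬ (g <_ℝ f)`. -/
def leR (f g : Tm Γ Ty.one) : Fm Γ := .neg (ltR g f)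

/-- `x =_X y :≡ ‖x - y‖ =_ℝ 0`. -/
def eqX (x y : Tm Γ Ty.X) : Fm Γ := eqR (normX (subX x y)) zeroR

/-- Equality at all types, defined by pointwise equality. -/
def eqAt : (ρ : Ty) → {Γ : List Ty} → Tm Γ ρ → Tm Γ ρ → Fm Γ
  | .nat, _, s, t => .eq s t
  | .X, _, s, t => eqX s t
  | .fn ρ τ, _, s, t => .all ρ (eqAt τ (.app s.wk v0) (.app t.wk v0))

/-- `y ∈ A x :≡ χ_A x y = 0`. -/
def memA (y x : Tm Γ Ty.X) : Fm Γ := .eq (.app2 (.cst .chi) x y) .zero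

/-! ### Axioms -/

/-- The axioms of `A^ω = WE-PA^ω + QF-AC + DC`, for all types and formulas of the language (the
rule of quantifier-free extensionality is a rule of `Der` below). -/
inductive ArithAxiom : {Γ : List Ty} → Fm Γ → Prop
  /-- equality at type `0` -/
  | eq_refl {Γ : List Ty} (a : Tm Γ Ty.nat) : ArithAxiom (.eq a a)
  | eq_symm {Γ : List Ty} (a b : Tm Γ Ty.nat) : ArithAxiom (.imp (.eq a b) (.eq b a))
  | eq_trans {Γ : List Ty} (a b c : Tm Γ Ty.nat) :
      ArithAxiom (.imp (.and (.eq a b) (.eq b c)) (.eq a c))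
  /-- successor -/
  | succ_ne_zero {Γ : List Ty} (a : Tm Γ Ty.nat) : ArithAxiom (.neg (.eq (.suc a) .zero))
  | succ_inj {Γ : List Ty} (a b : Tm Γ Ty.nat) :
      ArithAxiom (.imp (.eq (.suc a) (.suc b)) (.eq a b))
  /-- induction for arbitrary formulas -/
  | induction {Γ : List Ty} (φ : Fm (Ty.nat :: Γ)) :
      ArithAxiom (.imp
        (.and (φ.inst .zero)
          (.all Ty.nat (.imp φ (φ.subst (Sub.cons (.suc v0) (fun _ x => .var (.succ x)))))))
        (.all Ty.nat φ))
  /-- the combinators -/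
  | proj {Γ : List Ty} {ρ τ : Ty} (x : Tm Γ ρ) (y : Tm Γ τ) :
      ArithAxiom (eqAt ρ (.app2 (.cst (.proj ρ τ)) x y) x)
  | comb {Γ : List Ty} {δ ρ τ : Ty} (x : Tm Γ (Ty.fn δ (Ty.fn ρ τ))) (y : Tm Γ (Ty.fn δ ρ))
      (z : Tm Γ δ) :
      ArithAxiom (eqAt τ (.app3 (.cst (.comb δ ρ τ)) x y z) (.app2 x z (.app y z)))
  /-- simultaneous recursion: `R_i 0 y z = y_i` and
  `R_i (S x) y z = z_i (R_1 x y z) … (R_k x y z) x` -/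
  | rec_zero {Γ : List Ty} (ρs : List Ty) {τ : Ty} (i : Var ρs τ) (y : Sub ρs Γ)
      (z : Sub (ρs.map (stepTy ρs)) Γ) :
      ArithAxiom (eqAt τ (.apps (.apps (.app (.cst (.recur ρs i)) .zero) y) z) (y τ i))
  | rec_succ {Γ : List Ty} (ρs : List Ty) {τ : Ty} (i : Var ρs τ) (x : Tm Γ Ty.nat)
      (y : Sub ρs Γ) (z : Sub (ρs.map (stepTy ρs)) Γ) :
      ArithAxiom (eqAt τ (.apps (.apps (.app (.cst (.recur ρs i)) (.suc x)) y) z)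
        (.app
          (Tm.apps (z _ (Var.map (stepTy ρs) i))
            (fun _ j => .apps (.apps (.app (.cst (.recur ρs j)) x) y) z))
          x))
  /-- `QF-AC : ∀ x ∃ y A₀(x, y) → ∃ Y ∀ x A₀(x, Y x)` for tuples, `A₀` quantifier-free -/
  | qf_ac {Γ : List Ty} (ρs σs : List Ty) (φ : Fm (σs ++ (ρs ++ Γ))) (hφ : φ.QF) :
      ArithAxiom (.imp (.alls ρs (.exs σs φ))
        (.exs (σs.map (arrows ρs)) (.alls ρs (φ.subst
          (Sub.append
            (fun _ y => Tm.apps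
              (.var (Var.inr ρs (Var.inl (Var.map (arrows ρs) y)))) (fun _ x => .var (Var.inl x)))
            (Sub.append
              (fun _ x => .var (Var.inl x))
              (fun _ w => .var (Var.inr ρs (Var.inr (σs.map (arrows ρs)) w)))))))))
  /-- `DC : ∀ x⁰, y ∃ z A(x, y, z) → ∃ f ∀ x⁰ A(x, f x, f (S x))` for tuples, `A` arbitrary -/
  | dc {Γ : List Ty} (ρs : List Ty) (φ : Fm (ρs ++ (ρs ++ (Ty.nat :: Γ)))) :
      ArithAxiom (.imp (.all Ty.nat (.alls ρs (.exs ρs φ)))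
        (.exs (ρs.map (Ty.fn Ty.nat)) (.all Ty.nat (φ.subst
          (Sub.append
            (fun _ z => .app (.var (.succ (Var.inl (Var.map (Ty.fn Ty.nat) z)))) (.suc v0))
            (Sub.append
              (fun _ y => .app (.var (.succ (Var.inl (Var.map (Ty.fn Ty.nat) y)))) v0)
              (Sub.cons v0
                (fun _ w => .var (.succ (Var.inr (ρs.map (Ty.fn Ty.nat)) w))))))))))

/-- The axioms stating that `X` is a real normed vector space with `‖1_X‖ = 1`, and the
parallelogram law. -/
inductive SpaceAxiom : {Γ : List Ty} → Fm Γ → Prop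
  /-- vector space axioms -/
  | add_assoc {Γ : List Ty} (x y z : Tm Γ Ty.X) :
      SpaceAxiom (eqX (addX x (addX y z)) (addX (addX x y) z))
  | add_comm {Γ : List Ty} (x y : Tm Γ Ty.X) : SpaceAxiom (eqX (addX x y) (addX y x))
  | add_zero {Γ : List Ty} (x : Tm Γ Ty.X) : SpaceAxiom (eqX (addX x zeroX) x)
  | add_neg {Γ : List Ty} (x : Tm Γ Ty.X) : SpaceAxiom (eqX (addX x (negX x)) zeroX)
  | one_smul {Γ : List Ty} (x : Tm Γ Ty.X) : SpaceAxiom (eqX (smulX oneR x) x)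
  | mul_smul {Γ : List Ty} (α β : Tm Γ Ty.one) (x : Tm Γ Ty.X) :
      SpaceAxiom (eqX (smulX α (smulX β x)) (smulX (mulR α β) x))
  | smul_add {Γ : List Ty} (α : Tm Γ Ty.one) (x y : Tm Γ Ty.X) :
      SpaceAxiom (eqX (smulX α (addX x y)) (addX (smulX α x) (smulX α y)))
  | add_smul {Γ : List Ty} (α β : Tm Γ Ty.one) (x : Tm Γ Ty.X) :
      SpaceAxiom (eqX (smulX (addR α β) x) (addX (smulX α x) (smulX β x)))
  /-- norm axioms -/
  | norm_sub_self {Γ : List Ty} (x : Tm Γ Ty.X) : SpaceAxiom (eqR (normX (subX x x)) zeroR)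
  | norm_sub_comm {Γ : List Ty} (x y : Tm Γ Ty.X) :
      SpaceAxiom (eqR (normX (subX x y)) (normX (subX y x)))
  | norm_triangle {Γ : List Ty} (x y z : Tm Γ Ty.X) :
      SpaceAxiom (leR (normX (subX x z)) (addR (normX (subX x y)) (normX (subX y z))))
  | norm_smul_sub {Γ : List Ty} (α : Tm Γ Ty.one) (x y : Tm Γ Ty.X) :
      SpaceAxiom (eqR (normX (subX (smulX α x) (smulX α y)))
        (mulR (absR α) (normX (subX x y))))
  | norm_sub_smul {Γ : List Ty} (α β : Tm Γ Ty.one) (x : Tm Γ Ty.X) :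
      SpaceAxiom (eqR (normX (subX (smulX α x) (smulX β x)))
        (mulR (absR (subR α β)) (normX x)))
  | norm_add_sub_add {Γ : List Ty} (x y u v : Tm Γ Ty.X) :
      SpaceAxiom (leR (normX (subX (addX x y) (addX u v)))
        (addR (normX (subX x u)) (normX (subX y v))))
  | norm_neg_sub_neg {Γ : List Ty} (x y : Tm Γ Ty.X) :
      SpaceAxiom (eqR (normX (subX (negX x) (negX y))) (normX (subX x y)))
  | abs_norm_sub_norm {Γ : List Ty} (x y : Tm Γ Ty.X) :
      SpaceAxiom (leR (absR (subR (normX x) (normX y))) (normX (subX x y)))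
  | norm_one {Γ : List Ty} : SpaceAxiom (eqR (normX (Γ := Γ) oneX) oneR)
  /-- parallelogram law -/
  | parallelogram {Γ : List Ty} (x y : Tm Γ Ty.X) :
      SpaceAxiom (eqR (addR (normSqX (addX x y)) (normSqX (subX x y)))
        (mulR twoR (addR (normSqX x) (normSqX y))))

/-- The axioms on the operator `A` and its resolvent. In the resolvent axiom
`γ > 0 → γ⁻¹ (x - J_γ x) ∈ A (J_γ x)`, the premise `γ > 0` and the reciprocal are written as
`γ > 2^(-l)` and `(γ)⁻¹_l` for an arbitrary number `l`. -/
inductive OperatorAxiom : {Γ : List Ty} → Fm Γ → Prop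
  | chi_le_one {Γ : List Ty} (x y : Tm Γ Ty.X) :
      OperatorAxiom (leN (.app2 (.cst .chi) x y) (.suc .zero))
  | resolvent {Γ : List Ty} (γ : Tm Γ Ty.one) (x : Tm Γ Ty.X) (l : Tm Γ Ty.nat) :
      OperatorAxiom (.imp (ltR (twoPowNegR l) γ)
        (memA (smulX (invR l γ) (subX x (resolvent γ x))) (resolvent γ x)))
  | accretive {Γ : List Ty} (x y u v : Tm Γ Ty.X) (lam : Tm Γ Ty.one) :
      OperatorAxiom (.imp (.and (memA u x) (memA v y))
        (leR (normX (subX x y)) (normX (addX (subX x y) (smulX (absR lam) (subX u v))))))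
  | gamma_pos {Γ : List Ty} :
      OperatorAxiom (leR (Γ := Γ) (twoPowNegR (.cst .mTilde)) (.cst .gammaTilde))

/-- The axioms of `T^ω = A^ω[X, ⟨·,·⟩, A, J^A]`. -/
def TAxiom {Γ : List Ty} (φ : Fm Γ) : Prop := ArithAxiom φ ∨ SpaceAxiom φ ∨ OperatorAxiom φ

/-! ### Derivability -/

/-- Derivability of `φ` from the open assumptions `H` in `T^ω`: classical many-sorted natural
deduction, the axioms, and the rule of quantifier-free extensionality, whose premise has to be
derived without open assumptions. -/
inductive Der : {Γ : List Ty} → List (Fm Γ) → Fm Γ → Prop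
  | hyp {Γ : List Ty} {H : List (Fm Γ)} {φ : Fm Γ} : φ ∈ H → Der H φ
  | ax {Γ : List Ty} {H : List (Fm Γ)} {φ : Fm Γ} : TAxiom φ → Der H φ
  | and_intro {Γ : List Ty} {H : List (Fm Γ)} {φ ψ : Fm Γ} :
      Der H φ → Der H ψ → Der H (.and φ ψ)
  | and_left {Γ : List Ty} {H : List (Fm Γ)} {φ ψ : Fm Γ} : Der H (.and φ ψ) → Der H φ
  | and_right {Γ : List Ty} {H : List (Fm Γ)} {φ ψ : Fm Γ} : Der H (.and φ ψ) → Der H ψ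
  | or_left {Γ : List Ty} {H : List (Fm Γ)} {φ ψ : Fm Γ} : Der H φ → Der H (.or φ ψ)
  | or_right {Γ : List Ty} {H : List (Fm Γ)} {φ ψ : Fm Γ} : Der H ψ → Der H (.or φ ψ)
  | or_elim {Γ : List Ty} {H : List (Fm Γ)} {φ ψ χ : Fm Γ} :
      Der H (.or φ ψ) → Der (φ :: H) χ → Der (ψ :: H) χ → Der H χ
  | imp_intro {Γ : List Ty} {H : List (Fm Γ)} {φ ψ : Fm Γ} :
      Der (φ :: H) ψ → Der H (.imp φ ψ)
  | imp_elim {Γ : List Ty} {H : List (Fm Γ)} {φ ψ : Fm Γ} :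
      Der H (.imp φ ψ) → Der H φ → Der H ψ
  | by_contra {Γ : List Ty} {H : List (Fm Γ)} {φ : Fm Γ} :
      Der (φ.neg :: H) .bot → Der H φ
  | all_intro {Γ : List Ty} {H : List (Fm Γ)} {ρ : Ty} {φ : Fm (ρ :: Γ)} :
      Der (H.map Fm.wk) φ → Der H (.all ρ φ)
  | all_elim {Γ : List Ty} {H : List (Fm Γ)} {ρ : Ty} {φ : Fm (ρ :: Γ)} (t : Tm Γ ρ) :
      Der H (.all ρ φ) → Der H (φ.inst t)
  | ex_intro {Γ : List Ty} {H : List (Fm Γ)} {ρ : Ty} {φ : Fm (ρ :: Γ)} (t : Tm Γ ρ) :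
      Der H (φ.inst t) → Der H (.ex ρ φ)
  | ex_elim {Γ : List Ty} {H : List (Fm Γ)} {ρ : Ty} {φ : Fm (ρ :: Γ)} {ψ : Fm Γ} :
      Der H (.ex ρ φ) → Der (φ :: H.map Fm.wk) ψ.wk → Der H ψ
  /-- `QF-ER`: from `A₀ → s = t` infer `A₀ → r[s/x] = r[t/x]`, for `A₀` quantifier-free. -/
  | qf_er {Γ : List Ty} {H : List (Fm Γ)} {ρ τ : Ty} {φ : Fm Γ} (hφ : φ.QF) {s t : Tm Γ ρ}
      (r : Tm (ρ :: Γ) τ) :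
      Der [] (.imp φ (eqAt ρ s t)) →
      Der H (.imp φ (eqAt τ (r.subst (Sub.single s)) (r.subst (Sub.single t))))

/-- `T^ω ⊢ φ`, for a sentence `φ`. -/
def TProves (φ : Fm []) : Prop := Der [] φ

/-! ### The seven sentences -/

/-- (1) `∀ x y x' y' (x = x' ∧ y = y' → χ_A x y = χ_A x' y')`. -/
def extensionality : Fm [] :=
  .all .X (.all .X (.all .X (.all .X
    (.imp (.and (eqX v3 v1) (eqX v2 v0))
      (.eq (.app2 (.cst .chi) v3 v2) (.app2 (.cst .chi) v1 v0))))))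

/-- (2) `∀ x p γ (γ > 0 ∧ p = J_γ x → γ⁻¹ (x - p) ∈ A p)`, with `γ > 0` and `γ⁻¹` written as
`γ > 2^(-l)` and `(γ)⁻¹_l`. -/
def strongResolvent : Fm [] :=
  .all .X (.all .X (.all .one (.all .nat
    (.imp (.and (ltR (twoPowNegR v0) v1) (eqX v2 (resolvent v1 v3)))
      (memA (smulX (invR v0 v1) (subX v3 v2)) v2)))))

/-- (3) `∀ x u (∀ y v λ (v ∈ A y → ‖x - y + |λ| (u - v)‖ ≥ ‖x - y‖) → u ∈ A x)`. -/
def maximalAccretivity : Fm [] :=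
  .all .X (.all .X (.imp
    (.all .X (.all .X (.all .one (.imp (memA v1 v2)
      (leR (normX (subX v4 v2))
        (normX (addX (subX v4 v2) (smulX (absR v0) (subX v3 v1)))))))))
    (memA v0 v1)))

/-- (4) `∀ x p (p = J_1 x → x - p ∈ A p)`. -/
def strongResolventOne : Fm [] :=
  .all .X (.all .X (.imp (eqX v0 (resolvent oneR v1)) (memA (subX v1 v0) v0)))

/-- (5) `∀ x u (∀ y v (v ∈ A y → ‖x - y + (u - v)‖ ≥ ‖x - y‖) → u ∈ A x)`. -/
def maximalAccretivityOne : Fm [] :=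
  .all .X (.all .X (.imp
    (.all .X (.all .X (.imp (memA v0 v1)
      (leR (normX (subX v3 v1)) (normX (addX (subX v3 v1) (subX v2 v0)))))))
    (memA v0 v1)))

/-- `x_n → x :≡ ∀ k ∃ N ∀ m ≥ N (‖x_m - x‖ ≤ 2^(-k))`. -/
def convergesX (s : Tm Γ (Ty.fn .nat .X)) (x : Tm Γ .X) : Fm Γ :=
  .all .nat (.ex .nat (.all .nat (.imp (leN v1 v0)
    (leR (normX (subX (.app s.wk.wk.wk v0) x.wk.wk.wk)) (twoPowNegR v2)))))

/-- (6) `∀ x y (x_n) (y_n) (x_n → x ∧ y_n → y ∧ ∀ n (y_n ∈ A x_n) → y ∈ A x)`. -/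
def closedGraph : Fm [] :=
  .all .X (.all .X (.all (.fn .nat .X) (.all (.fn .nat .X)
    (.imp
      (.and (convergesX v1 v3) (.and (convergesX v0 v2)
        (.all .nat (memA (.app v1 v0) (.app v2 v0)))))
      (memA v2 v3)))))

/-- (7) `∀ x u (∀ y v (v ∈ A y → ⟨x - y, u - v⟩ ≥ 0) → u ∈ A x)`. -/
def maximalMonotonicity : Fm [] :=
  .all .X (.all .X (.imp
    (.all .X (.all .X (.imp (memA v0 v1) (leR zeroR (innerX (subX v3 v1) (subX v2 v0))))))
    (memA v0 v1)))

/-- The sentences (1)-(7). -/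
def item : Fin 7 → Fm [] :=
  ![extensionality, strongResolvent, maximalAccretivity, strongResolventOne,
    maximalAccretivityOne, closedGraph, maximalMonotonicity]

end FiniteType

namespace FiniteType

variable {Γ Δ Θ : List Ty} {ρ σ τ δ : Ty}

set_option linter.unusedSectionVars false

/-! ### Calculus of renamings and substitutions -/

/-! The proof is semantic. By the completeness theorem `Der.of_models` it suffices that the seven
sentences are equivalent in every model, and there the usual arguments about accretive and monotone
operators can be carried out.

The delicate point is the notion of model. Only the rule of quantifier-free extensionality is
available, so `=_X` must not be interpreted as identity: `χ_A` may distinguish two points at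
distance zero, and this is what the theorem is about. Yet terms whose equality is derivable from a
true quantifier-free premise have to be interchangeable inside `χ_A`. In a model (`IsModel`) the
type `X` is therefore a set carrying only a seminorm, but the equations obtained from the rule hold
as true identities. Such models come from a Henkin construction: contexts grow by one witness
variable at a time, and terms over the chain are identified when a true quantifier-free formula
provably implies their equality (`TmEq`). The truth lemma is `termModel_sat`. One consequence is
used again and again: the provable equations of `X` hold literally in each model. In particular `X`
is an abelian group on the nose, and by completeness an `=_X`-equation valid in all models is a
literal identity in each of them (`eval_eq_of_models`). This is how the scalars `|1|` and `1⁻¹` are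
removed inside the non-extensional predicate `Mem`.

To reason in a model one has to read the coded real numbers. The type `0` objects form a discretely
ordered semiring, possibly nonstandard; it has an ordered field of fractions `K`, and codes of
rationals evaluate to elements of `K`. Real numbers live in the ordered ring `R` of bounded external
sequences in `K` modulo those that are null along an ultrafilter refining `atTop`, which needs no
completeness of the model. The value `lim f` is the class of the approximations of `f`; `sat_eqR`,
`sat_ltR`, `sat_leR` and `lim_addR`, `lim_mulR` and their analogues translate the formal relations
and operations into those of `R`.

With this dictionary the mathematics is short. Extensionality transfers the resolvent axiom to every
`p` at distance zero from the resolvent. The case `γ = 1` gives maximality: for a pair `(x, u)`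
accretive against the graph take `p = J_1 (x + u)`; then `x + u - p ∈ A p`, and accretivity forces
`‖x - p‖ ≤ 0`, so `u ∈ A x`. Maximality implies closedness by passing to the limit in the
accretivity inequality, and closedness implies extensionality through constant sequences.
Monotonicity enters through the parallelogram law: it implies accretivity by expanding `‖x + y‖²`,
and it follows from accretivity with small dyadic scalars (`polar_nonneg_of_accretive`). -/

theorem Ren.lift_comp (f : Ren Γ Δ) (g : Ren Δ Θ) :
    (fun τ x => Ren.lift (ρ := ρ) g τ (Ren.lift (ρ := ρ) f τ x)) =
      Ren.lift (ρ := ρ) (fun τ x => g τ (f τ x)) := by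
  funext τ x; cases x <;> rfl

theorem Ren.lift_id : Ren.lift (ρ := ρ) (fun τ (x : Var Γ τ) => x) = fun _ x => x := by
  funext τ x; cases x <;> rfl

theorem Tm.rename_rename (f : Ren Γ Δ) (g : Ren Δ Θ) (t : Tm Γ τ) :
    (t.rename f).rename g = t.rename (fun τ x => g τ (f τ x)) := by
  induction t with
  | var x => rfl
  | cst c => rfl
  | app s t hs ht => simp only [Tm.rename, hs, ht]

theorem Tm.rename_id (t : Tm Γ τ) : t.rename (fun _ x => x) = t := by
  induction t with
  | var x => rfl
  | cst c => rfl
  | app s t hs ht => simp only [Tm.rename, hs, ht]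

theorem Tm.subst_rename (f : Ren Γ Δ) (g : Sub Δ Θ) (t : Tm Γ τ) :
    (t.rename f).subst g = t.subst (fun τ x => g τ (f τ x)) := by
  induction t with
  | var x => rfl
  | cst c => rfl
  | app s t hs ht => simp only [Tm.rename, Tm.subst, hs, ht]

theorem Tm.rename_subst (f : Sub Γ Δ) (g : Ren Δ Θ) (t : Tm Γ τ) :
    (t.subst f).rename g = t.subst (fun τ x => (f τ x).rename g) := by
  induction t with
  | var x => rfl
  | cst c => rfl
  | app s t hs ht => simp only [Tm.rename, Tm.subst, hs, ht]

theorem Tm.subst_subst (f : Sub Γ Δ) (g : Sub Δ Θ) (t : Tm Γ τ) :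
    (t.subst f).subst g = t.subst (fun τ x => (f τ x).subst g) := by
  induction t with
  | var x => rfl
  | cst c => rfl
  | app s t hs ht => simp only [Tm.subst, hs, ht]

theorem Tm.subst_var (t : Tm Γ τ) : t.subst (fun _ x => .var x) = t := by
  induction t with
  | var x => rfl
  | cst c => rfl
  | app s t hs ht => simp only [Tm.subst, hs, ht]

theorem Tm.rename_eq_subst (f : Ren Γ Δ) (t : Tm Γ τ) :
    t.rename f = t.subst (fun τ x => .var (f τ x)) := by
  induction t with
  | var x => rfl
  | cst c => rfl
  | app s t hs ht => simp only [Tm.rename, Tm.subst, hs, ht]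

@[simp] theorem Tm.wk_rename_lift (f : Ren Γ Δ) (t : Tm Γ τ) :
    (t.wk (ρ := ρ)).rename f.lift = (t.rename f).wk := by
  simp only [Tm.wk, Tm.rename_rename]; rfl

@[simp] theorem Tm.wk_subst_lift (f : Sub Γ Δ) (t : Tm Γ τ) :
    (t.wk (ρ := ρ)).subst f.lift = (t.subst f).wk := by
  simp only [Tm.wk, Tm.subst_rename, Tm.rename_subst]; rfl

@[simp] theorem Tm.wk_subst_single (s : Tm Γ ρ) (t : Tm Γ τ) :
    t.wk.subst (Sub.single s) = t := by
  simp only [Tm.wk, Tm.subst_rename]; exact Tm.subst_var t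

@[simp] theorem Tm.closed_rename (t : Tm [] τ) (f : Ren Γ Δ) :
    (t.closed : Tm Γ τ).rename f = t.closed := by
  simp only [Tm.closed, Tm.rename_rename]
  congr 1; funext τ x; nomatch x

@[simp] theorem Tm.closed_subst (t : Tm [] τ) (f : Sub Γ Δ) :
    (t.closed : Tm Γ τ).subst f = t.closed := by
  rw [Tm.closed, Tm.closed, Tm.subst_rename, Tm.rename_eq_subst]
  congr 1; funext τ x; nomatch x

theorem Sub.lift_comp_ren (f : Ren Γ Δ) (g : Sub Δ Θ) :
    (fun τ x => Sub.lift (ρ := ρ) g τ (Ren.lift (ρ := ρ) f τ x)) =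
      Sub.lift (ρ := ρ) (fun τ x => g τ (f τ x)) := by
  funext τ x; cases x <;> rfl

theorem Sub.lift_rename (f : Sub Γ Δ) (g : Ren Δ Θ) :
    (fun τ x => (Sub.lift (ρ := ρ) f τ x).rename (Ren.lift (ρ := ρ) g)) =
      Sub.lift (ρ := ρ) (fun τ x => (f τ x).rename g) := by
  funext τ x
  cases x with
  | zero => rfl
  | succ x => exact Tm.wk_rename_lift g (f τ x)

theorem Sub.lift_subst (f : Sub Γ Δ) (g : Sub Δ Θ) :
    (fun τ x => (Sub.lift (ρ := ρ) f τ x).subst (Sub.lift (ρ := ρ) g)) =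
      Sub.lift (ρ := ρ) (fun τ x => (f τ x).subst g) := by
  funext τ x
  cases x with
  | zero => rfl
  | succ x => exact Tm.wk_subst_lift g (f τ x)

theorem Sub.lift_var : Sub.lift (ρ := ρ) (fun τ (x : Var Γ τ) => Tm.var x) = fun _ x => .var x := by
  funext τ x; cases x <;> rfl

theorem Fm.rename_rename (φ : Fm Γ) : ∀ {Δ Θ : List Ty} (f : Ren Γ Δ) (g : Ren Δ Θ),
    (φ.rename f).rename g = φ.rename (fun τ x => g τ (f τ x)) := by
  induction φ <;> intros <;>
    simp_all only [Fm.rename, Tm.rename_rename, Ren.lift_comp]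

theorem Fm.rename_id (φ : Fm Γ) : φ.rename (fun _ x => x) = φ := by
  induction φ <;> simp_all only [Fm.rename, Tm.rename_id, Ren.lift_id]

theorem Fm.subst_rename (φ : Fm Γ) : ∀ {Δ Θ : List Ty} (f : Ren Γ Δ) (g : Sub Δ Θ),
    (φ.rename f).subst g = φ.subst (fun τ x => g τ (f τ x)) := by
  induction φ <;> intros <;>
    simp_all only [Fm.rename, Fm.subst, Tm.subst_rename, Sub.lift_comp_ren]

theorem Fm.rename_subst (φ : Fm Γ) : ∀ {Δ Θ : List Ty} (f : Sub Γ Δ) (g : Ren Δ Θ),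
    (φ.subst f).rename g = φ.subst (fun τ x => (f τ x).rename g) := by
  induction φ <;> intros <;>
    simp_all only [Fm.rename, Fm.subst, Tm.rename_subst, Sub.lift_rename]

theorem Fm.subst_subst (φ : Fm Γ) : ∀ {Δ Θ : List Ty} (f : Sub Γ Δ) (g : Sub Δ Θ),
    (φ.subst f).subst g = φ.subst (fun τ x => (f τ x).subst g) := by
  induction φ <;> intros <;>
    simp_all only [Fm.subst, Tm.subst_subst, Sub.lift_subst]

theorem Fm.subst_var (φ : Fm Γ) : φ.subst (fun _ x => .var x) = φ := by
  induction φ <;> simp_all only [Fm.subst, Tm.subst_var, Sub.lift_var]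

theorem Fm.wk_rename_lift (f : Ren Γ Δ) (φ : Fm Γ) :
    (φ.wk (ρ := ρ)).rename f.lift = (φ.rename f).wk := by
  simp only [Fm.wk, Fm.rename_rename]; rfl

theorem Fm.wk_subst_single (t : Tm Γ ρ) (φ : Fm Γ) : φ.wk.inst t = φ := by
  simp only [Fm.wk, Fm.inst, Fm.subst_rename]; exact Fm.subst_var φ

theorem Sub.single_rename (f : Ren Γ Δ) (t : Tm Γ ρ) :
    (fun τ x => (Sub.single t τ x).rename f) =
      fun τ x => Sub.single (t.rename f) τ (Ren.lift (ρ := ρ) f τ x) := by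
  funext τ x; cases x <;> rfl

theorem Fm.inst_rename (f : Ren Γ Δ) (φ : Fm (ρ :: Γ)) (t : Tm Γ ρ) :
    (φ.inst t).rename f = (φ.rename f.lift).inst (t.rename f) := by
  simp only [Fm.inst, Fm.rename_subst, Fm.subst_rename, Sub.single_rename]

theorem Tm.subst_single_rename (f : Ren Γ Δ) (r : Tm (ρ :: Γ) τ) (t : Tm Γ ρ) :
    (r.subst (Sub.single t)).rename f = (r.rename f.lift).subst (Sub.single (t.rename f)) := by
  simp only [Tm.rename_subst, Tm.subst_rename, Sub.single_rename]

theorem Fm.QF.rename {φ : Fm Γ} (h : φ.QF) (f : Ren Γ Δ) : (φ.rename f).QF := by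
  induction φ generalizing Δ with
  | eq => trivial
  | and φ ψ hφ hψ => exact ⟨hφ h.1 f, hψ h.2 f⟩
  | or φ ψ hφ hψ => exact ⟨hφ h.1 f, hψ h.2 f⟩
  | imp φ ψ hφ hψ => exact ⟨hφ h.1 f, hψ h.2 f⟩
  | all => exact h.elim
  | ex => exact h.elim

theorem eqAt_subst : ∀ (ρ : Ty) {Γ Δ : List Ty} (f : Sub Γ Δ) (s t : Tm Γ ρ),
    (eqAt ρ s t).subst f = eqAt ρ (s.subst f) (t.subst f)
  | .nat, _, _, _, _, _ => rfl
  | .X, _, _, f, s, t => by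
    simp [eqAt, eqX, eqR, Fm.subst, ltQ, ltQChar, absQ, subQ, addQ, negateQ, hat, twoPowNegQ, mkQ,
      pow2, zeroR, constR, natQ, Tm.subst, Sub.lift]
  | .fn ρ τ, _, _, f, s, t => by
    simp only [eqAt, Fm.subst, eqAt_subst τ, Tm.subst, Tm.wk_subst_lift]; rfl

theorem Fm.rename_eq_subst (φ : Fm Γ) : ∀ {Δ : List Ty} (f : Ren Γ Δ),
    φ.rename f = φ.subst (fun τ x => .var (f τ x)) := by
  intro Δ f
  rw [← Fm.subst_var (φ.rename f), Fm.subst_rename]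

theorem eqAt_rename (f : Ren Γ Δ) (s t : Tm Γ ρ) :
    (eqAt ρ s t).rename f = eqAt ρ (s.rename f) (t.rename f) := by
  simp only [Fm.rename_eq_subst, eqAt_subst, Tm.rename_eq_subst]

/-! ### Tuples -/

theorem Tm.apps_rename (f : Ren Γ Δ) : ∀ {ρs : List Ty} {τ : Ty} (t : Tm Γ (arrows ρs τ))
    (g : Sub ρs Γ), (t.apps g).rename f = (t.rename f).apps (fun _ x => (g _ x).rename f)
  | [], _, _, _ => rfl
  | ρ :: ρs, _, t, g => Tm.apps_rename f (ρs := ρs) (.app t (g ρ .zero)) fun _ x => g _ (.succ x)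

/-- Lifting of a renaming to a tuple of fresh variables. -/
def Ren.lifts (f : Ren Γ Δ) : (ρs : List Ty) → Ren (ρs ++ Γ) (ρs ++ Δ)
  | [] => f
  | _ :: ρs => (Ren.lifts f ρs).lift

theorem Fm.alls_rename : ∀ (ρs : List Ty) {Γ Δ : List Ty} (f : Ren Γ Δ) (φ : Fm (ρs ++ Γ)),
    (Fm.alls ρs φ).rename f = Fm.alls ρs (φ.rename (f.lifts ρs))
  | [], _, _, _, _ => rfl
  | _ :: ρs, _, _, f, _ => Fm.alls_rename ρs f _

theorem Fm.exs_rename : ∀ (ρs : List Ty) {Γ Δ : List Ty} (f : Ren Γ Δ) (φ : Fm (ρs ++ Γ)),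
    (Fm.exs ρs φ).rename f = Fm.exs ρs (φ.rename (f.lifts ρs))
  | [], _, _, _, _ => rfl
  | _ :: ρs, _, _, f, _ => Fm.exs_rename ρs f _

@[simp] theorem Ren.lifts_inl (f : Ren Γ Δ) : ∀ {ρs : List Ty} {τ : Ty} (x : Var ρs τ),
    f.lifts ρs τ (Var.inl x) = Var.inl x
  | _ :: _, _, .zero => rfl
  | _ :: _, _, .succ x => congrArg Var.succ (Ren.lifts_inl f x)

@[simp] theorem Ren.lifts_inr (f : Ren Γ Δ) : ∀ (ρs : List Ty) {τ : Ty} (x : Var Γ τ),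
    f.lifts ρs τ (Var.inr ρs x) = Var.inr ρs (f τ x)
  | [], _, _ => rfl
  | _ :: ρs, _, x => congrArg Var.succ (Ren.lifts_inr f ρs x)

@[simp] theorem Sub.append_inl : ∀ {Γ₁ Γ₂ : List Ty} (f : Sub Γ₁ Δ) (g : Sub Γ₂ Δ) {τ : Ty}
    (x : Var Γ₁ τ), Sub.append f g τ (Var.inl x) = f τ x
  | _ :: _, _, _, _, _, .zero => rfl
  | _ :: _, _, f, g, _, .succ x => Sub.append_inl (fun _ x => f _ (.succ x)) g x

@[simp] theorem Sub.append_inr : ∀ {Γ₁ Γ₂ : List Ty} (f : Sub Γ₁ Δ) (g : Sub Γ₂ Δ) {τ : Ty}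
    (x : Var Γ₂ τ), Sub.append f g τ (Var.inr Γ₁ x) = g τ x
  | [], _, _, _, _, _ => rfl
  | _ :: _, _, f, g, _, x => Sub.append_inr (fun _ x => f _ (.succ x)) g x

theorem Var.append_cases : ∀ {Γ₁ Γ₂ : List Ty} {τ : Ty} (x : Var (Γ₁ ++ Γ₂) τ),
    (∃ y : Var Γ₁ τ, x = Var.inl y) ∨ ∃ y : Var Γ₂ τ, x = Var.inr Γ₁ y
  | [], _, _, x => .inr ⟨x, rfl⟩
  | _ :: _, _, _, .zero => .inl ⟨.zero, rfl⟩
  | _ :: _, _, _, .succ x => by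
    rcases Var.append_cases x with ⟨y, rfl⟩ | ⟨y, rfl⟩
    · exact .inl ⟨.succ y, rfl⟩
    · exact .inr ⟨y, rfl⟩

theorem Sub.append_ext {Γ₁ Γ₂ : List Ty} {f g : Sub (Γ₁ ++ Γ₂) Δ}
    (h₁ : ∀ τ (x : Var Γ₁ τ), f τ (Var.inl x) = g τ (Var.inl x))
    (h₂ : ∀ τ (x : Var Γ₂ τ), f τ (Var.inr Γ₁ x) = g τ (Var.inr Γ₁ x)) : f = g := by
  funext τ x
  rcases Var.append_cases x with ⟨y, rfl⟩ | ⟨y, rfl⟩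
  · exact h₁ _ _
  · exact h₂ _ _

/-! ### Axioms and derivations are closed under renaming -/

theorem ArithAxiom.rename {φ : Fm Γ} (h : ArithAxiom φ) (f : Ren Γ Δ) :
    ArithAxiom (φ.rename f) := by
  cases h with
  | eq_refl a => exact .eq_refl _
  | eq_symm a b => exact .eq_symm _ _
  | eq_trans a b c => exact .eq_trans _ _ _
  | succ_ne_zero a => exact .succ_ne_zero _
  | succ_inj a b => exact .succ_inj _ _
  | induction φ =>
    have := ArithAxiom.induction (φ.rename f.lift)
    convert this using 1
    simp only [Fm.rename, Fm.inst_rename, Fm.rename_subst, Fm.subst_rename]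
    congr 5
    funext τ x
    cases x <;> rfl
  | proj x y => rw [eqAt_rename]; exact .proj _ _
  | comb x y z => rw [eqAt_rename]; exact .comb _ _ _
  | rec_zero ρs i y z =>
    simp only [eqAt_rename, Tm.apps_rename, Tm.rename]
    exact .rec_zero ρs i (fun _ x => (y _ x).rename f) (fun _ x => (z _ x).rename f)
  | rec_succ ρs i x y z =>
    simp only [eqAt_rename, Tm.apps_rename, Tm.rename]
    exact .rec_succ ρs i (x.rename f) (fun _ x => (y _ x).rename f) (fun _ x => (z _ x).rename f)
  | qf_ac ρs σs φ hφ =>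
    have := ArithAxiom.qf_ac ρs σs _ (hφ.rename ((f.lifts ρs).lifts σs))
    convert this using 1
    simp only [Fm.rename, Fm.alls_rename, Fm.exs_rename, Fm.rename_subst, Fm.subst_rename]
    congr 4
    refine Sub.append_ext (fun τ x => ?_) fun τ x => ?_
    · simp [Tm.apps_rename, Tm.rename]
    · rcases Var.append_cases x with ⟨y, rfl⟩ | ⟨y, rfl⟩ <;> simp [Tm.rename]
  | dc ρs φ =>
    have := ArithAxiom.dc ρs (φ.rename ((f.lift.lifts ρs).lifts ρs))
    convert this using 1
    simp only [Fm.rename, Fm.alls_rename, Fm.exs_rename, Fm.rename_subst, Fm.subst_rename]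
    congr 4
    refine Sub.append_ext (fun τ x => ?_) fun τ x => ?_
    · simp [Tm.rename, Ren.lift]
    · rcases Var.append_cases x with ⟨y, rfl⟩ | ⟨y, rfl⟩
      · simp [Tm.rename, Ren.lift]
      · cases y <;> simp [Tm.rename, Ren.lift, Sub.cons]

theorem leR_rename (f : Ren Γ Δ) (s t : Tm Γ Ty.one) :
    (leR s t).rename f = leR (s.rename f) (t.rename f) := by
  simp [leR, ltR, Fm.neg, Fm.bot, Fm.rename, leQ, leQChar, subQ, addQ, negateQ, hat, twoPowNegQ,
    mkQ, pow2, Tm.rename, Ren.lift]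

theorem eqR_rename (f : Ren Γ Δ) (s t : Tm Γ Ty.one) :
    (eqR s t).rename f = eqR (s.rename f) (t.rename f) := by
  simp [eqR, Fm.rename, ltQ, ltQChar, absQ, subQ, addQ, negateQ, hat, twoPowNegQ,
    mkQ, pow2, Tm.rename, Ren.lift]

theorem SpaceAxiom.rename {φ : Fm Γ} (h : SpaceAxiom φ) (f : Ren Γ Δ) :
    SpaceAxiom (φ.rename f) := by
  cases h <;>
    simp only [eqX, eqR_rename, leR_rename, normSqX, mulR, addR, subR, negR, absR, oneR, twoR,
      zeroR, constR, natQ, mkQ, Tm.rename, Tm.closed_rename] <;>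
    constructor

theorem OperatorAxiom.rename {φ : Fm Γ} (h : OperatorAxiom φ) (f : Ren Γ Δ) :
    OperatorAxiom (φ.rename f) := by
  cases h with
  | chi_le_one x y =>
    simp only [leN, monus, Fm.rename, Tm.rename, Tm.closed_rename]
    exact .chi_le_one _ _
  | resolvent γ x l =>
    have := OperatorAxiom.resolvent (γ.rename f) (x.rename f) (l.rename f)
    convert this using 1
    simp [ltR, Fm.rename, leQ, leQChar, subQ, addQ, negateQ, hat, twoPowNegQ, twoPowNegR, constR,
      memA, invR, mkQ, pow2, Tm.rename, Ren.lift]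
  | accretive x y u v lam =>
    simp only [Fm.rename, leR_rename, absR, memA, Tm.rename, Tm.closed_rename]
    exact .accretive _ _ _ _ _
  | gamma_pos =>
    simp only [leR_rename, twoPowNegR, constR, twoPowNegQ, mkQ, pow2, Tm.rename, Tm.closed_rename]
    exact .gamma_pos

theorem TAxiom.rename {φ : Fm Γ} (h : TAxiom φ) (f : Ren Γ Δ) : TAxiom (φ.rename f) :=
  h.imp (·.rename f) (Or.imp (·.rename f) (·.rename f))

theorem map_wk_rename (f : Ren Γ Δ) (H : List (Fm Γ)) :
    (H.map (Fm.wk (ρ := ρ))).map (Fm.rename f.lift) = (H.map (Fm.rename f)).map Fm.wk := by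
  simp only [List.map_map, Function.comp_def, Fm.wk_rename_lift]

/-- This moves derivations along the growing contexts of the Henkin chain. It rests on all axiom
schemes being given in arbitrary contexts, with terms as parameters. -/
theorem Der.rename {H : List (Fm Γ)} {φ : Fm Γ} (h : Der H φ) :
    ∀ {Δ : List Ty} (f : Ren Γ Δ), Der (H.map (Fm.rename f)) (φ.rename f) := by
  induction h with
  | hyp h => exact fun f => .hyp (List.mem_map_of_mem h)
  | ax h => exact fun f => .ax (h.rename f)
  | and_intro _ _ h₁ h₂ => exact fun f => .and_intro (h₁ f) (h₂ f)
  | and_left _ h => exact fun f => .and_left (h f)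
  | and_right _ h => exact fun f => .and_right (h f)
  | or_left _ h => exact fun f => .or_left (h f)
  | or_right _ h => exact fun f => .or_right (h f)
  | or_elim _ _ _ h h₁ h₂ => exact fun f => .or_elim (h f) (h₁ f) (h₂ f)
  | imp_intro _ h => exact fun f => .imp_intro (h f)
  | imp_elim _ _ h₁ h₂ => exact fun f => .imp_elim (h₁ f) (h₂ f)
  | by_contra _ h => exact fun f => .by_contra (h f)
  | all_intro _ h => exact fun f => .all_intro (map_wk_rename f _ ▸ h f.lift)
  | all_elim t _ h => exact fun f => Fm.inst_rename f _ t ▸ .all_elim (t.rename f) (h f)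
  | ex_intro t _ h => exact fun f => .ex_intro (t.rename f) (Fm.inst_rename f _ t ▸ h f)
  | ex_elim _ _ h h₁ =>
    intro Δ f
    have := h₁ f.lift
    rw [Fm.wk_rename_lift, List.map_cons, map_wk_rename] at this
    exact .ex_elim (h f) this
  | qf_er hφ r _ h =>
    intro Δ f
    have := h f
    simp only [Fm.rename, eqAt_rename, Tm.subst_single_rename] at this ⊢
    exact .qf_er (hφ.rename f) _ this

/-- The extensionality rule is unaffected by added assumptions, because its premise is derived from
none. -/
theorem Der.mono {H : List (Fm Γ)} {φ : Fm Γ} (h : Der H φ) :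
    ∀ {H' : List (Fm Γ)}, H ⊆ H' → Der H' φ := by
  induction h with
  | hyp h => exact fun hs => .hyp (hs h)
  | ax h => exact fun _ => .ax h
  | and_intro _ _ h₁ h₂ => exact fun hs => .and_intro (h₁ hs) (h₂ hs)
  | and_left _ h => exact fun hs => .and_left (h hs)
  | and_right _ h => exact fun hs => .and_right (h hs)
  | or_left _ h => exact fun hs => .or_left (h hs)
  | or_right _ h => exact fun hs => .or_right (h hs)
  | or_elim _ _ _ h h₁ h₂ =>
    exact fun hs => .or_elim (h hs) (h₁ (List.cons_subset_cons _ hs))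
      (h₂ (List.cons_subset_cons _ hs))
  | imp_intro _ h => exact fun hs => .imp_intro (h (List.cons_subset_cons _ hs))
  | imp_elim _ _ h₁ h₂ => exact fun hs => .imp_elim (h₁ hs) (h₂ hs)
  | by_contra _ h => exact fun hs => .by_contra (h (List.cons_subset_cons _ hs))
  | all_intro _ h => exact fun hs => .all_intro (h (List.map_subset _ hs))
  | all_elim t _ h => exact fun hs => .all_elim t (h hs)
  | ex_intro t _ h => exact fun hs => .ex_intro t (h hs)
  | ex_elim _ _ h h₁ =>
    exact fun hs => .ex_elim (h hs) (h₁ (List.cons_subset_cons _ (List.map_subset _ hs)))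
  | qf_er hφ r h _ => exact fun _ => .qf_er hφ r h

theorem Der.wk {φ : Fm Γ} (h : Der [] φ) : Der [] (φ.wk (ρ := ρ)) := h.rename _

/-! ### The language is countable -/

def Ty.code : Ty → ℕ
  | .nat => Nat.pair 0 0
  | .X => Nat.pair 1 0
  | .fn ρ τ => Nat.pair 2 (Nat.pair ρ.code τ.code)

theorem Ty.code_injective : ∀ {ρ τ : Ty}, ρ.code = τ.code → ρ = τ
  | .nat, τ, h => by cases τ <;> simp [Ty.code, Nat.pair_eq_pair] at h ⊢
  | .X, τ, h => by cases τ <;> simp [Ty.code, Nat.pair_eq_pair] at h ⊢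
  | .fn ρ σ, τ, h => by
    cases τ <;> simp [Ty.code, Nat.pair_eq_pair] at h ⊢
    exact ⟨Ty.code_injective h.1, Ty.code_injective h.2⟩

instance : Countable Ty := Function.Injective.countable fun _ _ => Ty.code_injective

def Var.code : {Γ : List Ty} → {τ : Ty} → Var Γ τ → ℕ
  | _, _, .zero => 0
  | _, _, .succ x => x.code + 1

theorem Var.code_injective : ∀ {Γ : List Ty} {τ τ' : Ty} (x : Var Γ τ) (y : Var Γ τ'),
    x.code = y.code → (⟨τ, x⟩ : Σ τ, Var Γ τ) = ⟨τ', y⟩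
  | _, _, _, .zero, .zero, _ => rfl
  | _, _, _, .zero, .succ y, h => by simp [Var.code] at h
  | _, _, _, .succ x, .zero, h => by simp [Var.code] at h
  | _, _, _, .succ x, .succ y, h => by
    have := Var.code_injective x y (by simpa [Var.code] using h)
    cases this
    rfl

def Cst.code : Cst τ → ℕ
  | .zero => Nat.pair 0 0
  | .succ => Nat.pair 1 0
  | .proj ρ τ => Nat.pair 2 (Nat.pair ρ.code τ.code)
  | .comb δ ρ τ => Nat.pair 3 (Nat.pair δ.code (Nat.pair ρ.code τ.code))
  | .recur ρs i => Nat.pair 4 (Nat.pair (Encodable.encode (ρs.map Ty.code)) i.code)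
  | .zeroX => Nat.pair 5 0
  | .oneX => Nat.pair 6 0
  | .addX => Nat.pair 7 0
  | .negX => Nat.pair 8 0
  | .smulX => Nat.pair 9 0
  | .normX => Nat.pair 10 0
  | .chi => Nat.pair 11 0
  | .res => Nat.pair 12 0
  | .gammaTilde => Nat.pair 13 0
  | .mTilde => Nat.pair 14 0
  | .pointX => Nat.pair 15 0

theorem Cst.code_injective {τ τ' : Ty} (c : Cst τ) (d : Cst τ') (h : c.code = d.code) :
    (⟨τ, c⟩ : Σ τ, Cst τ) = ⟨τ', d⟩ := by
  cases c <;> cases d <;> simp only [Cst.code, Nat.pair_eq_pair] at h <;>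
    first
    | rfl
    | exact absurd h.1 (by decide)
    | (obtain ⟨-, h₁, h₂⟩ := h
       obtain rfl := Ty.code_injective h₁
       obtain rfl := Ty.code_injective h₂
       rfl)
    | (obtain ⟨-, h₁, h₂, h₃⟩ := h
       obtain rfl := Ty.code_injective h₁
       obtain rfl := Ty.code_injective h₂
       obtain rfl := Ty.code_injective h₃
       rfl)
    | (obtain ⟨-, h₁, h₂⟩ := h
       obtain rfl := List.map_injective_iff.2 (fun _ _ => Ty.code_injective)
         (Encodable.encode_injective h₁)
       cases Var.code_injective _ _ h₂
       rfl)

def Tm.code : {τ : Ty} → Tm Γ τ → ℕ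
  | _, .var x => Nat.pair 0 x.code
  | _, .cst c => Nat.pair 1 c.code
  | _, .app s t => Nat.pair 2 (Nat.pair (Tm.code s) (Tm.code t))

/-- An application hides the type of its argument, so the induction has to recover types from codes
as well; hence the comparison of terms of different types in a sigma type. -/
theorem Tm.code_injective {τ : Ty} (s : Tm Γ τ) : ∀ {τ' : Ty} (t : Tm Γ τ'),
    s.code = t.code → (⟨τ, s⟩ : Σ τ, Tm Γ τ) = ⟨τ', t⟩ := by
  induction s with
  | var x =>
    intro τ' t h
    cases t <;> simp only [Tm.code, Nat.pair_eq_pair] at h <;> try exact absurd h.1 (by decide)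
    cases Var.code_injective _ _ h.2
    rfl
  | cst c =>
    intro τ' t h
    cases t <;> simp only [Tm.code, Nat.pair_eq_pair] at h <;> try exact absurd h.1 (by decide)
    cases Cst.code_injective _ _ h.2
    rfl
  | app s₁ s₂ ih₁ ih₂ =>
    intro τ' t h
    cases t <;> simp only [Tm.code, Nat.pair_eq_pair] at h <;> try exact absurd h.1 (by decide)
    cases ih₁ _ h.2.1
    cases ih₂ _ h.2.2
    rfl

def Fm.code : {Γ : List Ty} → Fm Γ → ℕ
  | _, .eq s t => Nat.pair 0 (Nat.pair s.code t.code)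
  | _, .and φ ψ => Nat.pair 1 (Nat.pair φ.code ψ.code)
  | _, .or φ ψ => Nat.pair 2 (Nat.pair φ.code ψ.code)
  | _, .imp φ ψ => Nat.pair 3 (Nat.pair φ.code ψ.code)
  | _, .all ρ φ => Nat.pair 4 (Nat.pair ρ.code φ.code)
  | _, .ex ρ φ => Nat.pair 5 (Nat.pair ρ.code φ.code)

theorem Fm.code_injective (φ : Fm Γ) : ∀ ψ : Fm Γ, φ.code = ψ.code → φ = ψ := by
  induction φ with
  | eq s t =>
    intro ψ h
    cases ψ <;> simp only [Fm.code, Nat.pair_eq_pair] at h <;> try exact absurd h.1 (by decide)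
    cases Tm.code_injective _ _ h.2.1
    cases Tm.code_injective _ _ h.2.2
    rfl
  | and φ₁ φ₂ ih₁ ih₂ | or φ₁ φ₂ ih₁ ih₂ | imp φ₁ φ₂ ih₁ ih₂ =>
    intro ψ h
    cases ψ <;> simp only [Fm.code, Nat.pair_eq_pair] at h <;> try exact absurd h.1 (by decide)
    rw [ih₁ _ h.2.1, ih₂ _ h.2.2]
  | all ρ φ ih | ex ρ φ ih =>
    intro ψ h
    cases ψ <;> simp only [Fm.code, Nat.pair_eq_pair] at h <;> try exact absurd h.1 (by decide)
    obtain rfl := Ty.code_injective h.2.1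
    rw [ih _ h.2.2]

instance : Countable (Fm Γ) := Function.Injective.countable fun φ ψ => Fm.code_injective φ ψ
instance : Nonempty (Fm Γ) := ⟨.bot⟩
instance : Nonempty Ty := ⟨.nat⟩

/-! ### Derived rules -/

theorem Der.exfalso {H : List (Fm Γ)} {φ : Fm Γ} (h : Der H .bot) : Der H φ :=
  .by_contra (h.mono (List.subset_cons_self _ _))

theorem Der.weaken {H : List (Fm Γ)} {φ : Fm Γ} (h : Der [] φ) : Der H φ :=
  h.mono (List.nil_subset _)

theorem Der.hyp₀ {H : List (Fm Γ)} {φ : Fm Γ} : Der (φ :: H) φ := .hyp (by simp)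

theorem Der.hyp₁ {H : List (Fm Γ)} {φ ψ : Fm Γ} : Der (ψ :: φ :: H) φ := .hyp (by simp)

theorem Fm.QF.subst {φ : Fm Γ} (h : φ.QF) (f : Sub Γ Δ) : (φ.subst f).QF := by
  induction φ generalizing Δ with
  | eq => trivial
  | and φ ψ hφ hψ => exact ⟨hφ h.1 f, hψ h.2 f⟩
  | or φ ψ hφ hψ => exact ⟨hφ h.1 f, hψ h.2 f⟩
  | imp φ ψ hφ hψ => exact ⟨hφ h.1 f, hψ h.2 f⟩
  | all => exact h.elim
  | ex => exact h.elim

theorem Fm.subst_lift_inst (φ : Fm (ρ :: Γ)) (f : Sub Γ Δ) (t : Tm Δ ρ) :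
    (φ.subst f.lift).inst t = φ.subst (Sub.cons t f) := by
  simp only [Fm.inst, Fm.subst_subst]
  congr 1
  funext τ x
  cases x with
  | zero => rfl
  | succ x => exact Tm.wk_subst_single t (f _ x)

theorem Fm.rename_lift_wk_inst (φ : Fm (ρ :: Γ)) :
    (φ.rename (Ren.lift fun _ x => Var.succ (ρ := ρ) x)).inst (.var .zero) = φ := by
  simp only [Fm.inst, Fm.subst_rename]
  conv_rhs => rw [← Fm.subst_var φ]
  congr 1
  funext τ x
  cases x <;> rfl

/-- Theorems are closed under substitution. -/
theorem Der.subst : ∀ {Γ : List Ty} {φ : Fm Γ}, Der [] φ → ∀ f : Sub Γ Δ, Der [] (φ.subst f)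
  | [], φ, h, f => by
    have := h.rename (Ren.empty (Γ := Δ))
    rw [Fm.rename_eq_subst] at this
    have hf : f = fun τ x => .var (Ren.empty τ x) := by funext τ x; nomatch x
    rw [hf]
    exact this
  | ρ :: Γ, φ, h, f => by
    have := Der.all_elim (f _ .zero)
      (Der.subst (Der.all_intro (H := []) h) fun _ x => f _ (.succ x))
    rw [Fm.subst_lift_inst] at this
    convert this using 2
    funext τ x
    cases x <;> rfl

/-- A closed term of each type. -/
def Tm.inhabitant : (ρ : Ty) → Tm Γ ρ
  | .nat => .zero
  | .X => zeroX
  | .fn _ τ => .app (.cst (.proj τ _)) (Tm.inhabitant τ)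

/-! ### Provable equality -/

theorem Der.eqAt_refl : ∀ (ρ : Ty) {Γ : List Ty} (s : Tm Γ ρ), Der [] (eqAt ρ s s)
  | .nat, _, s => .ax (.inl (.eq_refl s))
  | .X, _, s => .ax (.inr (.inl (.norm_sub_self s)))
  | .fn _ τ, _, s => .all_intro (Der.eqAt_refl τ (.app s.wk v0))

theorem Der.imp_trans_eq {φ ψ : Fm Γ} {a b c : Tm Γ Ty.nat} (h₁ : Der [] (.imp φ (.eq a b)))
    (h₂ : Der [] (.imp ψ (.eq b c))) : Der [] (.imp (.and φ ψ) (.eq a c)) :=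
  .imp_intro (.imp_elim (.ax (.inl (.eq_trans a b c)))
    (.and_intro (.imp_elim h₁.weaken (.and_left .hyp₀)) (.imp_elim h₂.weaken (.and_right .hyp₀))))

theorem Der.imp_symm_eq {φ : Fm Γ} {a b : Tm Γ Ty.nat} (h₁ : Der [] (.imp φ (.eq a b))) :
    Der [] (.imp φ (.eq b a)) :=
  .imp_intro (.imp_elim (.ax (.inl (.eq_symm a b))) (.imp_elim h₁.weaken .hyp₀))

/-- From `φ → ∀ x ψ` infer `φ → ψ`, for a fresh variable `x`. -/
theorem Der.imp_all_elim {φ : Fm Γ} {ψ : Fm (ρ :: Γ)} (h : Der [] (.imp φ (.all ρ ψ))) :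
    Der [] (.imp φ.wk ψ) := by
  refine .imp_intro ?_
  have := Der.all_elim (.var .zero) (.imp_elim (h.wk (ρ := ρ)).weaken (.hyp₀ (H := [])))
  rwa [Fm.rename_lift_wk_inst] at this

theorem Der.imp_all_intro {φ : Fm Γ} {ψ : Fm (ρ :: Γ)} (h : Der [] (.imp φ.wk ψ)) :
    Der [] (.imp φ (.all ρ ψ)) :=
  .imp_intro (.all_intro (.imp_elim h.weaken .hyp₀))

/-- The term which vanishes for all `n` iff `s =_X t`. -/
def eqXChar (s t : Tm Γ Ty.X) (n : Tm Γ Ty.nat) : Tm Γ Ty.nat :=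
  ltQChar (absQ (subQ (hat (normX (subX s t)) (.suc n)) (hat zeroR (.suc n)))) (twoPowNegQ n)

theorem eqX_eq_all (s t : Tm Γ Ty.X) :
    eqX s t = .all .nat (.eq (eqXChar s.wk t.wk v0) .zero) := by
  simp [eqX, eqR, eqXChar, ltQ, zeroR, constR, natQ, mkQ, Tm.wk, Tm.rename]

theorem eqXChar_subst (f : Sub Γ Δ) (s t : Tm Γ Ty.X) (n : Tm Γ Ty.nat) :
    (eqXChar s t n).subst f = eqXChar (s.subst f) (t.subst f) (n.subst f) := by
  simp [eqXChar, ltQChar, absQ, subQ, addQ, negateQ, hat, twoPowNegQ, mkQ,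
    pow2, zeroR, constR, natQ, Tm.subst]

/-- The rule of quantifier-free extensionality, for provable equalities of terms of type `X`
inside of another such equality. -/
theorem Der.er_eqXChar {φ : Fm Γ} (hφ : φ.QF) {s t : Tm Γ Ty.X} (u : Tm Γ Ty.X) (n : Tm Γ Ty.nat)
    (h : Der [] (.imp φ (eqX s t))) :
    Der [] (.imp φ (.eq (eqXChar s u n) (eqXChar t u n))) := by
  have := Der.qf_er (H := []) (τ := .nat) hφ (eqXChar v0 u.wk n.wk) h
  simp only [eqAt, eqXChar_subst, Tm.wk_subst_single] at this
  exact this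

theorem Der.eqX_wk {φ : Fm Γ} {s t : Tm Γ Ty.X} (h : Der [] (.imp φ (eqX s t))) :
    Der [] (.imp (φ.wk (ρ := ρ)) (eqX s.wk t.wk)) := by
  have := h.wk (ρ := ρ)
  rwa [Fm.wk, Fm.rename, ← show eqAt .X s t = eqX s t from rfl, eqAt_rename] at this

/-- At type `X` the rule replaces the left `s` by `t` in the characteristic term of `s =_X s`, for
each precision `n`; the norm axioms enter only through reflexivity. -/
theorem Der.imp_eqAt_symm : ∀ (ρ : Ty) {Γ : List Ty} {φ : Fm Γ} (_ : φ.QF) {s t : Tm Γ ρ},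
    Der [] (.imp φ (eqAt ρ s t)) → Der [] (.imp φ (eqAt ρ t s))
  | .nat, _, _, _, _, _, h => h.imp_symm_eq
  | .X, Γ, φ, hφ, s, t, h => by
    have h₀ : Der [] (eqX s s) := Der.eqAt_refl .X s
    rw [eqX_eq_all] at h₀
    have h₁ : Der [] (.imp φ.wk (.eq (eqXChar s.wk s.wk v0) .zero)) :=
      Der.imp_all_elim (.imp_intro h₀.weaken)
    have h₂ := Der.er_eqXChar (hφ.rename _) (s.wk (ρ := .nat)) v0 h.eqX_wk
    have h₃ := h₂.imp_symm_eq.imp_trans_eq h₁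
    change Der [] (.imp φ (eqX t s))
    rw [eqX_eq_all]
    refine .imp_all_intro (.imp_intro (.imp_elim h₃.weaken (.and_intro .hyp₀ .hyp₀)))
  | .fn ρ τ, _, _, hφ, s, t, h =>
    .imp_all_intro (Der.imp_eqAt_symm τ (hφ.rename _) (Der.imp_all_elim h))

/-- At type `X` the rule rewrites `t =_X u` into `s =_X u` within the characteristic term. Only the
first premise has to be quantifier-free. -/
theorem Der.imp_eqAt_trans : ∀ (ρ : Ty) {Γ : List Ty} {φ ψ : Fm Γ} (_ : φ.QF) {s t u : Tm Γ ρ},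
    Der [] (.imp φ (eqAt ρ s t)) → Der [] (.imp ψ (eqAt ρ t u)) →
      Der [] (.imp (.and φ ψ) (eqAt ρ s u))
  | .nat, _, _, _, _, _, _, _, h, h' => h.imp_trans_eq h'
  | .X, Γ, φ, ψ, hφ, s, t, u, h, h' => by
    change Der [] (.imp ψ (eqX t u)) at h'
    rw [eqX_eq_all] at h'
    have h₂ := Der.er_eqXChar (hφ.rename _) (u.wk (ρ := .nat)) v0 h.eqX_wk
    have h₃ := h₂.imp_trans_eq h'.imp_all_elim
    change Der [] (.imp (.and φ ψ) (eqX s u))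
    rw [eqX_eq_all]
    exact .imp_all_intro h₃
  | .fn ρ τ, _, _, _, hφ, s, t, u, h, h' =>
    .imp_all_intro (Der.imp_eqAt_trans τ (hφ.rename _) (Der.imp_all_elim h) (Der.imp_all_elim h'))

/-- Two uses of the extensionality rule, one in the function position and one in the argument
position. This congruence makes application well defined in the term model. -/
theorem Der.imp_eqAt_app {φ ψ : Fm Γ} (hφ : φ.QF) (hψ : ψ.QF) {s s' : Tm Γ (.fn ρ τ)}
    {t t' : Tm Γ ρ} (h : Der [] (.imp φ (eqAt (.fn ρ τ) s s')))
    (h' : Der [] (.imp ψ (eqAt ρ t t'))) :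
    Der [] (.imp (.and φ ψ) (eqAt τ (.app s t) (.app s' t'))) := by
  have h₁ := Der.qf_er (H := []) hφ (.app v0 t.wk) h
  have h₂ := Der.qf_er (H := []) hψ (.app s'.wk v0) h'
  simp only [Tm.subst, Tm.wk_subst_single] at h₁ h₂
  exact Der.imp_eqAt_trans τ hφ h₁ h₂

/-! ### Structures for the language -/

/-- An applicative structure interpreting the constants. -/
structure Interp where
  D : Ty → Type
  ap : ∀ {ρ τ : Ty}, D (.fn ρ τ) → D ρ → D τ
  cst : ∀ {τ : Ty}, Cst τ → D τ

namespace Interp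

/-- Valuations of the variables of a context. -/
abbrev Env (M : Interp) (Γ : List Ty) : Type := ∀ τ : Ty, Var Γ τ → M.D τ

variable (M : Interp)

def Env.cons {M : Interp} (d : M.D ρ) (e : M.Env Γ) : M.Env (ρ :: Γ)
  | _, .zero => d
  | _, .succ x => e _ x

def Env.nil {M : Interp} : M.Env [] := fun _ x => nomatch x

def eval (e : M.Env Γ) : {τ : Ty} → Tm Γ τ → M.D τ
  | _, .var x => e _ x
  | _, .cst c => M.cst c
  | _, .app s t => M.ap (eval e s) (eval e t)

def sat : {Γ : List Ty} → M.Env Γ → Fm Γ → Prop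
  | _, e, .eq s t => M.eval e s = M.eval e t
  | _, e, .and φ ψ => sat e φ ∧ sat e ψ
  | _, e, .or φ ψ => sat e φ ∨ sat e ψ
  | _, e, .imp φ ψ => sat e φ → sat e ψ
  | _, e, .all ρ φ => ∀ d : M.D ρ, sat (.cons d e) φ
  | _, e, .ex ρ φ => ∃ d : M.D ρ, sat (.cons d e) φ

/-- The models of `T^ω`: all theorems hold, and terms that are equal by quantifier-free
extensionality have the same value. -/
class IsModel : Prop where
  sound : ∀ {Γ : List Ty} {φ : Fm Γ}, Der [] φ → ∀ e : M.Env Γ, M.sat e φ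
  er : ∀ {Γ : List Ty} {ρ : Ty} {φ : Fm Γ} {s t : Tm Γ ρ}, φ.QF → Der [] (.imp φ (eqAt ρ s t)) →
    ∀ e : M.Env Γ, M.sat e φ → M.eval e s = M.eval e t
  ne_bot : M.cst .zero ≠ M.ap (M.cst .succ) (M.cst .zero)

end Interp

/-! ### A chain of contexts with witnesses -/

section Chain

noncomputable def enumTy : ℕ → Ty := (exists_surjective_nat Ty).choose
noncomputable def enumFm (Γ : List Ty) : ℕ → Fm Γ := (exists_surjective_nat (Fm Γ)).choose

theorem enumTy_surjective : Function.Surjective enumTy := (exists_surjective_nat Ty).choose_spec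
theorem enumFm_surjective (Γ : List Ty) : Function.Surjective (enumFm Γ) :=
  (exists_surjective_nat (Fm Γ)).choose_spec

/-- A stage number codes a triple: the level over which a formula lives, the type of its witness,
and the number of the formula in the enumeration. This is the middle component. -/
noncomputable def witTy (n : ℕ) : Ty := enumTy n.unpair.2.unpair.1

noncomputable def ctx (Γ₀ : List Ty) : ℕ → List Ty
  | 0 => Γ₀
  | n + 1 => witTy n :: ctx Γ₀ n

variable {Γ₀ : List Ty}

/-- Inclusions of the contexts of the chain. -/
noncomputable def up {n m : ℕ} (h : n ≤ m) : Ren (ctx Γ₀ n) (ctx Γ₀ m) :=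
  Nat.leRec (motive := fun m _ => Ren (ctx Γ₀ n) (ctx Γ₀ m)) (fun _ x => x)
    (fun _ _ f τ x => .succ (f τ x)) h

theorem up_refl (n : ℕ) : up (Γ₀ := Γ₀) (le_refl n) = fun _ x => x := by
  exact Nat.leRec_self _ _

theorem up_succ {n m : ℕ} (h : n ≤ m) :
    up (Γ₀ := Γ₀) (h.trans (Nat.le_succ m)) = fun τ x => .succ (up h τ x) := by
  exact Nat.leRec_succ _ _ h

theorem up_up {n m k : ℕ} (h : n ≤ m) (h' : m ≤ k) :
    (fun τ x => up (Γ₀ := Γ₀) h' τ (up h τ x)) = up (h.trans h') := by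
  induction k, h' using Nat.le_induction with
  | base => simp only [up_refl]
  | succ k hk ih => rw [up_succ hk, up_succ (h.trans hk), ← ih]

theorem Tm.up_up {n m k : ℕ} (h : n ≤ m) (h' : m ≤ k) (t : Tm (ctx Γ₀ n) τ) :
    (t.rename (up h)).rename (up h') = t.rename (up (h.trans h')) := by
  rw [Tm.rename_rename, FiniteType.up_up]

theorem Fm.up_up {n m k : ℕ} (h : n ≤ m) (h' : m ≤ k) (φ : Fm (ctx Γ₀ n)) :
    (φ.rename (up h)).rename (up h') = φ.rename (up (h.trans h')) := by
  rw [Fm.rename_rename, FiniteType.up_up]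

/-- The formula for which the `n`-th new variable is a witness. -/
noncomputable def request (n : ℕ) : Fm (witTy n :: ctx Γ₀ n) :=
  (enumFm (witTy n :: ctx Γ₀ n.unpair.1) n.unpair.2.unpair.2).rename
    (Ren.lift (up (Nat.unpair_left_le n)))

open Classical in
/-- The assumptions over the contexts of the chain. -/
noncomputable def hyps (H₀ : List (Fm Γ₀)) : (n : ℕ) → List (Fm (ctx Γ₀ n))
  | 0 => H₀
  | n + 1 =>
    if Der (.ex (witTy n) (request n) :: hyps H₀ n) .bot then (hyps H₀ n).map Fm.wk
    else request n :: (hyps H₀ n).map Fm.wk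

variable {H₀ : List (Fm Γ₀)}

/-- A new variable without new assumption is harmless because every type has a closed term. A new
variable with its request is harmless because it serves as eigenvariable for the consistent
existential formula. -/
theorem hyps_consistent (h₀ : ¬ Der H₀ .bot) : ∀ n : ℕ, ¬ Der (hyps H₀ n) .bot
  | 0 => h₀
  | n + 1 => by
    intro h
    rw [hyps] at h
    split_ifs at h with hb
    · exact hyps_consistent h₀ n (Der.all_elim (φ := .bot) (Tm.inhabitant _) (.all_intro h))
    · refine hb (.ex_elim (ψ := .bot) .hyp₀ (h.mono ?_))
      exact List.cons_subset_cons _ (List.map_subset _ (List.subset_cons_self _ _))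

theorem Der.up {n m : ℕ} (h : n ≤ m) {φ : Fm (ctx Γ₀ n)} (hφ : Der (hyps H₀ n) φ) :
    Der (hyps H₀ m) (φ.rename (up h)) := by
  induction m, h using Nat.le_induction with
  | base => rwa [up_refl, Fm.rename_id]
  | succ m hm ih =>
    have := ih.rename (fun _ x => Var.succ (ρ := witTy m) x)
    rw [Fm.rename_rename] at this
    rw [up_succ hm]
    refine this.mono ?_
    rw [hyps]
    split_ifs
    · exact List.Subset.refl _
    · exact List.subset_cons_self _ _

/-- Truth of a formula over a context of the chain. -/
def Tr (H₀ : List (Fm Γ₀)) (n : ℕ) (φ : Fm (ctx Γ₀ n)) : Prop :=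
  ∃ (m : ℕ) (h : n ≤ m), Der (hyps H₀ m) (φ.rename (up h))

theorem Tr.of_der {n : ℕ} {φ : Fm (ctx Γ₀ n)} (h : Der (hyps H₀ n) φ) : Tr H₀ n φ :=
  ⟨n, le_refl n, by rwa [up_refl, Fm.rename_id]⟩

/-- Truth does not depend on the level at which a formula is read, since derivations can be moved to
a common later level. -/
theorem Tr_up {n m : ℕ} (h : n ≤ m) {φ : Fm (ctx Γ₀ n)} :
    Tr H₀ m (φ.rename (up h)) ↔ Tr H₀ n φ := by
  constructor
  · rintro ⟨k, hk, hd⟩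
    exact ⟨k, h.trans hk, by rwa [Fm.up_up] at hd⟩
  · rintro ⟨k, hk, hd⟩
    refine ⟨max k m, le_max_right _ _, ?_⟩
    have := hd.up (le_max_left k m)
    rwa [Fm.up_up] at this ⊢

theorem Tr.mp {n : ℕ} {φ ψ : Fm (ctx Γ₀ n)} (h : Tr H₀ n (.imp φ ψ)) (h' : Tr H₀ n φ) :
    Tr H₀ n ψ := by
  obtain ⟨k, hk, hd⟩ := h
  obtain ⟨m, hm, hd'⟩ := h'
  refine ⟨max k m, hk.trans (le_max_left _ _), ?_⟩
  have h₁ := hd.up (le_max_left k m)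
  have h₂ := hd'.up (le_max_right k m)
  rw [Fm.up_up] at h₁ h₂
  exact .imp_elim h₁ h₂

theorem Tr.consequence {n : ℕ} {φ ψ : Fm (ctx Γ₀ n)} (h : Der [φ] ψ) (h' : Tr H₀ n φ) :
    Tr H₀ n ψ :=
  (Tr.of_der (Der.imp_intro h).weaken).mp h'

theorem Tr.consequence₂ {n : ℕ} {φ ψ χ : Fm (ctx Γ₀ n)} (h : Der [ψ, φ] χ) (h₁ : Tr H₀ n φ)
    (h₂ : Tr H₀ n ψ) : Tr H₀ n χ :=
  ((Tr.of_der (Der.imp_intro (Der.imp_intro h)).weaken).mp h₁).mp h₂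

theorem not_Tr_bot (h₀ : ¬ Der H₀ .bot) (n : ℕ) : ¬ Tr H₀ n .bot :=
  fun ⟨m, _, hd⟩ => hyps_consistent h₀ m hd

/-- Every existential formula has a witness or is refuted. -/
def Decided (H₀ : List (Fm Γ₀)) (n : ℕ) (ρ : Ty) (ψ : Fm (ρ :: ctx Γ₀ n)) : Prop :=
  Tr H₀ n (Fm.neg (.ex ρ ψ)) ∨
    ∃ (m : ℕ) (h : n ≤ m) (t : Tm (ctx Γ₀ m) ρ), Tr H₀ m ((ψ.rename (Ren.lift (up h))).inst t)

theorem decided_request (N : ℕ) :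
    Decided H₀ N.unpair.1 (witTy N) (enumFm _ N.unpair.2.unpair.2) := by
  by_cases hb : Der (.ex (witTy N) (request N) :: hyps H₀ N) .bot
  · exact .inl ⟨N, Nat.unpair_left_le N, .imp_intro hb⟩
  · refine .inr ⟨N + 1, (Nat.unpair_left_le N).trans (Nat.le_succ N), .var .zero, .of_der ?_⟩
    have hm : request N ∈ hyps H₀ (N + 1) := by
      rw [hyps, if_neg hb]
      exact List.mem_cons_self
    have := Der.hyp hm
    rw [request, Fm.rename_eq_subst] at this
    rw [up_succ (Nat.unpair_left_le N), Fm.inst, Fm.subst_rename]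
    refine (congrArg (fun f => Der (hyps H₀ (N + 1)) (Fm.subst f _)) ?_).mp this
    funext τ x
    cases x <;> rfl

/-- Each existential formula is the request of some stage, namely the one whose number codes its
level, type and index. -/
theorem decided (n : ℕ) (ρ : Ty) (ψ : Fm (ρ :: ctx Γ₀ n)) : Decided H₀ n ρ ψ := by
  obtain ⟨i, hi⟩ := enumTy_surjective ρ
  obtain ⟨j, hj⟩ := enumFm_surjective _ ψ
  -- Level and type occur in the type of the formula, so the decoding equations are generalized to
  -- variables and substituted instead of rewritten.
  have key : ∀ N k ρ j, N.unpair.1 = k → witTy N = ρ → N.unpair.2.unpair.2 = j →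
      Decided H₀ k ρ (enumFm _ j) := by
    rintro N _ _ _ rfl rfl rfl
    exact decided_request N
  rw [← hj]
  exact key (Nat.pair n (Nat.pair i j)) n ρ j (by simp) (by simp [witTy, hi]) (by simp)

/-- Apply the witness property to the vacuous quantification `∃ x⁰ φ`: deciding it decides `φ`. So
the theory becomes complete without a separate Lindenbaum extension. -/
theorem Tr_or_Tr_neg (n : ℕ) (φ : Fm (ctx Γ₀ n)) : Tr H₀ n φ ∨ Tr H₀ n φ.neg := by
  rcases decided (H₀ := H₀) n .nat φ.wk with h | ⟨m, h, t, ht⟩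
  · refine .inr (h.consequence (.imp_intro (.imp_elim .hyp₁ (.ex_intro .zero ?_))))
    rw [Fm.wk_subst_single]
    exact .hyp₀
  · rw [Fm.wk_rename_lift, Fm.wk_subst_single] at ht
    exact .inl ((Tr_up h).1 ht)

section Clauses
variable {n : ℕ} {φ ψ : Fm (ctx Γ₀ n)}

theorem Tr_and : Tr H₀ n (.and φ ψ) ↔ Tr H₀ n φ ∧ Tr H₀ n ψ :=
  ⟨fun h => ⟨h.consequence (.and_left .hyp₀), h.consequence (.and_right .hyp₀)⟩,
    fun h => Tr.consequence₂ (.and_intro .hyp₁ .hyp₀) h.1 h.2⟩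

theorem Tr_imp : Tr H₀ n (.imp φ ψ) ↔ (Tr H₀ n φ → Tr H₀ n ψ) := by
  refine ⟨Tr.mp, fun h => ?_⟩
  rcases Tr_or_Tr_neg (H₀ := H₀) n φ with hφ | hφ
  · exact (h hφ).consequence (.imp_intro .hyp₁)
  · exact hφ.consequence (.imp_intro (Der.exfalso (.imp_elim .hyp₁ .hyp₀)))

variable (h₀ : ¬ Der H₀ .bot)
include h₀

theorem Tr_neg : Tr H₀ n φ.neg ↔ ¬ Tr H₀ n φ :=
  Tr_imp.trans ⟨fun h h' => not_Tr_bot h₀ n (h h'), fun h h' => (h h').elim⟩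

theorem Tr_or : Tr H₀ n (.or φ ψ) ↔ Tr H₀ n φ ∨ Tr H₀ n ψ := by
  constructor
  · intro h
    by_contra! hn
    rw [← Tr_neg h₀, ← Tr_neg h₀, ← Tr_and] at hn
    refine not_Tr_bot h₀ n (Tr.consequence₂ ?_ h hn)
    exact .or_elim .hyp₁ (.imp_elim (.and_left .hyp₁) .hyp₀) (.imp_elim (.and_right .hyp₁) .hyp₀)
  · rintro (h | h)
    · exact h.consequence (.or_left .hyp₀)
    · exact h.consequence (.or_right .hyp₀)

theorem Tr_ex {φ : Fm (ρ :: ctx Γ₀ n)} : Tr H₀ n (.ex ρ φ) ↔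
    ∃ (m : ℕ) (h : n ≤ m) (t : Tm (ctx Γ₀ m) ρ),
      Tr H₀ m ((φ.rename (Ren.lift (up h))).inst t) := by
  constructor
  · intro h
    exact (decided n ρ φ).resolve_left fun h' => (Tr_neg h₀).1 h' h
  · rintro ⟨m, h, t, ht⟩
    exact (Tr_up h).1 (ht.consequence (.ex_intro t .hyp₀))

/-- The instances range over terms of all later levels, as the elements of the term model do. A
failing universal formula has a counterexample by the witness property of its negated matrix. -/
theorem Tr_all {φ : Fm (ρ :: ctx Γ₀ n)} : Tr H₀ n (.all ρ φ) ↔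
    ∀ (m : ℕ) (h : n ≤ m) (t : Tm (ctx Γ₀ m) ρ),
      Tr H₀ m ((φ.rename (Ren.lift (up h))).inst t) := by
  constructor
  · intro h m hm t
    exact ((Tr_up hm).2 h).consequence (.all_elim t .hyp₀)
  · intro h
    rcases decided (H₀ := H₀) n ρ φ.neg with hd | ⟨m, hm, t, ht⟩
    · refine hd.consequence (.all_intro (.by_contra (.imp_elim .hyp₁ (.ex_intro (.var .zero) ?_))))
      rw [Fm.rename_lift_wk_inst]
      exact .hyp₀
    · exact ((Tr_neg h₀).1 ht (h m hm t)).elim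

end Clauses

end Chain

/-! ### The term model -/

section TermModel

variable {Γ₀ : List Ty} (H₀ : List (Fm Γ₀))

/-- Equality by quantifier-free extensionality of terms over a context of the chain. -/
def TmEq (n : ℕ) (s t : Tm (ctx Γ₀ n) τ) : Prop :=
  ∃ φ : Fm (ctx Γ₀ n), φ.QF ∧ Tr H₀ n φ ∧ Der [] (.imp φ (eqAt τ s t))

variable {H₀}

theorem TmEq.refl {n : ℕ} (s : Tm (ctx Γ₀ n) τ) : TmEq H₀ n s s :=
  ⟨.eq .zero .zero, trivial, .of_der (.ax (.inl (.eq_refl _))),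
    .imp_intro (Der.eqAt_refl τ s).weaken⟩

theorem TmEq.symm {n : ℕ} {s t : Tm (ctx Γ₀ n) τ} : TmEq H₀ n s t → TmEq H₀ n t s :=
  fun ⟨φ, hφ, hT, hd⟩ => ⟨φ, hφ, hT, .imp_eqAt_symm τ hφ hd⟩

theorem TmEq.trans {n : ℕ} {s t u : Tm (ctx Γ₀ n) τ} :
    TmEq H₀ n s t → TmEq H₀ n t u → TmEq H₀ n s u :=
  fun ⟨φ, hφ, hT, hd⟩ ⟨ψ, hψ, hT', hd'⟩ =>
    ⟨.and φ ψ, ⟨hφ, hψ⟩, Tr_and.2 ⟨hT, hT'⟩, .imp_eqAt_trans τ hφ hd hd'⟩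

theorem TmEq.app {n : ℕ} {s s' : Tm (ctx Γ₀ n) (.fn ρ τ)} {t t' : Tm (ctx Γ₀ n) ρ} :
    TmEq H₀ n s s' → TmEq H₀ n t t' → TmEq H₀ n (.app s t) (.app s' t') :=
  fun ⟨φ, hφ, hT, hd⟩ ⟨ψ, hψ, hT', hd'⟩ =>
    ⟨.and φ ψ, ⟨hφ, hψ⟩, Tr_and.2 ⟨hT, hT'⟩, .imp_eqAt_app hφ hψ hd hd'⟩

theorem TmEq.up {n m : ℕ} (h : n ≤ m) {s t : Tm (ctx Γ₀ n) τ} :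
    TmEq H₀ n s t → TmEq H₀ m (s.rename (up h)) (t.rename (up h)) := by
  rintro ⟨φ, hφ, hT, hd⟩
  have := hd.rename (FiniteType.up h)
  simp only [Fm.rename, eqAt_rename] at this
  exact ⟨_, hφ.rename _, (Tr_up h).2 hT, this⟩

/-- At type `0` an equation is itself quantifier-free and may serve as its own premise. At other
types truth of the equation does not suffice, which keeps `=_X` apart from identity. -/
theorem TmEq_nat {n : ℕ} {s t : Tm (ctx Γ₀ n) Ty.nat} : TmEq H₀ n s t ↔ Tr H₀ n (.eq s t) :=
  ⟨fun ⟨_, _, hT, hd⟩ => (Tr.of_der hd.weaken).mp hT,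
    fun h => ⟨.eq s t, trivial, h, .imp_intro .hyp₀⟩⟩

variable (H₀)

/-- Terms over the chain of contexts, up to provable equality. -/
def tmSetoid (τ : Ty) : Setoid (Σ n : ℕ, Tm (ctx Γ₀ n) τ) where
  r p q := ∃ (k : ℕ) (hp : p.1 ≤ k) (hq : q.1 ≤ k),
    TmEq H₀ k (p.2.rename (up hp)) (q.2.rename (up hq))
  iseqv := by
    refine ⟨fun p => ⟨p.1, le_rfl, le_rfl, .refl _⟩, ?_, ?_⟩
    · rintro p q ⟨k, hp, hq, h⟩
      exact ⟨k, hq, hp, h.symm⟩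
    · rintro p q r ⟨k, hp, hq, h⟩ ⟨k', hq', hr, h'⟩
      refine ⟨max k k', hp.trans (le_max_left _ _), hr.trans (le_max_right _ _), ?_⟩
      have h₁ := h.up (le_max_left k k')
      have h₂ := h'.up (le_max_right k k')
      rw [Tm.up_up, Tm.up_up] at h₁ h₂
      exact h₁.trans h₂

/-- The element of the term model given by a term. -/
def tmMk (n : ℕ) (t : Tm (ctx Γ₀ n) τ) : Quotient (tmSetoid H₀ τ) := Quotient.mk _ ⟨n, t⟩

theorem tmMk_up {n m : ℕ} (h : n ≤ m) (t : Tm (ctx Γ₀ n) τ) :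
    tmMk H₀ m (t.rename (up h)) = tmMk H₀ n t := by
  refine Quotient.sound ⟨m, le_rfl, h, ?_⟩
  simp only [up_refl, Tm.rename_id]
  exact .refl _

theorem tmMk_eq {n : ℕ} {s t : Tm (ctx Γ₀ n) τ} (h : TmEq H₀ n s t) : tmMk H₀ n s = tmMk H₀ n t :=
  Quotient.sound ⟨n, le_rfl, le_rfl, by simpa only [up_refl, Tm.rename_id] using h⟩

theorem tmMk_eq_nat {n : ℕ} {s t : Tm (ctx Γ₀ n) Ty.nat} :
    tmMk H₀ n s = tmMk H₀ n t ↔ Tr H₀ n (.eq s t) := by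
  refine ⟨fun h => ?_, fun h => tmMk_eq H₀ (TmEq_nat.2 h)⟩
  obtain ⟨k, h₁, h₂, h⟩ := Quotient.exact h
  exact (Tr_up h₁).1 (TmEq_nat.1 h)

/-- Application in the term model. -/
noncomputable def tmApp : Quotient (tmSetoid H₀ (.fn ρ τ)) → Quotient (tmSetoid H₀ ρ) →
    Quotient (tmSetoid H₀ τ) :=
  Quotient.map₂ (fun p q => ⟨max p.1 q.1,
      .app (p.2.rename (up (le_max_left _ _))) (q.2.rename (up (le_max_right _ _)))⟩) <| by
    rintro p p' ⟨k, hp, hp', h⟩ q q' ⟨l, hq, hq', h'⟩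
    have a := le_max_left k l
    have b := le_max_right k l
    refine ⟨max k l, max_le (hp.trans a) (hq.trans b), max_le (hp'.trans a) (hq'.trans b), ?_⟩
    have h₁ := h.up a
    have h₂ := h'.up b
    simp only [Tm.rename, Tm.up_up] at h₁ h₂ ⊢
    exact h₁.app h₂

theorem tmApp_mk {n : ℕ} (s : Tm (ctx Γ₀ n) (.fn ρ τ)) (t : Tm (ctx Γ₀ n) ρ) :
    tmApp H₀ (tmMk H₀ n s) (tmMk H₀ n t) = tmMk H₀ n (.app s t) := by
  refine Quotient.sound ⟨max n n, le_rfl, le_max_left _ _, ?_⟩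
  simp only [Tm.rename, Tm.up_up]
  exact .refl _

/-- The term model. -/
noncomputable def termModel : Interp where
  D τ := Quotient (tmSetoid H₀ τ)
  ap := tmApp H₀
  cst c := tmMk H₀ 0 (.cst c)

/-- The valuation given by a substitution. -/
def tmEnv {n : ℕ} (f : Sub Δ (ctx Γ₀ n)) : (termModel H₀).Env Δ := fun _ x => tmMk H₀ n (f _ x)

theorem termModel_eval {n : ℕ} (f : Sub Δ (ctx Γ₀ n)) (t : Tm Δ τ) :
    (termModel H₀).eval (tmEnv H₀ f) t = tmMk H₀ n (t.subst f) := by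
  induction t with
  | var x => rfl
  | cst c => exact (tmMk_up H₀ (Nat.zero_le n) (.cst c)).symm
  | app s t hs ht =>
    rw [Interp.eval, hs, ht]
    exact tmApp_mk H₀ _ _

theorem Sub.cons_tmMk {n : ℕ} (f : Sub Δ (ctx Γ₀ n)) {m : ℕ} (h : n ≤ m) (t : Tm (ctx Γ₀ m) ρ) :
    Interp.Env.cons (M := termModel H₀) (tmMk H₀ m t) (tmEnv H₀ f) =
      tmEnv H₀ (Sub.cons t (fun _ x => (f _ x).rename (up h))) := by
  funext τ x
  cases x with
  | zero => rfl
  | succ x => exact (tmMk_up H₀ h _).symm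

theorem Fm.subst_lift_up_inst {n m : ℕ} (f : Sub Δ (ctx Γ₀ n)) (h : n ≤ m) (t : Tm (ctx Γ₀ m) ρ)
    (φ : Fm (ρ :: Δ)) : ((φ.subst f.lift).rename (Ren.lift (up h))).inst t =
      φ.subst (Sub.cons t (fun _ x => (f _ x).rename (up h))) := by
  rw [Fm.rename_subst, Sub.lift_rename, Fm.subst_lift_inst]

theorem exists_tmMk {n : ℕ} (d : (termModel H₀).D τ) :
    ∃ (m : ℕ) (_ : n ≤ m) (t : Tm (ctx Γ₀ m) τ), d = tmMk H₀ m t := by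
  obtain ⟨⟨m, t⟩, rfl⟩ := Quotient.exists_rep d
  exact ⟨max n m, le_max_left _ _, t.rename (up (le_max_right _ _)), (tmMk_up H₀ _ t).symm⟩

variable {H₀}

/-- The truth lemma. Atomic formulas are equations at type `0`, where identity in the model is
truth; the connectives and quantifiers follow the clauses for `Tr`. -/
theorem termModel_sat (h₀ : ¬ Der H₀ .bot) {Δ : List Ty} (φ : Fm Δ) :
    ∀ {n : ℕ} (f : Sub Δ (ctx Γ₀ n)),
      (termModel H₀).sat (tmEnv H₀ f) φ ↔ Tr H₀ n (φ.subst f) := by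
  induction φ with
  | eq s t =>
    intro n f
    rw [Interp.sat, termModel_eval, termModel_eval]
    exact tmMk_eq_nat H₀
  | and φ ψ h₁ h₂ => intro n f; rw [Interp.sat, h₁, h₂, Fm.subst, Tr_and]
  | or φ ψ h₁ h₂ => intro n f; rw [Interp.sat, h₁, h₂, Fm.subst, Tr_or h₀]
  | imp φ ψ h₁ h₂ => intro n f; rw [Interp.sat, h₁, h₂, Fm.subst, Tr_imp]
  | all ρ φ ih =>
    intro n f
    rw [Interp.sat, Fm.subst, Tr_all h₀]
    constructor
    · intro h m hm t
      have := h (tmMk H₀ m t)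
      rwa [Sub.cons_tmMk H₀ f hm, ih, ← Fm.subst_lift_up_inst] at this
    · intro h d
      obtain ⟨m, hm, t, rfl⟩ := exists_tmMk H₀ (n := n) d
      rw [Sub.cons_tmMk H₀ f hm, ih, ← Fm.subst_lift_up_inst]
      exact h m hm t
  | ex ρ φ ih =>
    intro n f
    rw [Interp.sat, Fm.subst, Tr_ex h₀]
    constructor
    · rintro ⟨d, h⟩
      obtain ⟨m, hm, t, rfl⟩ := exists_tmMk H₀ (n := n) d
      rw [Sub.cons_tmMk H₀ f hm, ih, ← Fm.subst_lift_up_inst] at h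
      exact ⟨m, hm, t, h⟩
    · rintro ⟨m, hm, t, h⟩
      refine ⟨tmMk H₀ m t, ?_⟩
      rwa [Sub.cons_tmMk H₀ f hm, ih, ← Fm.subst_lift_up_inst]

/-- A context is finite, so the representatives of its values can all be moved to one common level.
-/
theorem exists_env_eq : ∀ {Δ : List Ty} (e : (termModel H₀).Env Δ),
    ∃ (n : ℕ) (f : Sub Δ (ctx Γ₀ n)), e = tmEnv H₀ f
  | [], e => ⟨0, fun _ x => (nomatch x), funext fun _ => funext fun x => (nomatch x)⟩
  | ρ :: Δ, e => by
    obtain ⟨n, f, hf⟩ := exists_env_eq fun _ x => e _ (.succ x)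
    obtain ⟨m, hm, t, ht⟩ := exists_tmMk H₀ (n := n) (e _ .zero)
    refine ⟨m, _, Eq.trans ?_ (Sub.cons_tmMk H₀ f hm t)⟩
    funext τ x
    cases x with
    | zero => exact ht
    | succ x => exact congrFun (congrFun hf τ) x

/-- Soundness is closure of theorems under substitution; the clause on the extensionality rule is
the very definition of the identification of terms. -/
theorem termModel_isModel (h₀ : ¬ Der H₀ .bot) : (termModel H₀).IsModel where
  sound h e := by
    obtain ⟨n, f, rfl⟩ := exists_env_eq e
    rw [termModel_sat h₀]
    exact .of_der (h.subst f).weaken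
  er hφ h e he := by
    obtain ⟨n, f, rfl⟩ := exists_env_eq e
    rw [termModel_sat h₀] at he
    rw [termModel_eval, termModel_eval]
    have := h.subst f
    simp only [Fm.subst, eqAt_subst] at this
    exact tmMk_eq H₀ ⟨_, hφ.subst f, he, this⟩
  ne_bot h := by
    have : (termModel H₀).sat (tmEnv H₀ fun (_ : Ty) (x : Var (ctx Γ₀ 0) _) => .var x) Fm.bot := h
    rw [termModel_sat h₀] at this
    exact not_Tr_bot h₀ 0 this

end TermModel

/-- Completeness: what holds in all models is derivable. -/
theorem Der.of_models {φ : Fm Γ}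
    (h : ∀ M : Interp, M.IsModel → ∀ e : M.Env Γ, M.sat e φ) : Der [] φ := by
  refine .by_contra ?_
  -- Underivability of falsity from `¬φ` is the consistency needed for the Henkin construction,
  -- whose model then refutes `φ`.
  by_contra h₀
  have hs := h _ (termModel_isModel h₀) (tmEnv _ (n := 0) fun _ x => .var x)
  rw [termModel_sat h₀ φ] at hs
  have hs' : Tr _ 0 φ := (congrArg (Tr _ 0) (Fm.subst_var φ)).mp hs
  exact not_Tr_bot h₀ 0 ((Tr.of_der .hyp₀ : Tr _ 0 φ.neg).mp hs')

theorem Tm.lam_rename (f : Ren Γ Δ) : ∀ {τ : Ty} (t : Tm (ρ :: Γ) τ),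
    (Tm.lam t).rename f = Tm.lam (t.rename f.lift)
  | _, .var .zero => rfl
  | _, .var (.succ _) => rfl
  | _, .cst _ => rfl
  | _, .app s t => by simp only [Tm.lam, Tm.rename, Tm.lam_rename f s, Tm.lam_rename f t]


/-! ### Arithmetic of the type `0` objects of a model -/

namespace Interp

/-! ### Evaluation -/

section Eval
variable {M : Interp}

@[simp] theorem eval_var (e : M.Env Γ) (x : Var Γ τ) : M.eval e (.var x) = e τ x := rfl
@[simp] theorem eval_cst (e : M.Env Γ) (c : Cst τ) : M.eval e (.cst c) = M.cst c := rfl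
@[simp] theorem eval_app (e : M.Env Γ) (s : Tm Γ (.fn ρ τ)) (t : Tm Γ ρ) :
    M.eval e (.app s t) = M.ap (M.eval e s) (M.eval e t) := rfl
@[simp] theorem Env.cons_zero (e : M.Env Γ) (d : M.D ρ) : Env.cons d e ρ .zero = d := rfl
@[simp] theorem Env.cons_succ (e : M.Env Γ) (d : M.D ρ) (x : Var Γ τ) :
    Env.cons d e τ (.succ x) = e τ x := rfl

theorem eval_rename (f : Ren Γ Δ) (e : M.Env Δ) (t : Tm Γ τ) :
    M.eval e (t.rename f) = M.eval (fun τ x => e τ (f τ x)) t := by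
  induction t with
  | var x => rfl
  | cst c => rfl
  | app s t hs ht => simp only [Tm.rename, eval_app, hs, ht]

theorem eval_subst (f : Sub Γ Δ) (e : M.Env Δ) (t : Tm Γ τ) :
    M.eval e (t.subst f) = M.eval (fun τ x => M.eval e (f τ x)) t := by
  induction t with
  | var x => rfl
  | cst c => rfl
  | app s t hs ht => simp only [Tm.subst, eval_app, hs, ht]

@[simp] theorem eval_wk (d : M.D ρ) (e : M.Env Γ) (t : Tm Γ τ) :
    M.eval (.cons d e) t.wk = M.eval e t := eval_rename _ _ _

@[simp] theorem eval_closed (e : M.Env Γ) (t : Tm [] τ) :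
    M.eval e t.closed = M.eval .nil t := by
  rw [Tm.closed, eval_rename]
  congr 1
  funext τ x
  nomatch x

theorem sat_subst {Γ : List Ty} (φ : Fm Γ) : ∀ {Δ : List Ty} (f : Sub Γ Δ) (e : M.Env Δ),
    M.sat e (φ.subst f) ↔ M.sat (fun τ x => M.eval e (f τ x)) φ := by
  have key : ∀ {Γ Δ : List Ty} {ρ : Ty} (f : Sub Γ Δ) (e : M.Env Δ) (d : M.D ρ),
      (fun τ x => M.eval (.cons d e) (Sub.lift f τ x)) =
        Env.cons d (fun τ x => M.eval e (f τ x)) := by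
    intro Γ Δ ρ f e d
    funext τ x
    cases x with
    | zero => rfl
    | succ x => exact eval_wk d e _
  induction φ with
  | eq s t => intro Δ f e; simp only [Fm.subst, sat, eval_subst]
  | and φ ψ h₁ h₂ | or φ ψ h₁ h₂ | imp φ ψ h₁ h₂ => intro Δ f e; simp only [Fm.subst, sat, h₁, h₂]
  | all ρ φ ih | ex ρ φ ih => intro Δ f e; simp only [Fm.subst, sat, ih, key]

theorem sat_inst (φ : Fm (ρ :: Γ)) (t : Tm Γ ρ) (e : M.Env Γ) :
    M.sat e (φ.inst t) ↔ M.sat (.cons (M.eval e t) e) φ := by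
  rw [Fm.inst, sat_subst]
  refine iff_of_eq (congrArg (fun e => M.sat e φ) ?_)
  funext τ x
  cases x <;> rfl

@[simp] theorem sat_neg (φ : Fm Γ) [M.IsModel] (e : M.Env Γ) : M.sat e φ.neg ↔ ¬ M.sat e φ := by
  have : ¬ M.sat e .bot := fun h => IsModel.ne_bot (M := M) h
  exact ⟨fun h h' => this (h h'), fun h h' => (h h').elim⟩

end Eval

variable {M : Interp} [M.IsModel]

/-- With the trivially true premise `0 = 0`, the clause `er` upgrades an axiomatic equation to an
identity, even at type `X` and at function types, where `eqAt` is weaker than identity. -/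
theorem eval_eq_of_axiom {s t : Tm Γ ρ} (h : TAxiom (eqAt ρ s t)) (e : M.Env Γ) :
    M.eval e s = M.eval e t :=
  IsModel.er (φ := (.eq .zero .zero : Fm Γ)) trivial (.imp_intro (.ax h)) e rfl

@[simp] theorem ap_proj (x : M.D ρ) (y : M.D τ) : M.ap (M.ap (M.cst (.proj ρ τ)) x) y = x :=
  eval_eq_of_axiom (Γ := [ρ, τ]) (.inl (.proj v0 v1)) (.cons x (.cons y .nil))

@[simp] theorem ap_comb (x : M.D (.fn δ (.fn ρ τ))) (y : M.D (.fn δ ρ)) (z : M.D δ) :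
    M.ap (M.ap (M.ap (M.cst (.comb δ ρ τ)) x) y) z = M.ap (M.ap x z) (M.ap y z) :=
  eval_eq_of_axiom (Γ := [.fn δ (.fn ρ τ), .fn δ ρ, δ]) (.inl (.comb v0 v1 v2))
    (.cons x (.cons y (.cons z .nil)))

@[simp] theorem ap_eval_lam (e : M.Env Γ) (d : M.D ρ) : ∀ {τ : Ty} (t : Tm (ρ :: Γ) τ),
    M.ap (M.eval e t.lam) d = M.eval (.cons d e) t
  | _, .var .zero => by simp [Tm.lam]
  | _, .var (.succ _) => by simp [Tm.lam]
  | _, .cst _ => by simp [Tm.lam]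
  | _, .app s t => by simp [Tm.lam, ap_eval_lam e d s, ap_eval_lam e d t]

/-! ### Recursion at type `0` and induction -/

instance : Zero (M.D .nat) := ⟨M.cst .zero⟩
instance : One (M.D .nat) := ⟨M.ap (M.cst .succ) (M.cst .zero)⟩
instance : Add (M.D .nat) := ⟨fun x y => M.ap (M.ap (M.eval .nil plusC) x) y⟩
instance : Mul (M.D .nat) := ⟨fun x y => M.ap (M.ap (M.eval .nil timesC) x) y⟩

@[simp] theorem cst_zero : M.cst .zero = (0 : M.D .nat) := rfl
@[simp] theorem eval_plus (e : M.Env Γ) (s t : Tm Γ .nat) :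
    M.eval e (plus s t) = M.eval e s + M.eval e t := by
  simp only [plus, eval_app, eval_closed]; rfl
@[simp] theorem eval_times (e : M.Env Γ) (s t : Tm Γ .nat) :
    M.eval e (times s t) = M.eval e s * M.eval e t := by
  simp only [times, eval_app, eval_closed]; rfl

variable (M) in
/-- Recursion at type `0`. -/
def rec₀ (a : M.D .nat) (z : M.D (.fn .nat .one)) (n : M.D .nat) : M.D .nat :=
  M.ap (M.ap (M.ap (M.cst (.recur [.nat] .zero)) n) a) z

@[simp] theorem rec₀_zero (a : M.D .nat) (z : M.D (.fn .nat .one)) : M.rec₀ a z 0 = a :=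
  eval_eq_of_axiom (Γ := [.nat, .fn .nat .one])
    (.inl (.rec_zero [.nat] .zero (Sub.cons v0 fun _ x => (nomatch x))
      (Sub.cons v1 fun _ x => (nomatch x))))
    (.cons a (.cons z .nil))

theorem rec₀_succ' (a : M.D .nat) (z : M.D (.fn .nat .one)) (n : M.D .nat) :
    M.rec₀ a z (M.ap (M.cst .succ) n) = M.ap (M.ap z (M.rec₀ a z n)) n :=
  eval_eq_of_axiom (Γ := [.nat, .fn .nat .one, .nat])
    (.inl (.rec_succ [.nat] .zero v2 (Sub.cons v0 fun _ x => (nomatch x))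
      (Sub.cons v1 fun _ x => (nomatch x))))
    (.cons a (.cons z (.cons n .nil)))

theorem eval_recN (e : M.Env Γ) (a : Tm Γ .nat) (s : Tm (.nat :: .nat :: Γ) .nat) (n : Tm Γ .nat) :
    M.eval e (recN a s n) = M.rec₀ (M.eval e a) (M.eval e s.lam.lam) (M.eval e n) := rfl

theorem ap_plusC (x y : M.D .nat) :
    x + y = M.rec₀ x (M.eval (.cons x .nil) (Tm.lam (Tm.lam (.suc v1)))) y := by
  change M.ap (M.ap (M.eval .nil plusC) x) y = _
  rw [plusC, ap_eval_lam, ap_eval_lam, eval_recN]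
  rfl

@[simp] theorem ap_succ (n : M.D .nat) : M.ap (M.cst .succ) n = n + 1 := by
  rw [ap_plusC]
  change _ = M.rec₀ _ _ (M.ap (M.cst .succ) 0)
  rw [rec₀_succ']
  simp

theorem rec₀_succ (a : M.D .nat) (z : M.D (.fn .nat .one)) (n : M.D .nat) :
    M.rec₀ a z (n + 1) = M.ap (M.ap z (M.rec₀ a z n)) n := by
  rw [← ap_succ, rec₀_succ']

/-- Induction for formulas of the language. -/
theorem induction (φ : Fm (.nat :: Γ)) (e : M.Env Γ) (h₀ : M.sat (.cons 0 e) φ)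
    (hs : ∀ n, M.sat (.cons n e) φ → M.sat (.cons (n + 1) e) φ) (n : M.D .nat) :
    M.sat (.cons n e) φ := by
  have h := IsModel.sound (Der.ax (H := []) (.inl (.induction φ))) e
  refine h ⟨(sat_inst φ .zero e).2 h₀, fun d hd => ?_⟩ n
  rw [sat_subst]
  refine (iff_of_eq (congrArg (fun e => M.sat e φ) ?_)).2 (hs d hd)
  funext τ x
  cases x with
  | zero => exact ap_succ d
  | succ x => rfl

theorem add_one_ne_zero' (n : M.D .nat) : n + 1 ≠ 0 := by
  rw [← ap_succ]
  have := IsModel.sound (Der.ax (H := []) (.inl (.succ_ne_zero v0))) (Env.cons n (.nil (M := M)))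
  rwa [sat_neg] at this

theorem add_one_inj' {m n : M.D .nat} (h : m + 1 = n + 1) : m = n := by
  rw [← ap_succ, ← ap_succ] at h
  exact IsModel.sound (Der.ax (H := []) (.inl (.succ_inj v0 v1)))
    (Env.cons m (.cons n (.nil (M := M)))) h

theorem eq_zero_or_succ (n : M.D .nat) : n = 0 ∨ ∃ m, n = m + 1 := by
  have := induction (M := M) (.or (.eq v0 .zero) (.ex .nat (.eq v1 (.suc v0)))) .nil
    (.inl rfl) (fun n _ => .inr ⟨n, (ap_succ n).symm⟩) n
  rcases this with h | ⟨d, h⟩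
  · exact .inl h
  · exact .inr ⟨d, h.trans (ap_succ d)⟩

/-! ### Addition and multiplication -/

theorem add_zero' (a : M.D .nat) : a + 0 = a := by rw [ap_plusC, rec₀_zero]

theorem add_succ' (a b : M.D .nat) : a + (b + 1) = a + b + 1 := by
  rw [ap_plusC a (b + 1), rec₀_succ, ← ap_plusC]
  simp

theorem add_assoc' (a b c : M.D .nat) : a + b + c = a + (b + c) := by
  have := induction (M := M) (.eq (plus (plus v1 v2) v0) (plus v1 (plus v2 v0)))
    (.cons a (.cons b .nil)) (by simp [sat, add_zero'])
    (by simp only [sat, eval_plus]; intro n h; simp at h; simp [add_succ', h]) c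
  simpa [sat] using this

theorem zero_add' (a : M.D .nat) : 0 + a = a := by
  have := induction (M := M) (.eq (plus .zero v0) v0) .nil (by simp [sat, add_zero'])
    (by intro n h; simp [sat] at h; simp [sat, add_succ', h]) a
  simpa [sat] using this

theorem succ_add' (a b : M.D .nat) : a + 1 + b = a + b + 1 := by
  have := induction (M := M) (.eq (plus (.suc v1) v0) (.suc (plus v1 v0))) (.cons a .nil)
    (by simp [sat, add_zero'])
    (by intro n h; simp [sat] at h; simp [sat, add_succ', h]) b
  simpa [sat] using this

theorem add_comm' (a b : M.D .nat) : a + b = b + a := by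
  have := induction (M := M) (.eq (plus v1 v0) (plus v0 v1)) (.cons a .nil)
    (by simp [sat, add_zero', zero_add'])
    (by intro n h; simp [sat] at h; simp [sat, add_succ', succ_add', h]) b
  simpa [sat] using this

instance : AddCommMonoid (M.D .nat) where
  add_assoc := add_assoc'
  zero_add := zero_add'
  add_zero := add_zero'
  add_comm := add_comm'
  nsmul := nsmulRec

theorem ap_timesC (x y : M.D .nat) :
    x * y = M.rec₀ 0 (M.eval (.cons x .nil) (Tm.lam (Tm.lam (plus v1 v2)))) y := by
  change M.ap (M.ap (M.eval .nil timesC) x) y = _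
  rw [timesC, ap_eval_lam, ap_eval_lam, eval_recN]
  congr 1

theorem mul_zero' (a : M.D .nat) : a * 0 = 0 := by rw [ap_timesC, rec₀_zero]

theorem mul_succ' (a b : M.D .nat) : a * (b + 1) = a * b + a := by
  rw [ap_timesC a (b + 1), rec₀_succ, ← ap_timesC]
  simp

theorem zero_mul' (a : M.D .nat) : 0 * a = 0 := by
  have := induction (M := M) (.eq (times .zero v0) .zero) .nil (by simp [sat, mul_zero'])
    (by intro n h; simp [sat] at h; simp [sat, mul_succ', h]) a
  simpa [sat] using this

theorem succ_mul' (a b : M.D .nat) : (a + 1) * b = a * b + b := by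
  have := induction (M := M) (.eq (times (.suc v1) v0) (plus (times v1 v0) v0)) (.cons a .nil)
    (by simp [sat, mul_zero'])
    (by intro n h; simp [sat] at h; simp [sat, mul_succ', h, add_assoc, add_comm, add_left_comm]) b
  simpa [sat] using this

theorem mul_comm' (a b : M.D .nat) : a * b = b * a := by
  have := induction (M := M) (.eq (times v1 v0) (times v0 v1)) (.cons a .nil)
    (by simp [sat, mul_zero', zero_mul'])
    (by intro n h; simp [sat] at h; simp [sat, mul_succ', succ_mul', h]) b
  simpa [sat] using this

theorem mul_add' (a b c : M.D .nat) : a * (b + c) = a * b + a * c := by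
  have := induction (M := M) (.eq (times v1 (plus v2 v0)) (plus (times v1 v2) (times v1 v0)))
    (.cons a (.cons b .nil)) (by simp [sat, mul_zero'])
    (by intro n h; simp [sat] at h; simp [sat, ← add_assoc, mul_succ', h]) c
  simpa [sat] using this

theorem mul_one' (a : M.D .nat) : a * 1 = a := by
  have := mul_succ' a 0
  rwa [zero_add, mul_zero', zero_add] at this

theorem mul_assoc' (a b c : M.D .nat) : a * b * c = a * (b * c) := by
  have := induction (M := M) (.eq (times (times v1 v2) v0) (times v1 (times v2 v0)))
    (.cons a (.cons b .nil)) (by simp [sat, mul_zero'])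
    (by intro n h; simp [sat] at h; simp [sat, mul_add', mul_one', h]) c
  simpa [sat] using this

instance : CommSemiring (M.D .nat) where
  mul_assoc := mul_assoc'
  mul_comm := mul_comm'
  one_mul a := by rw [mul_comm', mul_one']
  mul_one := mul_one'
  zero_mul := zero_mul'
  mul_zero := mul_zero'
  left_distrib := mul_add'
  right_distrib a b c := by rw [mul_comm', mul_add', mul_comm' c a, mul_comm' c b]

theorem add_right_cancel' {a b c : M.D .nat} : a + c = b + c → a = b := by
  have := induction (M := M) (.imp (.eq (plus v1 v0) (plus v2 v0)) (.eq v1 v2))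
    (.cons a (.cons b .nil)) (by simp [sat])
    (by intro n h h'; simp [sat, ← add_assoc] at h h'; exact h (add_one_inj' h')) c
  simpa [sat] using this

theorem eq_zero_of_add_eq_zero {a b : M.D .nat} (h : a + b = 0) : b = 0 := by
  rcases eq_zero_or_succ b with rfl | ⟨c, rfl⟩
  · rfl
  · exact (add_one_ne_zero' (a + c) (by rw [add_assoc]; exact h)).elim

theorem total' (a b : M.D .nat) : (∃ c, a + c = b) ∨ ∃ c, b + c = a := by
  have := induction (M := M) (.or (.ex .nat (.eq (plus v1 v0) v2)) (.ex .nat (.eq (plus v2 v0) v1)))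
    (.cons b .nil) (by simp [sat]) (by
      simp only [sat, eval_plus, eval_var, Env.cons_zero, Env.cons_succ]
      rintro n (⟨c, rfl⟩ | ⟨c, rfl⟩)
      · rcases eq_zero_or_succ c with rfl | ⟨d, rfl⟩
        · exact .inr ⟨1, by simp⟩
        · exact .inl ⟨d, by ring⟩
      · exact .inr ⟨c + 1, by ring⟩) a
  simpa [sat] using this

open Classical in
noncomputable instance : LinearOrder (M.D .nat) where
  le a b := ∃ c, a + c = b
  le_refl a := ⟨0, add_zero a⟩
  le_trans := by
    rintro a _ _ ⟨c, rfl⟩ ⟨d, rfl⟩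
    exact ⟨c + d, (add_assoc _ _ _).symm⟩
  le_antisymm := by
    rintro a b ⟨c, rfl⟩ ⟨d, h⟩
    have : c + d = 0 := add_right_cancel' (c := a) (by rw [zero_add, add_comm, ← add_assoc, h])
    rw [add_comm] at this
    rw [eq_zero_of_add_eq_zero this, add_zero]
  le_total := total'
  toDecidableLE := Classical.decRel _

instance : CanonicallyOrderedAdd (M.D .nat) where
  exists_add_of_le := fun ⟨c, h⟩ => ⟨c, h.symm⟩
  le_add_self _ b := ⟨b, add_comm _ _⟩
  le_self_add _ b := ⟨b, rfl⟩

theorem lt_iff_add_one_le {a b : M.D .nat} : a < b ↔ a + 1 ≤ b := by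
  rw [lt_iff_le_not_ge]
  constructor
  · rintro ⟨⟨c, rfl⟩, h⟩
    rcases eq_zero_or_succ c with rfl | ⟨d, rfl⟩
    · exact (h ⟨0, by simp⟩).elim
    · exact ⟨d, by ring⟩
  · rintro ⟨c, rfl⟩
    refine ⟨⟨1 + c, by ring⟩, fun ⟨d, hd⟩ => ?_⟩
    have : c + d + 1 = 0 := add_right_cancel' (c := a) (by rw [zero_add]; exact Eq.trans (by ring) hd)
    exact add_one_ne_zero' _ this

instance : IsStrictOrderedRing (M.D .nat) where
  add_le_add_left := by
    rintro a _ ⟨c, rfl⟩ b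
    exact ⟨c, by ring⟩
  le_of_add_le_add_left := by
    rintro a b c ⟨d, h⟩
    exact ⟨d, add_right_cancel' (c := a) (by rw [add_comm c a, ← h]; ring)⟩
  zero_le_one := ⟨1, zero_add 1⟩
  exists_pair_ne := ⟨0, 1, fun h => add_one_ne_zero' (0 : M.D .nat) (by rw [zero_add, h])⟩
  mul_lt_mul_of_pos_left := by
    intro a ha b c h
    rw [lt_iff_add_one_le] at *
    obtain ⟨x, rfl⟩ := ha
    obtain ⟨y, rfl⟩ := h
    exact ⟨y + x * (y + 1), by ring⟩
  mul_lt_mul_of_pos_right := by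
    intro a ha b c h
    rw [lt_iff_add_one_le] at *
    obtain ⟨x, rfl⟩ := ha
    obtain ⟨y, rfl⟩ := h
    exact ⟨y + x * (y + 1), by ring⟩

theorem add_one_ne_zero (n : M.D .nat) : n + 1 ≠ 0 := add_one_ne_zero' n

/-- The step term of a defined function is formed in a context containing the recursion argument
without using it. Removing this variable leaves one step functional for all arguments, so that the
recursion equations apply. -/
theorem eval_lam_lam (e : M.Env Γ) (d : M.D δ) (s : Tm (ρ :: σ :: Γ) τ) :
    M.eval (.cons d e) (Tm.lam (Tm.lam (s.rename (Ren.lift (Ren.lift fun _ x => .succ x))))) =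
      M.eval e (Tm.lam (Tm.lam s)) := by
  rw [← eval_wk d e, Tm.wk, Tm.lam_rename, Tm.lam_rename]

/-! ### Predecessor, truncated subtraction, case distinction -/

def predN (x : M.D .nat) : M.D .nat := M.ap (M.eval .nil predC) x
def monusN (x y : M.D .nat) : M.D .nat := M.ap (M.ap (M.eval .nil monusC) x) y
def condN (c x y : M.D .nat) : M.D .nat := M.ap (M.ap (M.ap (M.eval .nil condC) c) x) y

@[simp] theorem eval_pred (e : M.Env Γ) (s : Tm Γ .nat) :
    M.eval e (pred s) = predN (M.eval e s) := by
  simp only [pred, eval_app, eval_closed, predN]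
@[simp] theorem eval_monus (e : M.Env Γ) (s t : Tm Γ .nat) :
    M.eval e (monus s t) = monusN (M.eval e s) (M.eval e t) := by
  simp only [monus, eval_app, eval_closed, monusN]
@[simp] theorem eval_cond (e : M.Env Γ) (c s t : Tm Γ .nat) :
    M.eval e (cond c s t) = condN (M.eval e c) (M.eval e s) (M.eval e t) := by
  simp only [cond, eval_app, eval_closed, condN]

theorem predN_eq (x : M.D .nat) :
    predN x = M.rec₀ 0 (M.eval .nil (Tm.lam (Tm.lam v0))) x := by
  rw [predN, predC, ap_eval_lam, eval_recN]
  rfl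

@[simp] theorem predN_zero : predN (0 : M.D .nat) = 0 := by rw [predN_eq, rec₀_zero]
@[simp] theorem predN_succ (x : M.D .nat) : predN (x + 1) = x := by
  rw [predN_eq, rec₀_succ, ap_eval_lam, ap_eval_lam]; rfl

@[simp] theorem condN_zero (x y : M.D .nat) : condN 0 x y = x := by
  rw [condN, condC, ap_eval_lam, ap_eval_lam, ap_eval_lam, eval_recN]
  exact rec₀_zero _ _

@[simp] theorem condN_succ (c x y : M.D .nat) : condN (c + 1) x y = y := by
  rw [condN, condC, ap_eval_lam, ap_eval_lam, ap_eval_lam, eval_recN]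
  refine (rec₀_succ _ _ _).trans ?_
  rw [ap_eval_lam, ap_eval_lam]
  rfl

theorem condN_of_ne {c : M.D .nat} (h : c ≠ 0) (x y : M.D .nat) : condN c x y = y := by
  obtain ⟨d, rfl⟩ := (eq_zero_or_succ c).resolve_left h
  exact condN_succ d x y

theorem monusN_eq (x y : M.D .nat) :
    monusN x y = M.rec₀ x (M.eval .nil (Tm.lam (Tm.lam (pred v1)))) y := by
  rw [monusN, monusC, ap_eval_lam, ap_eval_lam, eval_recN]
  rfl

theorem monusN_zero (x : M.D .nat) : monusN x 0 = x := by rw [monusN_eq, rec₀_zero]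

theorem monusN_succ (x y : M.D .nat) : monusN x (y + 1) = predN (monusN x y) := by
  rw [monusN_eq x (y + 1), rec₀_succ, ← monusN_eq, ap_eval_lam, ap_eval_lam]
  simp

@[simp] theorem monusN_add_left (x y : M.D .nat) : monusN (x + y) x = y := by
  have := induction (M := M) (.all .nat (.eq (monus (plus v1 v0) v1) v0)) .nil
    (by simp [sat, monusN_zero])
    (by
      intro n h d
      simp only [sat, eval_monus, eval_plus, eval_var, Env.cons_zero, Env.cons_succ] at h ⊢
      rw [monusN_succ, show n + 1 + d = n + (d + 1) by ring, h, predN_succ]) x y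
  simpa [sat] using this

@[simp] theorem monusN_add_right (x y : M.D .nat) : monusN x (x + y) = 0 := by
  have := induction (M := M) (.eq (monus v1 (plus v1 v0)) .zero) (.cons x .nil)
    (by simpa [sat] using monusN_add_left x 0)
    (by
      intro n h
      simp only [sat, eval_monus, eval_plus, eval_var, Env.cons_zero, Env.cons_succ] at h ⊢
      rw [← add_assoc, monusN_succ, h]
      exact predN_zero) y
  simpa [sat] using this

@[simp] theorem monusN_eq_zero {x y : M.D .nat} : monusN x y = 0 ↔ x ≤ y := by
  constructor
  · intro h
    rcases le_total x y with h' | ⟨c, rfl⟩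
    · exact h'
    · rw [monusN_add_left] at h
      simp [h]
  · rintro ⟨c, rfl⟩
    exact monusN_add_right x c

@[simp] theorem sat_leN (e : M.Env Γ) (s t : Tm Γ .nat) :
    M.sat e (leN s t) ↔ M.eval e s ≤ M.eval e t := by
  simp [leN, sat]

theorem le_succ_iff {x y : M.D .nat} : x ≤ y + 1 ↔ x ≤ y ∨ x = y + 1 := by
  rw [le_iff_lt_or_eq]
  refine or_congr ?_ Iff.rfl
  rw [lt_iff_add_one_le]
  exact add_le_add_iff_right 1

/-! ### Bounded search -/

def muN (p : M.D .one) (b : M.D .nat) : M.D .nat := M.ap (M.ap (M.eval .nil muC) p) b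

@[simp] theorem eval_mu (e : M.Env Γ) (p : Tm Γ .one) (b : Tm Γ .nat) :
    M.eval e (mu p b) = muN (M.eval e p) (M.eval e b) := by
  simp only [mu, eval_app, eval_closed, muN]

theorem muN_eq (p : M.D .one) (b : M.D .nat) :
    muN p b = M.rec₀ 0 (M.eval (.cons p .nil) (Tm.lam (Tm.lam
      (cond (.app v2 v1) v1 (cond (.app v2 (.suc v0)) (.suc v0) .zero))))) b := by
  rw [muN, muC, ap_eval_lam, ap_eval_lam, eval_recN]
  rfl

theorem muN_zero (p : M.D .one) : muN p 0 = 0 := by rw [muN_eq, rec₀_zero]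

theorem muN_succ (p : M.D .one) (b : M.D .nat) :
    muN p (b + 1) =
      condN (M.ap p (muN p b)) (muN p b) (condN (M.ap p (b + 1)) (b + 1) 0) := by
  rw [muN_eq p (b + 1), rec₀_succ, ← muN_eq, ap_eval_lam, ap_eval_lam]
  simp

/-- Induction on the bound: a successful search is kept, and an unsuccessful one leaves the new
bound as the only possible zero. -/
theorem ap_muN {p : M.D .one} {b u : M.D .nat} (hu : u ≤ b) (h : M.ap p u = 0) :
    M.ap p (muN p b) = 0 := by
  have := induction (M := M) (.all .nat (.imp (leN v0 v1) (.imp (.eq (.app v2 v0) .zero)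
      (.eq (.app v2 (mu v2 v1)) .zero)))) (.cons p .nil)
    (by simp [sat, muN_zero])
    (by
      intro n ih d
      have ih := ih d
      simp [sat, muN_succ] at ih ⊢
      intro hd hp
      by_cases h₀ : M.ap p (muN p n) = 0
      · rw [h₀]; simpa using h₀
      · rw [condN_of_ne h₀]
        rcases le_succ_iff.1 hd with hd | rfl
        · exact (h₀ (ih hd hp)).elim
        · rw [hp]; simpa using hp) b u
  simp [sat] at this
  exact this hu h

/-! ### Parity, halves, powers of two -/

def parityN (x : M.D .nat) : M.D .nat := M.ap (M.eval .nil parityC) x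
def halfN (x : M.D .nat) : M.D .nat := M.ap (M.eval .nil halfC) x
def pow2N (x : M.D .nat) : M.D .nat := M.ap (M.eval .nil pow2C) x

@[simp] theorem eval_parity (e : M.Env Γ) (s : Tm Γ .nat) :
    M.eval e (parity s) = parityN (M.eval e s) := by
  simp only [parity, eval_app, eval_closed, parityN]
@[simp] theorem eval_half (e : M.Env Γ) (s : Tm Γ .nat) :
    M.eval e (half s) = halfN (M.eval e s) := by
  simp only [half, eval_app, eval_closed, halfN]
@[simp] theorem eval_pow2 (e : M.Env Γ) (s : Tm Γ .nat) :
    M.eval e (pow2 s) = pow2N (M.eval e s) := by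
  simp only [pow2, eval_app, eval_closed, pow2N]

theorem parityN_eq (x : M.D .nat) :
    parityN x = M.rec₀ 0 (M.eval .nil (Tm.lam (Tm.lam (monus (.suc .zero) v1)))) x := by
  rw [parityN, parityC, ap_eval_lam, eval_recN]
  have := eval_lam_lam (ρ := .nat) (σ := .nat) .nil x (monus (.suc .zero) v1)
  simp only [monus, Tm.rename, Ren.lift, Tm.closed_rename] at this
  exact congrArg (M.rec₀ _ · x) this

theorem halfN_eq (x : M.D .nat) :
    halfN x = M.rec₀ 0 (M.eval .nil (Tm.lam (Tm.lam (plus v1 (parity v0))))) x := by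
  rw [halfN, halfC, ap_eval_lam, eval_recN]
  have := eval_lam_lam (ρ := .nat) (σ := .nat) .nil x (plus v1 (parity v0))
  simp only [plus, parity, Tm.rename, Ren.lift, Tm.closed_rename] at this
  exact congrArg (M.rec₀ _ · x) this

theorem pow2N_eq (x : M.D .nat) :
    pow2N x = M.rec₀ 1 (M.eval .nil (Tm.lam (Tm.lam (plus v1 v1)))) x := by
  rw [pow2N, pow2C, ap_eval_lam, eval_recN]
  have := eval_lam_lam (ρ := .nat) (σ := .nat) .nil x (plus v1 v1)
  simp only [plus, Tm.rename, Ren.lift, Tm.closed_rename] at this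
  exact congrArg (M.rec₀ _ · x) this

@[simp] theorem parityN_zero : parityN (0 : M.D .nat) = 0 := by rw [parityN_eq, rec₀_zero]
@[simp] theorem halfN_zero : halfN (0 : M.D .nat) = 0 := by rw [halfN_eq, rec₀_zero]
@[simp] theorem pow2N_zero : pow2N (0 : M.D .nat) = 1 := by rw [pow2N_eq, rec₀_zero]

theorem parityN_succ (x : M.D .nat) : parityN (x + 1) = monusN 1 (parityN x) := by
  rw [parityN_eq (x + 1), rec₀_succ, ← parityN_eq, ap_eval_lam, ap_eval_lam]
  simp
theorem halfN_succ (x : M.D .nat) : halfN (x + 1) = halfN x + parityN x := by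
  rw [halfN_eq (x + 1), rec₀_succ, ← halfN_eq, ap_eval_lam, ap_eval_lam]
  simp
theorem pow2N_succ (x : M.D .nat) : pow2N (x + 1) = 2 * pow2N x := by
  rw [pow2N_eq (x + 1), rec₀_succ, ← pow2N_eq, ap_eval_lam, ap_eval_lam]
  simp [two_mul]

theorem monusN_one_one : monusN (1 : M.D .nat) 1 = 0 := monusN_eq_zero.2 le_rfl

theorem parityN_and_halfN (x : M.D .nat) :
    (parityN x = 0 ∧ x = 2 * halfN x) ∨ (parityN x = 1 ∧ x = 2 * halfN x + 1) := by
  have := induction (M := M)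
    (.or (.and (.eq (parity v0) .zero) (.eq v0 (plus (half v0) (half v0))))
      (.and (.eq (parity v0) (.suc .zero)) (.eq v0 (.suc (plus (half v0) (half v0)))))) .nil
    (by simp [sat])
    (by
      intro n ih
      simp only [sat, eval_parity, eval_half, eval_plus, eval_var, Env.cons_zero, eval_app,
        eval_cst, ap_succ, cst_zero, parityN_succ, halfN_succ] at ih ⊢
      rcases ih with ⟨h₁, h₂⟩ | ⟨h₁, h₂⟩
      · rw [h₁]
        exact .inr ⟨by rw [monusN_zero, zero_add], by rw [add_zero, ← h₂]⟩
      · rw [h₁]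
        refine .inl ⟨by simp [monusN_one_one], ?_⟩
        conv_lhs => rw [h₂]
        ring) x
  simp only [sat, eval_parity, eval_half, eval_plus, eval_var, Env.cons_zero, eval_app,
    eval_cst, ap_succ, cst_zero, zero_add, ← two_mul] at this
  exact this

theorem two_mul_ne (a b : M.D .nat) : 2 * a ≠ 2 * b + 1 := by
  intro h
  rcases lt_or_ge b a with h' | h'
  · obtain ⟨c, rfl⟩ := lt_iff_add_one_le.1 h'
    have : 1 + 2 * c + 1 = (0 : M.D .nat) + 1 :=
      add_right_cancel (b := 2 * b) (by linear_combination h)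
    have := add_right_cancel this
    rw [add_comm] at this
    exact add_one_ne_zero _ this
  · obtain ⟨c, rfl⟩ := h'
    have : (0 : M.D .nat) = 2 * c + 1 := add_right_cancel (b := 2 * a) (by linear_combination h)
    exact add_one_ne_zero _ this.symm

theorem two_mul_inj {a b : M.D .nat} (h : 2 * a = 2 * b) : a = b := by
  rcases lt_trichotomy a b with h' | h' | h'
  · exact absurd h (mul_lt_mul_of_pos_left h' two_pos).ne
  · exact h'
  · exact absurd h (mul_lt_mul_of_pos_left h' two_pos).ne'

theorem parityN_two_mul (a : M.D .nat) : parityN (2 * a) = 0 :=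
  (parityN_and_halfN (2 * a)).elim (·.1) fun h => (two_mul_ne _ _ h.2).elim

theorem halfN_two_mul (a : M.D .nat) : halfN (2 * a) = a :=
  (parityN_and_halfN (2 * a)).elim (fun h => (two_mul_inj h.2).symm)
    fun h => (two_mul_ne _ _ h.2).elim

theorem parityN_two_mul_add_one (a : M.D .nat) : parityN (2 * a + 1) = 1 := by
  rw [parityN_succ, parityN_two_mul, monusN_zero]

theorem halfN_two_mul_add_one (a : M.D .nat) : halfN (2 * a + 1) = a := by
  rw [halfN_succ, halfN_two_mul, parityN_two_mul, add_zero]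

theorem succ_le_pow2N (x : M.D .nat) : x + 1 ≤ pow2N x := by
  have := induction (M := M) (leN (.suc v0) (pow2 v0)) .nil (by simp)
    (by
      intro n h
      simp only [sat_leN, eval_app, eval_cst, ap_succ, eval_var, Env.cons_zero, eval_pow2,
        pow2N_succ] at h ⊢
      calc n + 1 + 1 ≤ (n + 1) + (n + 1) := by
            obtain h := le_add_self (a := (1 : M.D .nat)) (b := n)
            exact add_le_add_right h _
        _ ≤ 2 * pow2N n := by rw [two_mul]; exact add_le_add h h) x
  simpa using this

/-! ### The pairing function -/

def pairN (x y : M.D .nat) : M.D .nat := M.ap (M.ap (M.eval .nil pairC) x) y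
def fstN (x : M.D .nat) : M.D .nat := M.ap (M.eval .nil fstC) x
def sndN (x : M.D .nat) : M.D .nat := M.ap (M.eval .nil sndC) x

@[simp] theorem eval_pair (e : M.Env Γ) (s t : Tm Γ .nat) :
    M.eval e (pair s t) = pairN (M.eval e s) (M.eval e t) := by
  simp only [pair, eval_app, eval_closed, pairN]
@[simp] theorem eval_fst (e : M.Env Γ) (s : Tm Γ .nat) :
    M.eval e (fst s) = fstN (M.eval e s) := by
  simp only [fst, eval_app, eval_closed, fstN]
@[simp] theorem eval_snd (e : M.Env Γ) (s : Tm Γ .nat) :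
    M.eval e (snd s) = sndN (M.eval e s) := by
  simp only [snd, eval_app, eval_closed, sndN]

/-- With `s = n + m` the right side is `s(s + 1) + 2n`, which is even. The witnesses come from `s =
2k` and `s = 2k + 1`. -/
theorem exists_two_mul_eq (n m : M.D .nat) :
    ∃ u, u ≤ (n + m) * (n + m) + (n + (n + n)) + m ∧
      2 * u = (n + m) * (n + m) + (n + (n + n)) + m := by
  obtain ⟨u, hu⟩ : ∃ u, 2 * u = (n + m) * (n + m) + (n + (n + n)) + m := by
    rcases parityN_and_halfN (n + m) with ⟨-, h⟩ | ⟨-, h⟩ <;>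
      generalize halfN (n + m) = k at h
    · refine ⟨2 * k * k + k + n, ?_⟩
      calc _ = 2 * k * (2 * k) + 2 * k + 2 * n := by ring
        _ = (n + m) * (n + m) + (n + m) + 2 * n := by rw [h]
        _ = _ := by ring
    · refine ⟨(2 * k + 1) * (k + 1) + n, ?_⟩
      calc _ = (2 * k + 1) * (2 * k + 1) + (2 * k + 1) + 2 * n := by ring
        _ = (n + m) * (n + m) + (n + m) + 2 * n := by rw [h]
        _ = _ := by ring
  exact ⟨u, by rw [← hu, two_mul]; exact le_self_add, hu⟩

/-- The search looks for a zero of the sum of the two truncated differences of `2u` and the Cantor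
sum, and such a zero exists below the bound. -/
theorem two_mul_pairN (n m : M.D .nat) :
    2 * pairN n m = (n + m) * (n + m) + (n + (n + n)) + m := by
  obtain ⟨u, hu, hu'⟩ := exists_two_mul_eq n m
  set c := (n + m) * (n + m) + (n + (n + n)) + m with hc
  let p : M.D .one := M.eval (.cons m (.cons n .nil))
    (.lam (plus (monus (plus v0 v0) (cantorSum v2 v1)) (monus (cantorSum v2 v1) (plus v0 v0))))
  have hp : ∀ x, M.ap p x = monusN (x + x) c + monusN c (x + x) := by
    intro x
    rw [ap_eval_lam]
    simp [cantorSum, hc]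
  have hpair : pairN n m = muN p c := by
    rw [pairN, pairC, ap_eval_lam, ap_eval_lam, eval_mu]
    simp [cantorSum, hc, p]
  have h₀ := ap_muN (p := p) hu (by rw [hp, ← two_mul, hu', monusN_eq_zero.2 le_rfl, add_zero])
  rw [hp, ← hpair, ← two_mul] at h₀
  have h₂ := eq_zero_of_add_eq_zero h₀
  rw [h₂, add_zero] at h₀
  exact le_antisymm (monusN_eq_zero.1 h₀) (monusN_eq_zero.1 h₂)

variable (M) in
/-- Simultaneous recursion of two sequences of numbers that start with zero. -/
def rec₂ (i : Var [Ty.nat, Ty.nat] .nat) (z₁ z₂ : M.D (.fn .nat (.fn .nat .one)))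
    (n : M.D .nat) : M.D .nat :=
  M.ap (M.ap (M.ap (M.ap (M.ap (M.cst (.recur [.nat, .nat] i)) n) 0) 0) z₁) z₂

section
variable (z₁ z₂ : M.D (.fn .nat (.fn .nat .one)))

/-- The tuple of two terms. -/
abbrev Sub.two {a b : Ty} (s : Tm Γ a) (t : Tm Γ b) : Sub [a, b] Γ :=
  Sub.cons s (Sub.cons t fun _ x => (nomatch x))

theorem rec₂_zero₁ : M.rec₂ .zero z₁ z₂ 0 = 0 :=
  eval_eq_of_axiom (Γ := [.fn .nat (.fn .nat .one), .fn .nat (.fn .nat .one)])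
    (.inl (.rec_zero [.nat, .nat] .zero (Sub.two .zero .zero) (Sub.two v0 v1)))
    (.cons z₁ (.cons z₂ .nil))

theorem rec₂_zero₂ : M.rec₂ (.succ .zero) z₁ z₂ 0 = 0 :=
  eval_eq_of_axiom (Γ := [.fn .nat (.fn .nat .one), .fn .nat (.fn .nat .one)])
    (.inl (.rec_zero [.nat, .nat] (.succ .zero) (Sub.two .zero .zero) (Sub.two v0 v1)))
    (.cons z₁ (.cons z₂ .nil))

theorem rec₂_succ₁ (n : M.D .nat) : M.rec₂ .zero z₁ z₂ (M.ap (M.cst .succ) n) =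
    M.ap (M.ap (M.ap z₁ (M.rec₂ .zero z₁ z₂ n)) (M.rec₂ (.succ .zero) z₁ z₂ n)) n :=
  eval_eq_of_axiom (Γ := [.fn .nat (.fn .nat .one), .fn .nat (.fn .nat .one), .nat])
    (.inl (.rec_succ [.nat, .nat] .zero v2 (Sub.two .zero .zero) (Sub.two v0 v1)))
    (.cons z₁ (.cons z₂ (.cons n .nil)))

theorem rec₂_succ₂ (n : M.D .nat) : M.rec₂ (.succ .zero) z₁ z₂ (M.ap (M.cst .succ) n) =
    M.ap (M.ap (M.ap z₂ (M.rec₂ .zero z₁ z₂ n)) (M.rec₂ (.succ .zero) z₁ z₂ n)) n :=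
  eval_eq_of_axiom (Γ := [.fn .nat (.fn .nat .one), .fn .nat (.fn .nat .one), .nat])
    (.inl (.rec_succ [.nat, .nat] (.succ .zero) v2 (Sub.two .zero .zero) (Sub.two v0 v1)))
    (.cons z₁ (.cons z₂ (.cons n .nil)))

end

variable (M) in
def stepN₁ : M.D (.fn .nat (.fn .nat .one)) := M.eval .nil unpairStep₁
variable (M) in
def stepN₂ : M.D (.fn .nat (.fn .nat .one)) := M.eval .nil unpairStep₂

theorem ap_stepN₁ (a b x : M.D .nat) :
    M.ap (M.ap (M.ap M.stepN₁ a) b) x = condN b 0 (a + 1) := by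
  change M.ap (M.ap (M.ap (M.eval .nil (Tm.lam (Tm.lam (Tm.lam (cond v1 .zero (.suc v2)))) :
    Tm [] (.fn .nat (.fn .nat .one)))) a) b) x = _
  rw [ap_eval_lam, ap_eval_lam, ap_eval_lam]
  simp

theorem ap_stepN₂ (a b x : M.D .nat) :
    M.ap (M.ap (M.ap M.stepN₂ a) b) x = condN b (a + 1) (predN b) := by
  change M.ap (M.ap (M.ap (M.eval .nil (Tm.lam (Tm.lam (Tm.lam (cond v1 (.suc v2) (pred v1)))) :
    Tm [] (.fn .nat (.fn .nat .one)))) a) b) x = _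
  rw [ap_eval_lam, ap_eval_lam, ap_eval_lam]
  simp

theorem fstN_eq (x : M.D .nat) : fstN x = M.rec₂ .zero M.stepN₁ M.stepN₂ x := by
  rw [fstN, fstC, ap_eval_lam]
  exact congrArg₂ (fun a b => M.rec₂ .zero a b x) (eval_closed _ unpairStep₁)
    (eval_closed _ unpairStep₂)

theorem sndN_eq (x : M.D .nat) : sndN x = M.rec₂ (.succ .zero) M.stepN₁ M.stepN₂ x := by
  rw [sndN, sndC, ap_eval_lam]
  exact congrArg₂ (fun a b => M.rec₂ (.succ .zero) a b x) (eval_closed _ unpairStep₁)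
    (eval_closed _ unpairStep₂)

theorem fstN_zero : fstN (0 : M.D .nat) = 0 := by rw [fstN_eq, rec₂_zero₁]

theorem sndN_zero : sndN (0 : M.D .nat) = 0 := by rw [sndN_eq, rec₂_zero₂]

theorem fstN_succ (x : M.D .nat) : fstN (x + 1) = condN (sndN x) 0 (fstN x + 1) := by
  rw [fstN_eq (x + 1), ← ap_succ, rec₂_succ₁, ← fstN_eq, ← sndN_eq, ap_stepN₁]

theorem sndN_succ (x : M.D .nat) :
    sndN (x + 1) = condN (sndN x) (fstN x + 1) (predN (sndN x)) := by
  rw [sndN_eq (x + 1), ← ap_succ, rec₂_succ₂, ← fstN_eq, ← sndN_eq, ap_stepN₂]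

/-- Each step of the enumeration raises `(a + b)² + 3a + b` by exactly `2`, whether it moves along a
diagonal or starts a new one. -/
theorem two_mul_eq_unpair (x : M.D .nat) : 2 * x =
    (fstN x + sndN x) * (fstN x + sndN x) + (fstN x + (fstN x + fstN x)) + sndN x := by
  have := induction (M := M) (.eq (plus v0 v0) (cantorSum (fst v0) (snd v0))) .nil
    (by simp [sat, cantorSum, fstN_zero, sndN_zero])
    (by
      intro n ih
      simp only [sat, cantorSum, eval_plus, eval_times, eval_fst, eval_snd, eval_var,
        Env.cons_zero] at ih ⊢
      rw [fstN_succ, sndN_succ, add_add_add_comm, ih]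
      rcases eq_zero_or_succ (sndN n) with h | ⟨d, h⟩ <;> rw [h]
      · rw [condN_zero, condN_zero]
        ring
      · rw [condN_succ, condN_succ, predN_succ]
        ring) x
  simp only [sat, cantorSum, eval_plus, eval_times, eval_fst, eval_snd, eval_var,
    Env.cons_zero] at this
  rw [two_mul, this]

/-- The numbers `(n + m)² + 3n + m` determine `n + m`. -/
theorem cantor_le {n m n' m' : M.D .nat}
    (h : (n + m) * (n + m) + (n + (n + n)) + m = (n' + m') * (n' + m') + (n' + (n' + n')) + m') :
    n + m ≤ n' + m' := by
  by_contra! hlt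
  -- With `s = n + m` and `s' = n' + m'`, the bound `s ≥ s' + 1` makes `s(s + 1)` at least `(s' +
  -- 1)(s' + 2)`, which exceeds `s'(s' + 1) + 2n'` by `2m' + 2`. The difference `c` lets this be
  -- written without subtraction.
  obtain ⟨c, hc⟩ := lt_iff_add_one_le.1 hlt
  have h₁ : (n + m) * (n + m) + (n + (n + n)) + m = (n + m) * (n + m + 1) + 2 * n := by ring
  have h₂ : (n' + m') * (n' + m') + (n' + (n' + n')) + m' + 2 * m' + 2 =
      (n' + m' + 1) * (n' + m' + 1 + 1) := by ring
  have h₃ : (n + m) * (n + m + 1) =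
      (n' + m' + 1) * (n' + m' + 1 + 1) + (c * (c + 1) + 2 * c * (n' + m' + 1)) := by
    rw [← hc]; ring
  have h₄ : (n' + m') * (n' + m') + (n' + (n' + n')) + m' =
      (n' + m') * (n' + m') + (n' + (n' + n')) + m' +
        (2 * m' + 2 + (c * (c + 1) + 2 * c * (n' + m' + 1)) + 2 * n) := by
    calc _ = (n + m) * (n + m + 1) + 2 * n := by rw [← h, h₁]
      _ = _ := by rw [h₃, ← h₂]; ring
  have h₅ := add_left_cancel ((add_zero _).trans h₄)
  exact add_one_ne_zero (2 * m' + 1 + (c * (c + 1) + 2 * c * (n' + m' + 1)) + 2 * n)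
    (h₅.trans (by ring)).symm

theorem cantor_inj {n m n' m' : M.D .nat}
    (h : (n + m) * (n + m) + (n + (n + n)) + m = (n' + m') * (n' + m') + (n' + (n' + n')) + m') :
    n = n' ∧ m = m' := by
  have hs := le_antisymm (cantor_le h) (cantor_le h.symm)
  have h₁ : ∀ a b : M.D .nat,
      (a + b) * (a + b) + (a + (a + a)) + b = (a + b) * (a + b) + (a + b) + 2 * a := by
    intro a b; ring
  rw [h₁, h₁, hs] at h
  have hn := two_mul_inj (add_left_cancel h)
  exact ⟨hn, by rw [hn] at hs; exact add_left_cancel hs⟩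

/-- The recursively computed projections and the searched pair satisfy the same Cantor equation, and
this equation has a unique solution. -/
theorem fstN_sndN_pairN (n m : M.D .nat) : fstN (pairN n m) = n ∧ sndN (pairN n m) = m :=
  cantor_inj ((two_mul_eq_unpair _).symm.trans (two_mul_pairN n m))

@[simp] theorem fstN_pairN (n m : M.D .nat) : fstN (pairN n m) = n := (fstN_sndN_pairN n m).1
@[simp] theorem sndN_pairN (n m : M.D .nat) : sndN (pairN n m) = m := (fstN_sndN_pairN n m).2

end Interp

/-! ### The ordered field generated by an ordered semiring -/


section Field

variable (N : Type) [CommSemiring N] [LinearOrder N] [IsStrictOrderedRing N]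

/-- Formal differences. -/
def diffSetoid : Setoid (N × N) where
  r p q := p.1 + q.2 = q.1 + p.2
  iseqv := by
    refine ⟨fun _ => rfl, fun h => h.symm, ?_⟩
    rintro ⟨a, a'⟩ ⟨b, b'⟩ ⟨c, c'⟩ h h'
    simp only at *
    apply add_right_cancel (b := b + b')
    calc a + c' + (b + b') = (a + b') + (b + c') := by ring
      _ = (b + a') + (c + b') := by rw [h, h']
      _ = c + a' + (b + b') := by ring

def Diff : Type := Quotient (diffSetoid N)

namespace Diff

variable {N}

def mk (a b : N) : Diff N := Quotient.mk (diffSetoid N) (a, b)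

theorem mk_eq {a b c d : N} : mk a b = mk c d ↔ a + d = c + b :=
  ⟨fun h => Quotient.exact h, fun h => Quotient.sound h⟩

theorem ind {P : Diff N → Prop} (h : ∀ a b, P (mk a b)) (x : Diff N) : P x :=
  Quotient.ind (fun p => h p.1 p.2) x

instance : Zero (Diff N) := ⟨mk 0 0⟩
instance : One (Diff N) := ⟨mk 1 0⟩
instance : Neg (Diff N) := ⟨Quotient.map (fun p => (p.2, p.1)) <| by
  rintro ⟨a, b⟩ ⟨c, d⟩ (h : a + d = c + b)
  change b + c = d + a
  rw [add_comm b, add_comm d, h]⟩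
instance : Add (Diff N) := ⟨Quotient.map₂ (fun p q => (p.1 + q.1, p.2 + q.2)) <| by
  rintro ⟨a, b⟩ ⟨c, d⟩ (h : a + d = c + b) ⟨a', b'⟩ ⟨c', d'⟩ (h' : a' + d' = c' + b')
  change a + a' + (d + d') = c + c' + (b + b')
  rw [add_add_add_comm, h, h', add_add_add_comm]⟩
instance : Mul (Diff N) :=
  ⟨Quotient.map₂ (fun p q => (p.1 * q.1 + p.2 * q.2, p.1 * q.2 + p.2 * q.1)) <| by
  rintro ⟨a, b⟩ ⟨c, d⟩ (h : a + d = c + b) ⟨a', b'⟩ ⟨c', d'⟩ (h' : a' + d' = c' + b')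
  change a * a' + b * b' + (c * d' + d * c') = c * c' + d * d' + (a * b' + b * a')
  apply add_right_cancel (b := d * a' + c * b')
  calc _ = (a + d) * a' + (c + b) * b' + (c * d' + d * c') := by ring
    _ = (c + b) * a' + (a + d) * b' + (c * d' + d * c') := by rw [h]
    _ = c * (a' + d') + d * (c' + b') + (b * a' + a * b') := by ring
    _ = c * (c' + b') + d * (a' + d') + (b * a' + a * b') := by rw [h']
    _ = _ := by ring⟩

theorem add_mk (a b c d : N) : mk a b + mk c d = mk (a + c) (b + d) := rfl
theorem mul_mk (a b c d : N) : mk a b * mk c d = mk (a * c + b * d) (a * d + b * c) := rfl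
theorem neg_mk (a b : N) : -mk a b = mk b a := rfl
theorem zero_def : (0 : Diff N) = mk 0 0 := rfl
theorem one_def : (1 : Diff N) = mk 1 0 := rfl

instance : CommRing (Diff N) where
  add_assoc x y z := by
    induction x using ind; induction y using ind; induction z using ind
    simp only [add_mk, add_assoc]
  zero_add x := by induction x using ind; simp [add_mk, zero_def]
  add_zero x := by induction x using ind; simp [add_mk, zero_def]
  add_comm x y := by
    induction x using ind; induction y using ind
    simp only [add_mk, mk_eq]; ring
  mul_assoc x y z := by
    induction x using ind; induction y using ind; induction z using ind
    simp only [mul_mk, mk_eq]; ring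
  one_mul x := by induction x using ind; simp [mul_mk, one_def]
  mul_one x := by induction x using ind; simp [mul_mk, one_def]
  zero_mul x := by induction x using ind; simp [mul_mk, zero_def]
  mul_zero x := by induction x using ind; simp [mul_mk, zero_def]
  left_distrib x y z := by
    induction x using ind; induction y using ind; induction z using ind
    simp only [mul_mk, add_mk, mk_eq]; ring
  right_distrib x y z := by
    induction x using ind; induction y using ind; induction z using ind
    simp only [mul_mk, add_mk, mk_eq]; ring
  mul_comm x y := by
    induction x using ind; induction y using ind
    simp only [mul_mk, mk_eq]; ring
  neg_add_cancel x := by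
    induction x using ind
    simp only [neg_mk, add_mk, zero_def, mk_eq]; ring
  nsmul := nsmulRec
  zsmul := zsmulRec

variable [CanonicallyOrderedAdd N]

/-- The inclusion of the nonnegative elements. -/
def of : N →+* Diff N where
  toFun a := mk a 0
  map_zero' := rfl
  map_one' := rfl
  map_add' a b := by simp [add_mk]
  map_mul' a b := by simp [mul_mk]

theorem of_inj {a b : N} : of a = of b ↔ a = b := by
  change mk a 0 = mk b 0 ↔ _
  simp [mk_eq]

theorem eq_of_or (x : Diff N) : (∃ a, x = of a) ∨ ∃ a, -x = of a := by
  induction x using ind with | h a b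
  rcases le_total a b with h | h <;> obtain ⟨c, rfl⟩ := exists_add_of_le h
  · exact .inr ⟨c, mk_eq.2 (by ring)⟩
  · exact .inl ⟨c, mk_eq.2 (by ring)⟩

theorem of_eq_zero_of_add {a b : N} (h : of a + of b = 0) : a = 0 ∧ b = 0 := by
  rw [← map_add, ← map_zero of, of_inj] at h
  simpa using h

/-- Up to sign every difference comes from `N`, so a zero product descends to `N`, where it forces a
zero factor. -/
instance : IsDomain (Diff N) := by
  have : NoZeroDivisors (Diff N) := ⟨by
    intro x y h
    rcases eq_of_or x with ⟨a, ha⟩ | ⟨a, ha⟩ <;> rcases eq_of_or y with ⟨b, hb⟩ | ⟨b, hb⟩ <;>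
    · have h' : of (a * b) = of 0 := by
        rw [map_mul, ← ha, ← hb]; simp [h]
      rw [of_inj, mul_eq_zero] at h'
      refine h'.imp (fun h₀ => ?_) fun h₀ => ?_ <;> simp_all⟩
  have : Nontrivial (Diff N) := ⟨0, 1, fun h => zero_ne_one (of_inj.1 (h : of 0 = of (1 : N)))⟩
  exact NoZeroDivisors.to_isDomain _

theorem algebraMap_of_ne_zero {b : N} (hb : b ≠ 0) :
    algebraMap (Diff N) (FractionRing (Diff N)) (of b) ≠ 0 := by
  rw [ne_eq, map_eq_zero_iff _ (IsFractionRing.injective _ _)]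
  exact fun h => hb (of_inj.1 (h.trans (map_zero of).symm))

end Diff

variable {N} [CanonicallyOrderedAdd N]

open Diff in
/-- The nonnegative fractions. -/
def fracCone : RingCone (FractionRing (Diff N)) where
  carrier := {x | ∃ a b : N, b ≠ 0 ∧
    x = algebraMap (Diff N) (FractionRing (Diff N)) (of a) / algebraMap _ _ (of b)}
  zero_mem' := ⟨0, 1, one_ne_zero, by simp⟩
  one_mem' := ⟨1, 1, one_ne_zero, by simp⟩
  add_mem' := by
    rintro _ _ ⟨a, b, hb, rfl⟩ ⟨c, d, hd, rfl⟩
    have hb' : algebraMap (Diff N) (FractionRing (Diff N)) (of b) ≠ 0 :=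
      algebraMap_of_ne_zero hb
    have hd' : algebraMap (Diff N) (FractionRing (Diff N)) (of d) ≠ 0 :=
      algebraMap_of_ne_zero hd
    refine ⟨a * d + b * c, b * d, mul_ne_zero hb hd, ?_⟩
    simp only [map_add, map_mul]
    field_simp
  mul_mem' := by
    rintro _ _ ⟨a, b, hb, rfl⟩ ⟨c, d, hd, rfl⟩
    refine ⟨a * c, b * d, mul_ne_zero hb hd, ?_⟩
    simp only [map_mul, div_mul_div_comm]
  eq_zero_of_mem_of_neg_mem' := by
    rintro _ ⟨a, b, hb, rfl⟩ ⟨c, d, hd, h⟩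
    have hb' : algebraMap (Diff N) (FractionRing (Diff N)) (of b) ≠ 0 :=
      algebraMap_of_ne_zero hb
    have hd' : algebraMap (Diff N) (FractionRing (Diff N)) (of d) ≠ 0 :=
      algebraMap_of_ne_zero hd
    have h₁ : algebraMap (Diff N) (FractionRing (Diff N)) (of (a * d) + of (b * c)) = 0 := by
      simp only [map_add, map_mul]
      field_simp at h
      linear_combination -h
    rw [map_eq_zero_iff _ (IsFractionRing.injective _ _)] at h₁
    have := (of_eq_zero_of_add h₁).1
    rw [mul_eq_zero, or_iff_left hd] at this
    simp [this]

open Diff in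
-- Differences give a domain, and nonnegative fractions give a positive cone of its fraction field;
-- a sign change puts each fraction or its negative into the cone. The last clause is what makes
-- reciprocals of numbers of `N` cofinal towards zero.
theorem exists_ordered_field (N : Type) [CommSemiring N] [LinearOrder N] [IsStrictOrderedRing N]
    [CanonicallyOrderedAdd N] :
    ∃ (K : Type) (_ : Field K) (_ : LinearOrder K) (_ : IsStrictOrderedRing K) (f : N →+* K),
      StrictMono f ∧ ∀ x : K, ∃ a b : N, b ≠ 0 ∧ |x| = f a / f b := by
  classical
  have : HasMemOrNegMem (fracCone (N := N)) := ⟨by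
    intro x
    obtain ⟨p, q, hq, rfl⟩ := IsFractionRing.div_surjective (A := Diff N) x
    have hq : q ≠ 0 := nonZeroDivisors.ne_zero hq
    have key : ∀ (p q : Diff N) (a b : N), q ≠ 0 → p = of a → q = of b →
        algebraMap (Diff N) (FractionRing (Diff N)) p / algebraMap _ _ q ∈ fracCone := by
      rintro p q a b hq rfl rfl
      exact ⟨a, b, fun h => hq (by simp [h]), rfl⟩
    rcases eq_of_or p with ⟨a, ha⟩ | ⟨a, ha⟩ <;> rcases eq_of_or q with ⟨b, hb⟩ | ⟨b, hb⟩
    · exact .inl (key p q a b hq ha hb)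
    · exact .inr (by simpa [div_neg] using key p (-q) a b (by simpa using hq) ha hb)
    · exact .inr (by simpa [neg_div] using key (-p) q a b hq ha hb)
    · exact .inl (by simpa using key (-p) (-q) a b (by simpa using hq) ha hb)⟩
  let _ : LinearOrder (FractionRing (Diff N)) := .mkOfAddGroupCone fracCone
  have : IsOrderedRing (FractionRing (Diff N)) := .mkOfCone fracCone
  have : IsStrictOrderedRing (FractionRing (Diff N)) := IsOrderedRing.toIsStrictOrderedRing _
  have hf : ∀ a : N, 0 ≤ algebraMap (Diff N) (FractionRing (Diff N)) (of a) := fun a =>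
    show _ ∈ fracCone from ⟨a, 1, one_ne_zero, by simp⟩
  have hinj : Function.Injective ((algebraMap (Diff N) (FractionRing (Diff N))).comp of) :=
    (IsFractionRing.injective _ _).comp fun a b => of_inj.1
  refine ⟨FractionRing (Diff N), inferInstance, inferInstance, inferInstance,
    (algebraMap _ _).comp of, ?_, ?_⟩
  · refine Monotone.strictMono_of_injective (fun a b h => ?_) hinj
    obtain ⟨c, rfl⟩ := exists_add_of_le h
    simpa using hf c
  · intro x
    have : |x| - 0 ∈ fracCone (N := N) := abs_nonneg x
    rw [sub_zero] at this
    exact this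

end Field

/-! ### Coded rational numbers and their values in an ordered field -/

namespace Interp

variable {M : Interp} [M.IsModel]

/-! ### The field of rational numbers of a model -/

variable (M) in
/-- The ordered field of fractions of the numbers of the model. -/
def K : Type := (exists_ordered_field (M.D .nat)).choose

noncomputable instance : Field M.K := (exists_ordered_field (M.D .nat)).choose_spec.choose
noncomputable instance : LinearOrder M.K :=
  (exists_ordered_field (M.D .nat)).choose_spec.choose_spec.choose
instance : IsStrictOrderedRing M.K :=
  (exists_ordered_field (M.D .nat)).choose_spec.choose_spec.choose_spec.choose

/-- The inclusion of the numbers. -/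
noncomputable def toK : M.D .nat →+* M.K :=
  (exists_ordered_field (M.D .nat)).choose_spec.choose_spec.choose_spec.choose_spec.choose

theorem toK_strictMono : StrictMono (toK (M := M)) :=
  (exists_ordered_field (M.D .nat)).choose_spec.choose_spec.choose_spec.choose_spec.choose_spec.1

theorem K_exists_frac (x : M.K) : ∃ a b : M.D .nat, b ≠ 0 ∧ |x| = toK a / toK b :=
  (exists_ordered_field (M.D .nat)).choose_spec.choose_spec.choose_spec.choose_spec.choose_spec.2 x

@[simp] theorem toK_le {a b : M.D .nat} : toK a ≤ toK b ↔ a ≤ b := toK_strictMono.le_iff_le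
@[simp] theorem toK_lt {a b : M.D .nat} : toK a < toK b ↔ a < b := toK_strictMono.lt_iff_lt
theorem toK_nonneg (a : M.D .nat) : 0 ≤ toK a := by
  rw [← map_zero toK, toK_le]
  exact zero_le
theorem toK_pos {a : M.D .nat} (h : a ≠ 0) : 0 < toK a := by
  rw [← map_zero toK, toK_lt]
  exact pos_iff_ne_zero.2 h

/-- Numerators and denominators of codes of rational numbers. -/
def posN (q : M.D .nat) : M.D .nat := monusN 1 (parityN (fstN q)) * halfN (fstN q)
def negN (q : M.D .nat) : M.D .nat := parityN (fstN q) * (halfN (fstN q) + 1)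

/-- The rational number with a given code. -/
noncomputable def val (q : M.D .nat) : M.K := (toK (posN q) - toK (negN q)) / (toK (sndN q) + 1)

@[simp] theorem eval_posQ (e : M.Env Γ) (q : Tm Γ .nat) :
    M.eval e (posQ q) = posN (M.eval e q) := by
  rw [posQ, eval_app, eval_closed, posQC, ap_eval_lam]
  simp [posN]

@[simp] theorem eval_negQ (e : M.Env Γ) (q : Tm Γ .nat) :
    M.eval e (negQ q) = negN (M.eval e q) := by
  rw [negQ, eval_app, eval_closed, negQC, ap_eval_lam]
  simp [negN]

@[simp] theorem eval_denQ (e : M.Env Γ) (q : Tm Γ .nat) :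
    M.eval e (denQ q) = sndN (M.eval e q) + 1 := by
  simp [denQ]

theorem posN_or_negN (q : M.D .nat) : posN q = 0 ∨ negN q = 0 := by
  rcases parityN_and_halfN (fstN q) with ⟨h, -⟩ | ⟨h, -⟩
  · exact .inr (by rw [negN, h, zero_mul])
  · exact .inl (by rw [posN, h, monusN_one_one, zero_mul])

theorem den_pos (q : M.D .nat) : 0 < toK (sndN q) + 1 :=
  add_pos_of_nonneg_of_pos (toK_nonneg _) one_pos

theorem posN_even (a d : M.D .nat) : posN (pairN (2 * a) d) = a := by
  rw [posN, fstN_pairN, parityN_two_mul, halfN_two_mul, monusN_zero, one_mul]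
theorem negN_even (a d : M.D .nat) : negN (pairN (2 * a) d) = 0 := by
  rw [negN, fstN_pairN, parityN_two_mul, zero_mul]
theorem posN_odd (a d : M.D .nat) : posN (pairN (2 * a + 1) d) = 0 := by
  rw [posN, fstN_pairN, parityN_two_mul_add_one, monusN_one_one, zero_mul]
theorem negN_odd (a d : M.D .nat) : negN (pairN (2 * a + 1) d) = a + 1 := by
  rw [negN, fstN_pairN, parityN_two_mul_add_one, halfN_two_mul_add_one, one_mul]

/-- The first component of the code is `2(p - n)` for `n ≤ p` and `2(n - p) - 1` otherwise, so its
parity records the sign. -/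
theorem val_mkQ (e : M.Env Γ) (p n d : Tm Γ .nat) (hd : M.eval e d ≠ 0) :
    val (M.eval e (mkQ p n d)) =
      (toK (M.eval e p) - toK (M.eval e n)) / toK (M.eval e d) := by
  rw [mkQ]
  simp only [eval_app, eval_closed]
  generalize M.eval e p = p at *
  generalize M.eval e n = n at *
  generalize M.eval e d = d at *
  rw [mkQC, ap_eval_lam, ap_eval_lam, ap_eval_lam]
  obtain ⟨d, rfl⟩ := (eq_zero_or_succ d).resolve_left hd
  simp only [eval_pair, eval_plus, eval_monus, eval_pred, eval_var, Env.cons_zero, Env.cons_succ,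
    predN_succ]
  rcases le_total n p with h | h
  · rw [monusN_eq_zero.2 h, add_zero, predN_zero, add_zero, ← two_mul, val, posN_even, negN_even,
      sndN_pairN]
    obtain ⟨c, rfl⟩ := h
    simp
  · obtain ⟨c, rfl⟩ := h
    rw [monusN_add_right, monusN_add_left]
    rcases eq_zero_or_succ c with rfl | ⟨c, rfl⟩
    · have : (0 : M.D .nat) + 0 + predN (0 + 0) = 2 * 0 := by simp
      rw [this, val, posN_even, negN_even]
      simp
    · have : (0 : M.D .nat) + 0 + predN (c + 1 + (c + 1)) = 2 * c + 1 := by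
        rw [← add_assoc, predN_succ]; ring
      rw [this, val, posN_odd, negN_odd, sndN_pairN]
      simp

@[simp] theorem val_addQ (e : M.Env Γ) (p q : Tm Γ .nat) :
    val (M.eval e (addQ p q)) = val (M.eval e p) + val (M.eval e q) := by
  rw [addQ]
  simp only [eval_app, eval_closed]
  rw [addQC, ap_eval_lam, ap_eval_lam, val_mkQ _ _ _ _ (by simp)]
  simp only [eval_plus, eval_times, eval_posQ, eval_negQ, eval_denQ, eval_var, Env.cons_zero,
    Env.cons_succ, map_add, map_mul, map_one, val]
  have h₁ := (den_pos (M.eval e p)).ne'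
  have h₂ := (den_pos (M.eval e q)).ne'
  field_simp
  ring

@[simp] theorem val_negateQ (e : M.Env Γ) (q : Tm Γ .nat) :
    val (M.eval e (negateQ q)) = -val (M.eval e q) := by
  rw [negateQ]
  simp only [eval_app, eval_closed]
  rw [negateQC, ap_eval_lam, val_mkQ _ _ _ _ (by simp)]
  simp only [eval_posQ, eval_negQ, eval_denQ, eval_var, Env.cons_zero, map_add, map_one, val]
  ring

@[simp] theorem val_subQ (e : M.Env Γ) (p q : Tm Γ .nat) :
    val (M.eval e (subQ p q)) = val (M.eval e p) - val (M.eval e q) := by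
  rw [subQ, val_addQ, val_negateQ, sub_eq_add_neg]

@[simp] theorem val_mulQ (e : M.Env Γ) (p q : Tm Γ .nat) :
    val (M.eval e (mulQ p q)) = val (M.eval e p) * val (M.eval e q) := by
  rw [mulQ]
  simp only [eval_app, eval_closed]
  rw [mulQC, ap_eval_lam, ap_eval_lam, val_mkQ _ _ _ _ (by simp)]
  simp only [eval_plus, eval_times, eval_posQ, eval_negQ, eval_denQ, eval_var, Env.cons_zero,
    Env.cons_succ, map_add, map_mul, map_one, val]
  have h₁ := (den_pos (M.eval e p)).ne'
  have h₂ := (den_pos (M.eval e q)).ne'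
  field_simp
  ring

theorem abs_val (q : M.D .nat) : |val q| = (toK (posN q) + toK (negN q)) / (toK (sndN q) + 1) := by
  rw [val, abs_div, abs_of_pos (den_pos q)]
  rcases posN_or_negN q with h | h <;> rw [h] <;> simp [abs_of_nonneg, toK_nonneg]

@[simp] theorem val_absQ (e : M.Env Γ) (q : Tm Γ .nat) :
    val (M.eval e (absQ q)) = |val (M.eval e q)| := by
  rw [absQ]
  simp only [eval_app, eval_closed]
  rw [absQC, ap_eval_lam, val_mkQ _ _ _ _ (by simp), abs_val]
  simp

/-- A positive value has vanishing negative part, so the conditional in the new numerator takes the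
denominator of `q`. Positivity suffices here, as only the reciprocal of one gets evaluated. -/
theorem val_invQ (e : M.Env Γ) (q : Tm Γ .nat) (h : 0 < val (M.eval e q)) :
    val (M.eval e (invQ q)) = (val (M.eval e q))⁻¹ := by
  rw [invQ]
  simp only [eval_app, eval_closed]
  generalize M.eval e q = q at *
  have hp : posN q ≠ 0 := by
    intro h₀
    rw [val, h₀, map_zero, zero_sub, neg_div] at h
    have := div_nonneg (toK_nonneg (negN q)) (den_pos q).le
    linarith
  have hn := (posN_or_negN q).resolve_left hp
  rw [invQC, ap_eval_lam, val_mkQ _ _ _ _ (by simp [hn, hp])]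
  simp [hn, condN_of_ne hp, val]

@[simp] theorem val_natQ (e : M.Env Γ) (n : Tm Γ .nat) :
    val (M.eval e (natQ n)) = toK (M.eval e n) := by
  rw [natQ, val_mkQ _ _ _ _ (by simp)]
  simp

theorem pow2N_ne (n : M.D .nat) : pow2N n ≠ 0 := by
  intro h
  have := succ_le_pow2N n
  rw [h, nonpos_iff_eq_zero] at this
  exact add_one_ne_zero n this

variable (M) in
/-- The rational number `2 ^ (-n)`. -/
noncomputable def eps (n : M.D .nat) : M.K := (toK (pow2N n))⁻¹

theorem eps_pos (n : M.D .nat) : 0 < M.eps n := inv_pos.2 (toK_pos (pow2N_ne n))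
theorem eps_zero : M.eps 0 = 1 := by simp [eps]
theorem eps_succ (n : M.D .nat) : M.eps (n + 1) = M.eps n / 2 := by
  rw [eps, eps, pow2N_succ, map_mul, mul_inv, map_ofNat]
  ring

@[simp] theorem val_twoPowNegQ (e : M.Env Γ) (n : Tm Γ .nat) :
    val (M.eval e (twoPowNegQ n)) = M.eps (M.eval e n) := by
  rw [twoPowNegQ, val_mkQ _ _ _ _ (by simp [pow2N_ne])]
  simp [eps]

theorem val_le_val {p q : M.D .nat} : val p ≤ val q ↔
    posN p * (sndN q + 1) + negN q * (sndN p + 1) ≤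
      posN q * (sndN p + 1) + negN p * (sndN q + 1) := by
  rw [val, val, div_le_div_iff₀ (den_pos p) (den_pos q), ← toK_le]
  simp only [map_add, map_mul, map_one]
  constructor <;> intro h <;> linarith

@[simp] theorem sat_leQ (e : M.Env Γ) (p q : Tm Γ .nat) :
    M.sat e (leQ p q) ↔ val (M.eval e p) ≤ val (M.eval e q) := by
  simp only [leQ, sat, leQChar, eval_app, eval_closed]
  rw [leQC, ap_eval_lam, ap_eval_lam, val_le_val]
  simp

@[simp] theorem sat_ltQ (e : M.Env Γ) (p q : Tm Γ .nat) :
    M.sat e (ltQ p q) ↔ val (M.eval e p) < val (M.eval e q) := by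
  simp only [ltQ, sat, ltQChar, eval_app, eval_closed]
  rw [ltQC, ap_eval_lam, ap_eval_lam, ← not_le, val_le_val, not_le]
  simp [lt_iff_add_one_le]

/-- Write `x = a / b` with numbers `a ≥ 1` and `b` of the model; since `2^b > b`, the exponent `b`
works. No archimedean property of `K` is needed. -/
theorem exists_eps_lt {x : M.K} (hx : 0 < x) : ∃ n, M.eps n < x := by
  obtain ⟨a, b, hb, h⟩ := K_exists_frac x
  rw [abs_of_pos hx] at h
  have hb' := toK_pos hb
  have ha : a ≠ 0 := by
    rintro rfl
    simp [h] at hx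
  refine ⟨b, ?_⟩
  have h₁ : toK b < toK (pow2N b) := toK_lt.2 (lt_iff_add_one_le.2 (succ_le_pow2N b))
  calc M.eps b < (toK b)⁻¹ := by rw [eps]; exact inv_strictAnti₀ hb' h₁
    _ ≤ x := by
      rw [h, inv_eq_one_div]
      refine div_le_div_of_nonneg_right ?_ hb'.le
      rw [← map_one toK, toK_le]
      obtain ⟨c, rfl⟩ := (eq_zero_or_succ a).resolve_left ha
      exact le_add_self

/-! ### The rational approximations of a type `1` object -/

def defectN (f : M.D .one) (n : M.D .nat) : M.D .nat := M.ap (M.ap (M.eval .nil defectC) f) n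
def hatN (f : M.D .one) (n : M.D .nat) : M.D .nat := M.ap (M.ap (M.eval .nil hatC) f) n

@[simp] theorem eval_defect (e : M.Env Γ) (f : Tm Γ .one) (n : Tm Γ .nat) :
    M.eval e (defect f n) = defectN (M.eval e f) (M.eval e n) := by
  simp only [defect, eval_app, eval_closed, defectN]
@[simp] theorem eval_hat (e : M.Env Γ) (f : Tm Γ .one) (n : Tm Γ .nat) :
    M.eval e (hat f n) = hatN (M.eval e f) (M.eval e n) := by
  simp only [hat, eval_app, eval_closed, hatN]

end Interp

open Filter


/-! ### Limits along an ultrafilter in a non-archimedean ordered field -/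

section Limits

variable {N K : Type} [Field K] [LinearOrder K] [IsStrictOrderedRing K]

variable (N K) in
/-- The bounded sequences. -/
def bddSeq : Subring (N → K) where
  carrier := {x | ∃ k, ∀ n, |x n| ≤ k}
  zero_mem' := ⟨0, by simp⟩
  one_mem' := ⟨1, by simp⟩
  add_mem' := by
    rintro x y ⟨a, ha⟩ ⟨b, hb⟩
    exact ⟨a + b, fun n => (abs_add_le _ _).trans (add_le_add (ha n) (hb n))⟩
  mul_mem' := by
    rintro x y ⟨a, ha⟩ ⟨b, hb⟩
    refine ⟨a * b, fun n => ?_⟩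
    rw [Pi.mul_apply, abs_mul]
    exact mul_le_mul (ha n) (hb n) (abs_nonneg _) ((abs_nonneg _).trans (ha n))
  neg_mem' := by
    rintro x ⟨a, ha⟩
    exact ⟨a, fun n => by simpa using ha n⟩

variable (U : Ultrafilter N)

/-- The sequences tending to zero along the ultrafilter. -/
def nullSeq : Ideal (bddSeq N K) where
  carrier := {x | ∀ ε > 0, ∀ᶠ n in (U : Filter N), |x.1 n| < ε}
  zero_mem' := by
    intro ε hε
    simpa using hε
  add_mem' := by
    intro x y hx hy ε hε
    filter_upwards [hx _ (half_pos hε), hy _ (half_pos hε)] with n h₁ h₂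
    calc |x.1 n + y.1 n| ≤ |x.1 n| + |y.1 n| := abs_add_le _ _
      _ < ε := by linarith
  smul_mem' := by
    rintro ⟨c, k, hk⟩ x hx ε hε
    obtain hk' : 0 ≤ k := (abs_nonneg _).trans (hk (U.nonempty_of_mem Filter.univ_mem).some)
    filter_upwards [hx (ε / (k + 1)) (by positivity)] with n h₁
    change |c n * x.1 n| < ε
    rw [abs_mul]
    calc |c n| * |x.1 n| ≤ (k + 1) * |x.1 n| :=
          mul_le_mul_of_nonneg_right ((hk n).trans (by linarith)) (abs_nonneg _)
      _ < ε := by rwa [lt_div_iff₀' (by positivity)] at h₁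

/-- The ring of limits. -/
abbrev Lim : Type := bddSeq N K ⧸ nullSeq (K := K) U

variable {U}

theorem mem_nullSeq {x : bddSeq N K} :
    x ∈ nullSeq U ↔ ∀ ε > 0, ∀ᶠ n in (U : Filter N), |x.1 n| < ε := Iff.rfl

/-- The class of a bounded sequence. -/
def Lim.mk (x : bddSeq N K) : Lim (K := K) U := Ideal.Quotient.mk _ x

theorem Lim.mk_eq {x y : bddSeq N K} : (Lim.mk x : Lim (K := K) U) = Lim.mk y ↔
    ∀ ε > 0, ∀ᶠ n in (U : Filter N), |x.1 n - y.1 n| < ε :=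
  Ideal.Quotient.eq.trans mem_nullSeq

theorem Lim.mk_surjective (r : Lim (K := K) U) : ∃ x : bddSeq N K, Lim.mk x = r :=
  Ideal.Quotient.mk_surjective r

theorem Lim.mk_neg (x : bddSeq N K) : (Lim.mk (-x) : Lim (K := K) U) = -Lim.mk x := rfl

/-- Here the ultrafilter is essential: a condition that does not hold on a large set fails on a
large set. -/
theorem eventually_le_of_notMem_nullSeq {x : bddSeq N K} (h : x ∉ nullSeq U) :
    ∃ ε > 0, ∀ᶠ n in (U : Filter N), ε ≤ |x.1 n| := by
  rw [mem_nullSeq] at h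
  push Not at h
  obtain ⟨ε, hε, h⟩ := h
  exact ⟨ε, hε, h⟩

/-- Two sequences that are not null are bounded away from zero on large sets, hence so is their
product on the intersection. -/
instance : (nullSeq (K := K) U).IsPrime where
  ne_top' := by
    rw [Ideal.ne_top_iff_one, mem_nullSeq]
    intro h
    obtain ⟨n, hn⟩ := (h 1 one_pos).exists
    simp at hn
  mem_or_mem' := by
    intro x y h
    by_contra! hn
    obtain ⟨ε, hε, h₁⟩ := eventually_le_of_notMem_nullSeq hn.1
    obtain ⟨δ, hδ, h₂⟩ := eventually_le_of_notMem_nullSeq hn.2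
    obtain ⟨n, h₃, h₄, h₅⟩ := ((h (ε * δ) (by positivity)).and (h₁.and h₂)).exists
    change |x.1 n * y.1 n| < ε * δ at h₃
    rw [abs_mul] at h₃
    exact absurd h₃ (not_lt.2 (mul_le_mul h₄ h₅ hδ.le (hε.le.trans h₄)))

variable (U) in
/-- The limits of nonnegative sequences. -/
def limCone : RingCone (Lim (K := K) U) where
  carrier := {r | ∃ x : bddSeq N K, (∀ n, 0 ≤ x.1 n) ∧ Lim.mk x = r}
  zero_mem' := ⟨0, fun _ => le_rfl, rfl⟩
  one_mem' := ⟨1, fun _ => zero_le_one, rfl⟩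
  add_mem' := by
    rintro _ _ ⟨x, hx, rfl⟩ ⟨y, hy, rfl⟩
    exact ⟨x + y, fun n => add_nonneg (hx n) (hy n), rfl⟩
  mul_mem' := by
    rintro _ _ ⟨x, hx, rfl⟩ ⟨y, hy, rfl⟩
    exact ⟨x * y, fun n => mul_nonneg (hx n) (hy n), rfl⟩
  eq_zero_of_mem_of_neg_mem' := by
    rintro _ ⟨x, hx, rfl⟩ ⟨y, hy, h⟩
    rw [← Lim.mk_neg, Lim.mk_eq] at h
    refine Lim.mk_eq.2 fun ε hε => ?_
    filter_upwards [h ε hε] with n hn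
    have hx := hx n
    have hy := hy n
    change |y.1 n - -x.1 n| < ε at hn
    change |x.1 n - 0| < ε
    rw [sub_zero, abs_of_nonneg hx]
    rw [sub_neg_eq_add, abs_of_nonneg (by positivity)] at hn
    linarith

/-- The positive part of a bounded sequence. -/
def posSeq (x : bddSeq N K) : bddSeq N K :=
  ⟨fun n => max (x.1 n) 0, x.2.imp fun _ hk n =>
    (abs_max_le_max_abs_abs).trans (max_le (hk n) (by simpa using (abs_nonneg _).trans (hk n)))⟩

theorem mk_posSeq_of_eventually {x : bddSeq N K}
    (h : ∀ ε > 0, ∀ᶠ n in (U : Filter N), -ε < x.1 n) :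
    (Lim.mk (posSeq x) : Lim (K := K) U) = Lim.mk x := by
  refine Lim.mk_eq.2 fun ε hε => ?_
  filter_upwards [h ε hε] with n hn
  change |max (x.1 n) 0 - x.1 n| < ε
  rcases le_total (x.1 n) 0 with h₀ | h₀
  · rw [max_eq_right h₀, zero_sub, abs_neg, abs_of_nonpos h₀]
    linarith
  · rw [max_eq_left h₀, sub_self, abs_zero]
    exact hε

/-- A sequence that is nonnegative up to every `ε` differs from its positive part by a null
sequence. -/
theorem mk_mem_limCone {x : bddSeq N K} : Lim.mk x ∈ limCone (K := K) U ↔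
    ∀ ε > 0, ∀ᶠ n in (U : Filter N), -ε < x.1 n := by
  constructor
  · rintro ⟨y, hy, h⟩ ε hε
    rw [Lim.mk_eq] at h
    filter_upwards [h ε hε] with n hn
    have := (abs_lt.1 hn).2
    linarith [hy n]
  · intro h
    exact ⟨posSeq x, fun n => le_max_right _ _, mk_posSeq_of_eventually h⟩

instance : HasMemOrNegMem (limCone (K := K) U) := ⟨by
  intro r
  obtain ⟨x, rfl⟩ := Lim.mk_surjective r
  rw [← Lim.mk_neg, mk_mem_limCone, mk_mem_limCone]
  rcases U.em fun n => 0 ≤ x.1 n with h | h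
  · refine .inl fun ε hε => ?_
    filter_upwards [h] with n hn
    linarith
  · refine .inr fun ε hε => ?_
    filter_upwards [h] with n hn
    change -ε < -x.1 n
    linarith⟩

open Classical in
noncomputable instance : LinearOrder (Lim (K := K) U) := .mkOfAddGroupCone (limCone (K := K) U)
instance : IsOrderedRing (Lim (K := K) U) := .mkOfCone (limCone (K := K) U)
instance : IsStrictOrderedRing (Lim (K := K) U) := IsOrderedRing.toIsStrictOrderedRing _

theorem Lim.mk_le {x y : bddSeq N K} : (Lim.mk x : Lim (K := K) U) ≤ Lim.mk y ↔
    ∀ ε > 0, ∀ᶠ n in (U : Filter N), x.1 n < y.1 n + ε := by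
  change Lim.mk (y - x) ∈ limCone (K := K) U ↔ _
  rw [mk_mem_limCone]
  refine forall₂_congr fun ε _ => eventually_congr (.of_forall fun n => ?_)
  change -ε < y.1 n - x.1 n ↔ _
  constructor <;> intro h <;> linarith

/-- Constant sequences. -/
def constSeq : K →+* bddSeq N K where
  toFun k := ⟨fun _ => k, |k|, fun _ => le_rfl⟩
  map_zero' := rfl
  map_one' := rfl
  map_add' _ _ := rfl
  map_mul' _ _ := rfl

variable (U) in
/-- The inclusion of the field. -/
def toLim : K →+* Lim (K := K) U := (Ideal.Quotient.mk _).comp constSeq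

theorem toLim_def (k : K) : toLim U k = Lim.mk (constSeq k) := rfl

theorem toLim_le {a b : K} : toLim U a ≤ toLim U b ↔ a ≤ b := by
  rw [toLim_def, toLim_def, Lim.mk_le]
  constructor
  · intro h
    refine le_of_forall_pos_lt_add fun ε hε => ?_
    obtain ⟨_, hn⟩ := (h ε hε).exists
    exact hn
  · intro h ε hε
    exact .of_forall fun n => lt_add_of_le_of_pos h hε

theorem toLim_lt {a b : K} : toLim U a < toLim U b ↔ a < b := by
  rw [← not_le, toLim_le, not_le]

theorem exists_lt_toLim (r : Lim (K := K) U) : ∃ k : K, r ≤ toLim U k := by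
  obtain ⟨⟨x, k, hk⟩, rfl⟩ := Lim.mk_surjective r
  refine ⟨k, Lim.mk_le.2 fun ε hε => .of_forall fun n => ?_⟩
  exact lt_add_of_le_of_pos ((le_abs_self _).trans (hk n)) hε

/-- The ring has no positive element below all of `K`, because null sequences are tested against
every positive `ε` of `K`. So order statements about limits can be decided by rational
approximation. -/
theorem exists_toLim_le {r : Lim (K := K) U} (hr : 0 < r) : ∃ k : K, 0 < k ∧ toLim U k ≤ r := by
  obtain ⟨x, rfl⟩ := Lim.mk_surjective r
  by_contra! h
  refine hr.not_ge ?_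
  refine (Lim.mk_le (y := 0)).2 fun ε hε => ?_
  have := (h (ε / 2) (half_pos hε)).le
  rw [toLim_def, Lim.mk_le] at this
  filter_upwards [this (ε / 2) (half_pos hε)] with n hn
  change x.1 n < 0 + ε
  change x.1 n < ε / 2 + ε / 2 at hn
  linarith

end Limits

/-! ### Real numbers of a model as limits along an ultrafilter -/

namespace Interp

variable {M : Interp} [M.IsModel]

/-! ### Convergence of the rational approximations -/

theorem defectN_eq (f : M.D .one) (n : M.D .nat) :
    defectN f n = M.rec₀ 0 (M.eval (.cons f .nil) (Tm.lam (Tm.lam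
      (plus v1 (ltQChar (absQ (subQ (.app v2 v0) (.app v2 (.suc v0))))
        (twoPowNegQ (.suc v0))))))) n := by
  rw [defectN, defectC, ap_eval_lam, ap_eval_lam, eval_recN]
  have := eval_lam_lam (ρ := .nat) (σ := .nat) (.cons f (.nil (M := M))) n
    (plus v1 (ltQChar (absQ (subQ (.app v2 v0) (.app v2 (.suc v0)))) (twoPowNegQ (.suc v0))))
  simp only [plus, ltQChar, absQ, subQ, addQ, negateQ, twoPowNegQ, mkQ, pow2, Tm.rename, Ren.lift,
    Tm.closed_rename] at this
  exact congrArg (M.rec₀ _ · n) this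

theorem defectN_zero (f : M.D .one) : defectN f 0 = 0 := by rw [defectN_eq, rec₀_zero]

theorem defectN_succ (f : M.D .one) (n : M.D .nat) : defectN f (n + 1) = 0 ↔
    defectN f n = 0 ∧ |val (M.ap f n) - val (M.ap f (n + 1))| < M.eps (n + 1) := by
  rw [defectN_eq f (n + 1), rec₀_succ, ← defectN_eq, ap_eval_lam, ap_eval_lam, eval_plus,
    add_eq_zero]
  have := sat_ltQ (.cons n (.cons (defectN f n) (.cons f (.nil (M := M)))))
    (absQ (subQ (.app v2 v0) (.app v2 (.suc v0)))) (twoPowNegQ (.suc v0))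
  simp only [ltQ, sat, val_absQ, val_subQ, val_twoPowNegQ, eval_app, eval_cst, ap_succ, eval_var,
    Env.cons_zero, Env.cons_succ, cst_zero] at this
  rw [this]
  rfl

theorem hatN_eq (f : M.D .one) (n : M.D .nat) :
    hatN f n = M.rec₀ (M.ap f 0) (M.eval (.cons f .nil) (Tm.lam (Tm.lam
      (cond (defect v2 (.suc v0)) (.app v2 (.suc v0)) v1)))) n := by
  rw [hatN, hatC, ap_eval_lam, ap_eval_lam, eval_recN]
  have := eval_lam_lam (ρ := .nat) (σ := .nat) (.cons f (.nil (M := M))) n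
    (cond (defect v2 (.suc v0)) (.app v2 (.suc v0)) v1)
  simp only [cond, defect, Tm.rename, Ren.lift, Tm.closed_rename] at this
  exact congrArg (M.rec₀ _ · n) this

theorem hatN_zero (f : M.D .one) : hatN f 0 = M.ap f 0 := by rw [hatN_eq, rec₀_zero]

theorem hatN_succ (f : M.D .one) (n : M.D .nat) : hatN f (n + 1) =
    condN (defectN f (n + 1)) (M.ap f (n + 1)) (hatN f n) := by
  rw [hatN_eq f (n + 1), rec₀_succ, ← hatN_eq, ap_eval_lam, ap_eval_lam]
  simp

theorem hatN_of_defectN {f : M.D .one} {n : M.D .nat} (h : defectN f n = 0) :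
    hatN f n = M.ap f n := by
  rcases eq_zero_or_succ n with rfl | ⟨m, rfl⟩
  · exact hatN_zero f
  · rw [hatN_succ, h, condN_zero]

/-- No hypothesis on `f` is needed: before the first violation of the Cauchy condition `f` itself
satisfies the bound, and from then on the sequence is constant. -/
theorem abs_hatN_sub_succ (f : M.D .one) (n : M.D .nat) :
    |val (hatN f n) - val (hatN f (n + 1))| < M.eps (n + 1) := by
  by_cases h : defectN f (n + 1) = 0
  · obtain ⟨h₁, h₂⟩ := (defectN_succ f n).1 h
    rwa [hatN_of_defectN h, hatN_of_defectN h₁]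
  · rw [hatN_succ, condN_of_ne h, sub_self, abs_zero]
    exact eps_pos _

/-- Telescoping of the geometric series. As `k` may be nonstandard, the induction is carried out on
a formula of the language. -/
theorem abs_hatN_sub_add (f : M.D .one) (n k : M.D .nat) :
    |val (hatN f n) - val (hatN f (n + k))| ≤ M.eps n - M.eps (n + k) := by
  have := induction (M := M) (leQ (absQ (subQ (hat v2 v1) (hat v2 (plus v1 v0))))
      (subQ (twoPowNegQ v1) (twoPowNegQ (plus v1 v0)))) (.cons n (.cons f .nil))
    (by simp) (by
      intro k h
      simp only [sat_leQ, val_twoPowNegQ, eval_plus, eval_var, Env.cons_zero, Env.cons_succ,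
        val_absQ, val_subQ, eval_hat, ← add_assoc] at h ⊢
      have h₁ := abs_hatN_sub_succ f (n + k)
      have h₂ := abs_sub_le (val (hatN f n)) (val (hatN f (n + k))) (val (hatN f (n + k + 1)))
      have h₃ := eps_succ (n + k)
      linarith) k
  simpa using this

/-- A sequence of rationals that converges fast is its own approximation. -/
theorem hatN_eq_self {f : M.D .one}
    (h : ∀ n, |val (M.ap f n) - val (M.ap f (n + 1))| < M.eps (n + 1)) (n : M.D .nat) :
    hatN f n = M.ap f n := by
  refine hatN_of_defectN ?_
  have := induction (M := M) (.eq (defect v1 v0) .zero) (.cons f .nil)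
    (by simp [sat, defectN_zero]) (by
      intro n hn
      simp only [sat, eval_defect, eval_var, eval_cst, cst_zero, Env.cons_zero,
        Env.cons_succ] at hn ⊢
      exact (defectN_succ f n).2 ⟨hn, h n⟩) n
  simpa [sat] using this

/-! ### The real numbers of a model -/

variable (M) in
/-- An ultrafilter converging to infinity. -/
noncomputable def ultra : Ultrafilter (M.D .nat) := .of atTop

theorem eventually_ge (n : M.D .nat) : ∀ᶠ m in (M.ultra : Filter (M.D .nat)), n ≤ m :=
  Ultrafilter.of_le _ (eventually_ge_atTop n)

variable (M) in
/-- The ordered ring of real numbers. -/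
def R : Type := Lim (K := M.K) M.ultra

noncomputable instance : CommRing M.R := inferInstanceAs (CommRing (Lim (K := M.K) M.ultra))
noncomputable instance : LinearOrder M.R := inferInstanceAs (LinearOrder (Lim (K := M.K) M.ultra))
instance : IsStrictOrderedRing M.R :=
  inferInstanceAs (IsStrictOrderedRing (Lim (K := M.K) M.ultra))

variable (M) in
/-- The inclusion of the rational numbers. -/
noncomputable def toR : M.K →+* M.R := toLim M.ultra

theorem toR_le {a b : M.K} : M.toR a ≤ M.toR b ↔ a ≤ b := toLim_le
theorem toR_lt {a b : M.K} : M.toR a < M.toR b ↔ a < b := toLim_lt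

theorem abs_toR (k : M.K) : |M.toR k| = M.toR |k| := by
  rcases le_total 0 k with h | h
  · rw [abs_of_nonneg h, abs_of_nonneg]
    rwa [← map_zero M.toR, toR_le]
  · rw [abs_of_nonpos h, abs_of_nonpos, map_neg]
    rwa [← map_zero M.toR, toR_le]

/-- The sequence of approximations. -/
noncomputable def hatSeq (f : M.D .one) : bddSeq (M.D .nat) M.K :=
  ⟨fun n => val (hatN f n), |val (hatN f 0)| + 1, fun n => by
    have h₁ := abs_hatN_sub_add f 0 n
    rw [zero_add, eps_zero] at h₁
    have h₂ := abs_sub_abs_le_abs_sub (val (hatN f n)) (val (hatN f 0))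
    rw [abs_sub_comm] at h₂
    linarith [eps_pos n]⟩

/-- The real number represented by a type `1` object. -/
noncomputable def lim (f : M.D .one) : M.R := Lim.mk (hatSeq f)

theorem abs_lim_sub_lt (f : M.D .one) (n : M.D .nat) :
    |lim f - M.toR (val (hatN f n))| < M.toR (M.eps n) := by
  have h₁ := abs_hatN_sub_succ f n
  have key : ∀ m, n + 1 ≤ m → |val (hatN f n) - val (hatN f m)| ≤
      |val (hatN f n) - val (hatN f (n + 1))| + M.eps (n + 1) := by
    rintro _ ⟨k, rfl⟩
    have h₂ := abs_hatN_sub_add f (n + 1) k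
    have h₃ := abs_sub_le (val (hatN f n)) (val (hatN f (n + 1))) (val (hatN f (n + 1 + k)))
    linarith [eps_pos (n + 1 + k)]
  have h₄ := eps_succ n
  -- Passing to the limit preserves only weak inequalities. Strictness is saved by bounding through
  -- index `n + 1`, where the first increment is already strictly below `2^(-n-1)`.
  refine lt_of_le_of_lt ?_ (toR_lt.2
    (show |val (hatN f n) - val (hatN f (n + 1))| + M.eps (n + 1) < M.eps n by linarith))
  rw [abs_le, neg_le_sub_iff_le_add, sub_le_iff_le_add', ← map_add]
  constructor
  · refine (Lim.mk_le (x := constSeq _) (y := hatSeq f + constSeq _)).2 fun ε hε => ?_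
    filter_upwards [eventually_ge (n + 1)] with m hm
    change val (hatN f n) < (val (hatN f m) +
      (|val (hatN f n) - val (hatN f (n + 1))| + M.eps (n + 1))) + ε
    linarith [(abs_le.1 (key m hm)).2]
  · refine (Lim.mk_le (x := hatSeq f) (y := constSeq _)).2 fun ε hε => ?_
    filter_upwards [eventually_ge (n + 1)] with m hm
    change val (hatN f m) < (val (hatN f n) +
      (|val (hatN f n) - val (hatN f (n + 1))| + M.eps (n + 1))) + ε
    linarith [(abs_le.1 (key m hm)).1]

theorem toR_eps_pos (n : M.D .nat) : 0 < M.toR (M.eps n) := by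
  rw [← map_zero M.toR, toR_lt]
  exact eps_pos n

theorem toR_eps_succ (n : M.D .nat) : M.toR (M.eps n) = 2 * M.toR (M.eps (n + 1)) := by
  rw [eps_succ, ← map_ofNat M.toR 2, ← map_mul]
  congr 1
  ring

theorem exists_mul_eps_lt (a : M.R) {r : M.R} (hr : 0 < r) : ∃ n, a * M.toR (M.eps n) < r := by
  obtain ⟨k, hk, h₁⟩ := exists_toLim_le hr
  obtain ⟨b, h₂⟩ := exists_lt_toLim a
  -- The bound `b` of `a` need not be positive, hence the denominator `|b| + 1`.
  obtain ⟨n, hn⟩ := exists_eps_lt (M := M) (x := k / (|b| + 1)) (by positivity)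
  refine ⟨n, lt_of_lt_of_le ?_ h₁⟩
  calc a * M.toR (M.eps n) ≤ M.toR b * M.toR (M.eps n) :=
        mul_le_mul_of_nonneg_right h₂ (toR_eps_pos n).le
    _ = M.toR (b * M.eps n) := (map_mul _ _ _).symm
    _ < M.toR k := by
      rw [toR_lt]
      rw [lt_div_iff₀ (by positivity)] at hn
      nlinarith [le_abs_self b, eps_pos n]

/-- The powers `2^(-n)`, with `n` ranging over the numbers of the model, are cofinal towards zero in
`R`. This replaces the archimedean property in all limit arguments below. -/
theorem le_of_forall_eps {a b c : M.R} (h : ∀ n, a ≤ b + c * M.toR (M.eps n)) : a ≤ b := by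
  by_contra! hlt
  obtain ⟨n, hn⟩ := exists_mul_eps_lt c (sub_pos.2 hlt)
  linarith [h n]

theorem eq_of_forall_eps {a b c : M.R} (h : ∀ n, |a - b| ≤ c * M.toR (M.eps n)) : a = b := by
  refine le_antisymm (le_of_forall_eps (c := c) fun n => ?_) (le_of_forall_eps (c := c) fun n => ?_)
  · linarith [(abs_le.1 (h n)).2]
  · linarith [(abs_le.1 (h n)).1]

@[simp] theorem sat_eqR (e : M.Env Γ) (f g : Tm Γ .one) :
    M.sat e (eqR f g) ↔ lim (M.eval e f) = lim (M.eval e g) := by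
  simp only [eqR, sat, sat_ltQ, val_absQ, val_subQ, val_twoPowNegQ, eval_hat, eval_wk, eval_app,
    eval_cst, ap_succ, eval_var, Env.cons_zero]
  generalize M.eval e f = f
  generalize M.eval e g = g
  constructor
  · intro h
    refine eq_of_forall_eps (c := 2) fun n => ?_
    have h₁ := abs_lt.1 (abs_lim_sub_lt f (n + 1))
    have h₂ := abs_lt.1 (abs_lim_sub_lt g (n + 1))
    have h₃ := toR_lt.2 (h n)
    rw [← abs_toR, map_sub, abs_lt] at h₃
    have h₄ := toR_eps_succ n
    rw [abs_le]
    constructor <;> linarith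
  -- The two strict errors below `2^(-n-1)` add up to strictly less than `2^(-n)`, as the formula
  -- demands.
  · intro h n
    have h₁ := abs_lt.1 (abs_lim_sub_lt f (n + 1))
    have h₂ := abs_lt.1 (abs_lim_sub_lt g (n + 1))
    have h₄ := toR_eps_succ n
    rw [← toR_lt, ← abs_toR, map_sub, abs_lt]
    constructor <;> linarith

@[simp] theorem sat_ltR (e : M.Env Γ) (f g : Tm Γ .one) :
    M.sat e (ltR f g) ↔ lim (M.eval e f) < lim (M.eval e g) := by
  simp only [ltR, sat, sat_leQ, val_subQ, val_twoPowNegQ, eval_hat, eval_wk, eval_app,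
    eval_cst, ap_succ, eval_var, Env.cons_zero]
  generalize M.eval e f = f
  generalize M.eval e g = g
  constructor
  · rintro ⟨n, h⟩
    have h₁ := abs_lt.1 (abs_lim_sub_lt f (n + 1))
    have h₂ := abs_lt.1 (abs_lim_sub_lt g (n + 1))
    rw [← toR_le, map_sub] at h
    linarith [toR_eps_succ n]
  · intro h
    -- A gap of `2 · 2^(-n)` leaves `2^(-n)` after the two approximation errors at index `n + 1`.
    obtain ⟨n, hn⟩ := exists_mul_eps_lt 2 (sub_pos.2 h)
    refine ⟨n, ?_⟩
    have h₁ := abs_lt.1 (abs_lim_sub_lt f (n + 1))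
    have h₂ := abs_lt.1 (abs_lim_sub_lt g (n + 1))
    rw [← toR_le, map_sub]
    linarith [toR_eps_succ n]

@[simp] theorem sat_leR (e : M.Env Γ) (f g : Tm Γ .one) :
    M.sat e (leR f g) ↔ lim (M.eval e f) ≤ lim (M.eval e g) := by
  rw [leR, sat_neg, sat_ltR, not_lt]

/-- A fast converging sequence of rationals represents its limit. -/
theorem lim_eq {f : M.D .one} {r : M.R}
    (h : ∀ n, |val (M.ap f n) - val (M.ap f (n + 1))| < M.eps (n + 1))
    (hr : ∀ n, |r - M.toR (val (M.ap f n))| ≤ M.toR (M.eps n)) : lim f = r := by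
  refine eq_of_forall_eps (c := 2) fun n => ?_
  have h₁ := abs_lt.1 (abs_lim_sub_lt f n)
  have h₂ := abs_le.1 (hr n)
  rw [hatN_eq_self h] at h₁
  rw [abs_le]
  constructor <;> linarith

@[simp] theorem lim_constR (e : M.Env Γ) (q : Tm Γ .nat) :
    lim (M.eval e (constR q)) = M.toR (val (M.eval e q)) := by
  refine lim_eq (fun n => ?_) (fun n => ?_)
  · simpa [constR] using eps_pos _
  · simpa [constR] using (toR_eps_pos n).le

@[simp] theorem lim_zeroR (e : M.Env Γ) : lim (M.eval e zeroR) = 0 := by simp [zeroR]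
@[simp] theorem lim_oneR (e : M.Env Γ) : lim (M.eval e oneR) = 1 := by simp [oneR]
@[simp] theorem lim_twoR (e : M.Env Γ) : lim (M.eval e twoR) = 2 := by
  rw [twoR, lim_constR, val_natQ]
  simp only [eval_app, eval_cst, ap_succ, cst_zero, zero_add, one_add_one_eq_two]
  exact (congrArg M.toR (map_ofNat toK 2)).trans (map_ofNat M.toR 2)
@[simp] theorem lim_twoPowNegR (e : M.Env Γ) (n : Tm Γ .nat) :
    lim (M.eval e (twoPowNegR n)) = M.toR (M.eps (M.eval e n)) := by simp [twoPowNegR]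

@[simp] theorem lim_addR (e : M.Env Γ) (f g : Tm Γ .one) :
    lim (M.eval e (addR f g)) = lim (M.eval e f) + lim (M.eval e g) := by
  simp only [addR, eval_app, eval_closed]
  generalize M.eval e f = f
  generalize M.eval e g = g
  refine lim_eq (fun n => ?_) (fun n => ?_) <;>
  · rw [addRC]
    simp only [ap_eval_lam, val_addQ, eval_hat, eval_app, eval_cst, ap_succ, eval_var,
      Env.cons_zero, Env.cons_succ]
    first
    | have h₁ := abs_lt.1 (abs_hatN_sub_succ f (n + 1))
      have h₂ := abs_lt.1 (abs_hatN_sub_succ g (n + 1))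
      have h₃ := eps_succ (n + 1)
      rw [abs_lt]
      constructor <;> linarith
    | have h₁ := abs_lt.1 (abs_lim_sub_lt f (n + 1))
      have h₂ := abs_lt.1 (abs_lim_sub_lt g (n + 1))
      have h₃ := toR_eps_succ n
      rw [map_add, abs_le]
      constructor <;> linarith

@[simp] theorem lim_negR (e : M.Env Γ) (f : Tm Γ .one) :
    lim (M.eval e (negR f)) = -lim (M.eval e f) := by
  simp only [negR, eval_app, eval_closed]
  generalize M.eval e f = f
  refine lim_eq (fun n => ?_) (fun n => ?_) <;> rw [negRC] <;>
    simp only [ap_eval_lam, val_negateQ, eval_hat, eval_var, Env.cons_zero, Env.cons_succ]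
  · rw [neg_sub_neg, abs_sub_comm]
    exact abs_hatN_sub_succ f n
  · rw [map_neg, neg_sub_neg, abs_sub_comm]
    exact (abs_lim_sub_lt f n).le

@[simp] theorem lim_subR (e : M.Env Γ) (f g : Tm Γ .one) :
    lim (M.eval e (subR f g)) = lim (M.eval e f) - lim (M.eval e g) := by
  rw [subR, lim_addR, lim_negR, sub_eq_add_neg]

@[simp] theorem lim_absR (e : M.Env Γ) (f : Tm Γ .one) :
    lim (M.eval e (absR f)) = |lim (M.eval e f)| := by
  simp only [absR, eval_app, eval_closed]
  generalize M.eval e f = f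
  refine lim_eq (fun n => ?_) (fun n => ?_) <;> rw [absRC] <;>
    simp only [ap_eval_lam, val_absQ, eval_hat, eval_var, Env.cons_zero, Env.cons_succ]
  · exact (abs_abs_sub_abs_le _ _).trans_lt (abs_hatN_sub_succ f n)
  · rw [← abs_toR]
    exact (abs_abs_sub_abs_le _ _).trans (abs_lim_sub_lt f n).le

/-- The one reciprocal whose value matters. For general `γ` the scalar `(γ)⁻¹_l` only multiplies a
vector of norm zero, so its value is irrelevant. -/
theorem lim_invR_one_one (e : M.Env Γ) : lim (M.eval e (invR (.suc .zero) oneR)) = 1 := by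
  have h : ∀ n : M.D .nat, val (M.ap (M.eval e (invR (.suc .zero) oneR)) n) = 1 := by
    intro n
    have h₁ : ∀ m, val (hatN (M.eval e oneR) m) = 1 := by
      intro m
      rw [hatN_eq_self (fun k => by simpa [oneR, constR] using eps_pos _)]
      simp [oneR, constR]
    simp only [invR, eval_app, eval_closed]
    rw [invRC, ap_eval_lam, ap_eval_lam, ap_eval_lam, val_invQ]
    · rw [eval_hat]
      exact (congrArg _ (h₁ _)).trans inv_one
    · rw [eval_hat]
      exact (h₁ _).symm ▸ one_pos
  refine lim_eq (fun n => ?_) (fun n => ?_)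
  · simpa [h] using eps_pos _
  · simpa [h] using (toR_eps_pos n).le

end Interp

/-! ### Multiplication of real numbers -/

theorem abs_mul_sub_mul_le {R : Type} [CommRing R] [LinearOrder R] [IsStrictOrderedRing R]
    {a a' b b' A B ε : R} (ha : |a| ≤ A) (hb : |b'| ≤ B) (h₁ : |a - a'| ≤ ε) (h₂ : |b - b'| ≤ ε) :
    |a * b - a' * b'| ≤ (A + B) * ε := by
  have : a * b - a' * b' = a * (b - b') + b' * (a - a') := by ring
  rw [this]
  refine (abs_add_le _ _).trans ?_
  rw [abs_mul, abs_mul, add_mul]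
  exact add_le_add (mul_le_mul ha h₂ (abs_nonneg _) ((abs_nonneg _).trans ha))
    (mul_le_mul hb h₁ (abs_nonneg _) ((abs_nonneg _).trans hb))

/-! ### Products of reals, the seminormed space, the operator, and the equivalences -/

namespace Interp

variable {M : Interp} [M.IsModel]

instance : IsOrderedRing M.R := inferInstance
instance : IsOrderedAddMonoid M.R := inferInstance

theorem eps_add (m n : M.D .nat) : M.eps (m + n) = M.eps m * M.eps n := by
  have := induction (M := M) (.eq (pow2 (plus v1 v0)) (times (pow2 v1) (pow2 v0))) (.cons m .nil)
    (by simp [sat]) (by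
      intro n h
      simp only [sat, eval_pow2, eval_plus, eval_times, eval_var, Env.cons_zero, Env.cons_succ,
        ← add_assoc, pow2N_succ] at h ⊢
      rw [h]
      ring) n
  simp only [sat, eval_pow2, eval_plus, eval_times, eval_var, Env.cons_zero, Env.cons_succ] at this
  rw [eps, this, map_mul, mul_inv, eps, eps]

/-- The bound of a type `1` object used in the multiplication. -/
def boundN (f : M.D .one) : M.D .nat := posN (M.ap f 0) + negN (M.ap f 0)

theorem abs_val_le (q : M.D .nat) : |val q| ≤ toK (posN q + negN q) := by
  rw [abs_val, div_le_iff₀ (den_pos q), map_add]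
  have h := add_nonneg (toK_nonneg (posN q)) (toK_nonneg (negN q))
  nlinarith [mul_nonneg h (toK_nonneg (sndN q))]

theorem abs_hatN_le (f : M.D .one) (n : M.D .nat) : |val (hatN f n)| ≤ toK (boundN f) + 1 := by
  have h₁ := abs_hatN_sub_add f 0 n
  have h₂ := abs_val_le (M.ap f 0)
  rw [zero_add, eps_zero, hatN_zero] at h₁
  have h₃ := abs_sub_abs_le_abs_sub (val (hatN f n)) (val (M.ap f 0))
  rw [abs_sub_comm] at h₃
  rw [boundN]
  linarith [eps_pos n]

theorem abs_lim_le (f : M.D .one) : |lim f| ≤ M.toR (toK (boundN f) + 1) := by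
  have h₁ := abs_lim_sub_lt f 0
  have h₂ := toR_le.2 (abs_val_le (M.ap f 0))
  rw [← abs_toR] at h₂
  rw [eps_zero, hatN_zero] at h₁
  rw [map_add, boundN]
  linarith [abs_sub_abs_le_abs_sub (lim f) (M.toR (val (M.ap f 0)))]

/-- The index shift in the product absorbs the sum of the bounds of both factors, since `s + 2 ≤
2^(s + 1)`. -/
theorem boundN_mul_eps_le (f g : M.D .one) (n : M.D .nat) :
    (toK (boundN f) + 1 + (toK (boundN g) + 1)) * M.eps (n + (boundN f + boundN g + 1)) ≤
      M.eps n := by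
  rw [eps_add, ← mul_assoc, mul_comm _ (M.eps n), mul_assoc]
  refine mul_le_of_le_one_right (eps_pos n).le ?_
  rw [eps, ← div_eq_mul_inv, div_le_one (toK_pos (pow2N_ne _))]
  have h := toK_le.2 (succ_le_pow2N (boundN f + boundN g + 1))
  simp only [map_add, map_one] at h
  linarith

@[simp] theorem lim_mulR (e : M.Env Γ) (f g : Tm Γ .one) :
    lim (M.eval e (mulR f g)) = lim (M.eval e f) * lim (M.eval e g) := by
  simp only [mulR, eval_app, eval_closed]
  generalize M.eval e f = f
  generalize M.eval e g = g
  have hv : ∀ n, val (M.ap (M.ap (M.ap (M.eval .nil mulRC) f) g) n) =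
      val (hatN f (n + (boundN f + boundN g + 1))) *
        val (hatN g (n + (boundN f + boundN g + 1))) := by
    intro n
    rw [mulRC]
    simp only [ap_eval_lam, val_mulQ, eval_hat, eval_plus, mulShift, eval_app, eval_cst, eval_posQ,
      eval_negQ, ap_succ, eval_var, Env.cons_zero, Env.cons_succ, cst_zero, boundN]
  refine lim_eq (fun n => ?_) (fun n => ?_)
  · have h₀ := boundN_mul_eps_le f g (n + 1)
    rw [add_right_comm n 1] at h₀
    rw [hv, hv, add_right_comm n 1]
    have h₁ := abs_hatN_sub_succ f (n + (boundN f + boundN g + 1))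
    have h₂ := abs_hatN_sub_succ g (n + (boundN f + boundN g + 1))
    refine lt_of_le_of_lt (abs_mul_sub_mul_le (abs_hatN_le f _) (abs_hatN_le g _)
      (le_max_left _ _) (le_max_right _ _)) ?_
    -- Both increments are strictly below the power of two, hence so is their maximum, and the
    -- strict inequality survives multiplication by the positive bound.
    refine lt_of_lt_of_le (mul_lt_mul_of_pos_left (max_lt h₁ h₂) ?_) h₀
    linarith [toK_nonneg (boundN f), toK_nonneg (boundN g)]
  · rw [hv, map_mul]
    have hg := toR_le.2 (abs_hatN_le g (n + (boundN f + boundN g + 1)))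
    rw [← abs_toR] at hg
    refine (abs_mul_sub_mul_le (abs_lim_le f) hg (abs_lim_sub_lt f _).le
      (abs_lim_sub_lt g _).le).trans ?_
    rw [← map_add, ← map_mul, toR_le]
    exact boundN_mul_eps_le f g n

variable (M) in
/-- The representative of the real number one. -/
def one : M.D .one := M.eval .nil oneR
def absF (f : M.D .one) : M.D .one := M.ap (M.eval .nil absRC) f
def invF (l : M.D .nat) (f : M.D .one) : M.D .one := M.ap (M.ap (M.eval .nil invRC) l) f

@[simp] theorem eval_oneR (e : M.Env Γ) : M.eval e oneR = M.one := by
  simp only [one, oneR, constR, natQ, mkQ, eval_app, eval_cst, eval_closed]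
@[simp] theorem eval_absR (e : M.Env Γ) (f : Tm Γ .one) :
    M.eval e (absR f) = absF (M.eval e f) := by
  simp only [absR, eval_app, eval_closed, absF]
@[simp] theorem eval_invR (e : M.Env Γ) (l : Tm Γ .nat) (f : Tm Γ .one) :
    M.eval e (invR l f) = invF (M.eval e l) (M.eval e f) := by
  simp only [invR, eval_app, eval_closed, invF]

@[simp] theorem lim_one : lim M.one = 1 := lim_oneR _
@[simp] theorem lim_absF (f : M.D .one) : lim (absF f) = |lim f| := by
  simpa using lim_absR (.cons f (.nil (M := M))) v0

/-! ### The abstract space of a model -/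

instance : Zero (M.D .X) := ⟨M.cst .zeroX⟩
instance : Neg (M.D .X) := ⟨M.ap (M.cst .negX)⟩
instance : Add (M.D .X) := ⟨fun x y => M.ap (M.ap (M.cst .addX) x) y⟩

@[simp] theorem cst_zeroX : M.cst .zeroX = (0 : M.D .X) := rfl
@[simp] theorem ap_negX (x : M.D .X) : M.ap (M.cst .negX) x = -x := rfl
@[simp] theorem ap_addX (x y : M.D .X) : M.ap (M.ap (M.cst .addX) x) y = x + y := rfl

theorem add_neg_self (x : M.D .X) : x + -x = 0 :=
  eval_eq_of_axiom (ρ := .X) (Γ := [.X]) (.inr (.inl (.add_neg v0))) (.cons x .nil)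
theorem addX_comm (x y : M.D .X) : x + y = y + x :=
  eval_eq_of_axiom (ρ := .X) (Γ := [.X, .X]) (.inr (.inl (.add_comm v0 v1)))
    (.cons x (.cons y .nil))
theorem addX_zero (x : M.D .X) : x + 0 = x :=
  eval_eq_of_axiom (ρ := .X) (Γ := [.X]) (.inr (.inl (.add_zero v0))) (.cons x .nil)

/-- The axioms assert only `=_X`, but being provable they hold as identities. Rearrangements by the
group laws are therefore allowed inside `Mem`, although distance zero is not. -/
instance : AddCommGroup (M.D .X) where
  add_assoc x y z := (eval_eq_of_axiom (ρ := .X) (Γ := [.X, .X, .X])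
    (.inr (.inl (.add_assoc v0 v1 v2))) (.cons x (.cons y (.cons z .nil)))).symm
  add_comm := addX_comm
  add_zero := addX_zero
  zero_add x := by rw [addX_comm, addX_zero]
  neg_add_cancel x := by rw [addX_comm, add_neg_self]
  nsmul := nsmulRec
  zsmul := zsmulRec

@[simp] theorem add_neg_eq_sub (x y : M.D .X) : x + -y = x - y := (sub_eq_add_neg x y).symm

/-- Scalar multiplication. -/
def smul (α : M.D .one) (x : M.D .X) : M.D .X := M.ap (M.ap (M.cst .smulX) α) x

@[simp] theorem ap_smulX (α : M.D .one) (x : M.D .X) :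
    M.ap (M.ap (M.cst .smulX) α) x = smul α x := rfl

/-- The norm. -/
noncomputable def norm (x : M.D .X) : M.R := lim (M.ap (M.cst .normX) x)

@[simp] theorem lim_normX (x : M.D .X) : lim (M.ap (M.cst .normX) x) = norm x := rfl

@[simp] theorem sat_eqX (e : M.Env Γ) (x y : Tm Γ .X) :
    M.sat e (eqX x y) ↔ norm (M.eval e x - M.eval e y) = 0 := by
  simp [eqX]

theorem sat_of_spaceAxiom {φ : Fm Γ} (h : SpaceAxiom φ) (e : M.Env Γ) : M.sat e φ :=
  IsModel.sound (.ax (.inr (.inl h))) e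

theorem sat_of_operatorAxiom {φ : Fm Γ} (h : OperatorAxiom φ) (e : M.Env Γ) : M.sat e φ :=
  IsModel.sound (.ax (.inr (.inr h))) e

@[simp] theorem norm_zero : norm (0 : M.D .X) = 0 := by
  have := sat_of_spaceAxiom (.norm_sub_self (zeroX : Tm [] .X)) (.nil (M := M))
  simpa using this

theorem norm_sub_rev (x y : M.D .X) : norm (x - y) = norm (y - x) := by
  have := sat_of_spaceAxiom (.norm_sub_comm v0 v1) (.cons x (.cons y (.nil (M := M))))
  simpa using this

theorem norm_neg (x : M.D .X) : norm (-x) = norm x := by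
  rw [← zero_sub, norm_sub_rev, sub_zero]

theorem norm_add_le (x y : M.D .X) : norm (x + y) ≤ norm x + norm y := by
  have := sat_of_spaceAxiom (.norm_triangle v0 v1 v2)
    -- The triangle inequality for the points `x`, `0` and `-y`.
    (.cons x (.cons 0 (.cons (-y) (.nil (M := M)))))
  simpa using this

theorem norm_nonneg (x : M.D .X) : 0 ≤ norm x := by
  have := norm_add_le x (-x)
  rw [add_neg_cancel, norm_zero, norm_neg] at this
  linarith

theorem norm_smul_sub_smul (α : M.D .one) (x y : M.D .X) :
    norm (smul α x - smul α y) = |lim α| * norm (x - y) := by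
  have := sat_of_spaceAxiom (.norm_smul_sub v0 v1 v2)
    (.cons α (.cons x (.cons y (.nil (M := M)))))
  simpa using this

theorem norm_smul_sub_smul' (α β : M.D .one) (x : M.D .X) :
    norm (smul α x - smul β x) = |lim α - lim β| * norm x := by
  have := sat_of_spaceAxiom (.norm_sub_smul v0 v1 v2)
    (.cons α (.cons β (.cons x (.nil (M := M)))))
  simpa using this

theorem parallelogram (x y : M.D .X) :
    norm (x + y) ^ 2 + norm (x - y) ^ 2 = 2 * (norm x ^ 2 + norm y ^ 2) := by
  have := sat_of_spaceAxiom (.parallelogram v0 v1) (.cons x (.cons y (.nil (M := M))))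
  simpa [sq] using this

theorem norm_congr {x y : M.D .X} (h : norm (x - y) = 0) : norm x = norm y := by
  refine le_antisymm ?_ ?_
  · have := norm_add_le (x - y) y
    rwa [sub_add_cancel, h, zero_add] at this
  · have := norm_add_le (y - x) x
    rwa [sub_add_cancel, norm_sub_rev, h, zero_add] at this

/-- Closed terms denoting elements that are provably equal are interchangeable. -/
theorem eval_eq_of_models {s t : Tm Γ ρ}
    (h : ∀ M : Interp, M.IsModel → ∀ e : M.Env Γ, M.sat e (eqAt ρ s t)) (e : M.Env Γ) :
    M.eval e s = M.eval e t :=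
  IsModel.er (φ := (.eq .zero .zero : Fm Γ)) trivial
    -- Completeness turns validity in all models into a derivation, and the rule of quantifier-free
    -- extensionality turns the derivation into identity in the given model.
    (Der.of_models fun M hM e => by
      change _ → M.sat e (eqAt ρ s t)
      exact fun _ => h M hM e) e rfl

theorem norm_sub_trans {x y z : M.D .X} (h₁ : norm (x - y) = 0) (h₂ : norm (y - z) = 0) :
    norm (x - z) = 0 := by
  refine le_antisymm ?_ (norm_nonneg _)
  have := norm_add_le (x - y) (y - z)
  rwa [sub_add_sub_cancel, h₁, h₂, add_zero] at this

/-- Scalars that are provably one act trivially. -/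
theorem smul_eq_self {f : Tm [] .one}
    (h : ∀ M : Interp, ∀ _ : M.IsModel, lim (M.eval .nil f) = 1) (x : M.D .X) :
    smul (M.eval .nil f) x = x := by
  -- In a single model the norm axioms yield only distance zero between the two sides; the
  -- hypothesis on all models is what gives identity.
  have := eval_eq_of_models (M := M) (Γ := [.X]) (ρ := .X) (s := smulX f.closed v0) (t := v0)
    (fun M _ e => by
      have h₁ := sat_of_spaceAxiom (.one_smul v0) e
      have h₂ := norm_smul_sub_smul' (M.eval .nil f) M.one (e _ .zero)
      rw [h, lim_one, sub_self, abs_zero, zero_mul] at h₂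
      rw [sat_eqX] at h₁
      rw [eqAt, sat_eqX]
      simp only [eval_app, eval_closed, eval_cst, eval_var, ap_smulX, eval_oneR] at h₁ ⊢
      exact norm_sub_trans h₂ h₁) (.cons x .nil)
  simpa using this

@[simp] theorem smul_one (x : M.D .X) : smul M.one x = x :=
  smul_eq_self (f := oneR) (fun _ _ => lim_oneR _) x
@[simp] theorem smul_absF_one (x : M.D .X) : smul (absF M.one) x = x := by
  simpa using smul_eq_self (M := M) (f := absR oneR) (fun _ _ => by simp) x
@[simp] theorem smul_invF_one_one (x : M.D .X) : smul (invF 1 M.one) x = x := by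
  simpa using smul_eq_self (M := M) (f := invR (.suc .zero) oneR)
    (fun _ _ => lim_invR_one_one _) x

/-- The representative of `2 ^ (-n)`. -/
def epsF (n : M.D .nat) : M.D .one := M.eval (.cons n .nil) (twoPowNegR v0)

@[simp] theorem eval_twoPowNegR (e : M.Env Γ) (n : Tm Γ .nat) :
    M.eval e (twoPowNegR n) = epsF (M.eval e n) := by
  simp only [epsF, twoPowNegR, constR, twoPowNegQ, mkQ, pow2, eval_app, eval_cst, eval_closed,
    eval_var, Env.cons_zero]

@[simp] theorem lim_epsF (n : M.D .nat) : lim (epsF n) = M.toR (M.eps n) :=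
  lim_twoPowNegR _ _

/-! ### Monotone pairs -/

theorem exists_add_smul (α β : M.D .one) (x : M.D .X) :
    ∃ γ, lim γ = lim α + lim β ∧ smul γ x = smul α x + smul β x := by
  refine ⟨M.eval (.cons α (.cons β .nil)) (addR v0 v1), by simp, ?_⟩
  have := eval_eq_of_axiom (M := M) (ρ := .X) (Γ := [.one, .one, .X])
    (.inr (.inl (.add_smul v0 v1 v2))) (.cons α (.cons β (.cons x .nil)))
  simpa [addR] using this

theorem norm_smul_congr {α β : M.D .one} (h : lim α = lim β) (x : M.D .X) :
    norm (smul α x - smul β x) = 0 := by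
  rw [norm_smul_sub_smul', h, sub_self, abs_zero, zero_mul]

theorem norm_smul (α : M.D .one) (x : M.D .X) : norm (smul α x) = |lim α| * norm x := by
  have h₁ := norm_smul_sub_smul α x 0
  have h₂ : smul α (0 : M.D .X) = 0 := by
    have := eval_eq_of_axiom (M := M) (ρ := .X) (Γ := [.one])
      (.inr (.inl (.smul_add v0 zeroX zeroX))) (.cons α .nil)
    simpa using this
  rwa [h₂, sub_zero, sub_zero] at h₁

variable (M) in
/-- Four times the inner product. -/
noncomputable def polar (x y : M.D .X) : M.R := norm (x + y) ^ 2 - norm (x - y) ^ 2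

/-- Subtract the parallelogram laws for the pairs `(x + y, y)` and `(x - y, y)`. -/
theorem polar_add_self (x y : M.D .X) : M.polar x (y + y) = 2 * M.polar x y := by
  have h₁ := parallelogram (x + y) y
  have h₂ := parallelogram (x - y) y
  rw [add_sub_cancel_right, add_assoc] at h₁
  rw [sub_add_cancel, sub_sub] at h₂
  simp only [polar]
  linarith

theorem polar_congr {x y z : M.D .X} (h : norm (y - z) = 0) : M.polar x y = M.polar x z := by
  have h₁ : norm (x + y) = norm (x + z) := norm_congr (by rwa [add_sub_add_left_eq_sub])
  have h₂ : norm (x - y) = norm (x - z) :=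
    norm_congr (by rwa [sub_sub_sub_cancel_left, norm_sub_rev])
  rw [polar, polar, h₁, h₂]

/-- Doubling, read backwards, gives homogeneity for powers of `1/2`, so full bilinearity is not
needed. The claim is written as a formula of the language because `n` may be nonstandard. The sum of
two copies of `2^(-n-1)` only has the same limit as `2^(-n)`, hence the appeal to `polar_congr`. -/
theorem polar_smul_epsF (x y : M.D .X) (n : M.D .nat) :
    M.polar x (smul (absF (epsF n)) y) = M.toR (M.eps n) * M.polar x y := by
  have := induction (M := M) (eqR
      (subR (normSqX (addX v1 (smulX (absR (twoPowNegR v0)) v2)))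
        (normSqX (subX v1 (smulX (absR (twoPowNegR v0)) v2))))
      (mulR (twoPowNegR v0) (subR (normSqX (addX v1 v2)) (normSqX (subX v1 v2)))))
    (.cons x (.cons y .nil)) (by
      have := polar_congr (x := x) (norm_smul_congr (α := absF (epsF 0)) (β := M.one)
        (by simp [eps_zero]) y)
      simpa [polar, sq, eps_zero] using this) (by
      intro n ih
      have ih : M.polar x (smul (absF (epsF n)) y) = M.toR (M.eps n) * M.polar x y := by
        simpa [polar, sq] using ih
      have : M.polar x (smul (absF (epsF (n + 1))) y) =
          M.toR (M.eps (n + 1)) * M.polar x y := by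
        obtain ⟨γ, h₁, h₂⟩ := exists_add_smul (absF (epsF (n + 1))) (absF (epsF (n + 1))) y
        have h₃ := polar_add_self x (smul (absF (epsF (n + 1))) y)
        have h₄ := toR_eps_succ n
        rw [← h₂, polar_congr (norm_smul_congr (β := absF (epsF n)) (by
          rw [h₁, lim_absF, lim_absF, lim_epsF, lim_epsF, abs_of_pos (toR_eps_pos _),
            abs_of_pos (toR_eps_pos _), h₄, two_mul]) y), ih, h₄] at h₃
        linarith
      simpa [polar, sq] using this) n
  simpa [polar, sq] using this

/-- Accretive pairs are monotone. -/
theorem polar_nonneg_of_accretive {x y : M.D .X}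
    (h : ∀ α, norm x ≤ norm (x + smul (absF α) y)) : 0 ≤ M.polar x y := by
  -- For `ε = 2^(-n)` the parallelogram law gives `polar x (εy) = 2‖x + εy‖² - 2‖x‖² - 2ε²‖y‖² ≥
  -- -2ε²‖y‖²`; dividing by `ε` leaves the error `2‖y‖²ε`.
  refine le_of_forall_eps (c := 2 * norm y ^ 2) fun n => ?_
  have h₁ := polar_smul_epsF x y n
  have h₂ := pow_le_pow_left₀ (norm_nonneg x) (h (epsF n)) 2
  have h₃ := parallelogram x (smul (absF (epsF n)) y)
  have h₄ := norm_smul (absF (epsF n)) y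
  have h₅ := toR_eps_pos n
  rw [lim_absF, lim_epsF, abs_abs, abs_of_pos h₅] at h₄
  rw [h₄] at h₃
  rw [polar] at h₁
  generalize M.toR (M.eps n) = ε at *
  refine le_of_mul_le_mul_left ?_ h₅
  nlinarith

/-- If `‖x - y‖² ≤ ‖x + y‖²`, then `2‖x + y‖²` is at least the left side of the parallelogram law,
hence at least `2‖x‖²`. -/
theorem norm_le_norm_add_of_polar_nonneg {x y : M.D .X} (h : 0 ≤ M.polar x y) :
    norm x ≤ norm (x + y) := by
  refine le_of_sq_le_sq ?_ (norm_nonneg _)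
  have := parallelogram x y
  rw [polar] at h
  nlinarith [sq_nonneg (norm y)]

/-! ### The operator and its resolvent -/

/-- `y ∈ A x`. -/
def Mem (y x : M.D .X) : Prop := M.ap (M.ap (M.cst .chi) x) y = 0

@[simp] theorem sat_memA (e : M.Env Γ) (y x : Tm Γ .X) :
    M.sat e (memA y x) ↔ Mem (M.eval e y) (M.eval e x) := Iff.rfl

/-- The resolvent. -/
def res (γ : M.D .one) (x : M.D .X) : M.D .X := M.ap (M.ap (M.cst .res) γ) x

@[simp] theorem ap_res (γ : M.D .one) (x : M.D .X) :
    M.ap (M.ap (M.cst .res) γ) x = res γ x := rfl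

theorem chi_le_one (x y : M.D .X) : M.ap (M.ap (M.cst .chi) x) y ≤ 1 := by
  have := sat_of_operatorAxiom (.chi_le_one v0 v1) (.cons x (.cons y (.nil (M := M))))
  simpa using this

theorem mem_res {γ : M.D .one} {l : M.D .nat} (h : M.toR (M.eps l) < lim γ) (x : M.D .X) :
    Mem (smul (invF l γ) (x - res γ x)) (res γ x) := by
  have := sat_of_operatorAxiom (.resolvent v0 v1 v2)
    (.cons γ (.cons x (.cons l (.nil (M := M)))))
  simp [sat] at this
  exact this h

theorem eps_one_lt : M.toR (M.eps 1) < 1 := by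
  rw [← map_one M.toR, toR_lt, ← zero_add 1, eps_succ, eps_zero]
  linarith [one_pos (α := M.K)]

theorem mem_res_one (x : M.D .X) : Mem (x - res M.one x) (res M.one x) := by
  simpa using mem_res (γ := M.one) (l := 1) (by simpa using eps_one_lt) x

theorem accretive {x y u v : M.D .X} (hu : Mem u x) (hv : Mem v y) (α : M.D .one) :
    norm (x - y) ≤ norm (x - y + smul (absF α) (u - v)) := by
  have := sat_of_operatorAxiom (.accretive v0 v1 v2 v3 v4)
    (.cons x (.cons y (.cons u (.cons v (.cons α (.nil (M := M)))))))
  simp [sat] at this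
  exact this hu hv

/-! ### The sentences in a model -/

/-- Since `χ_A` takes only the values `0` and `1`, equality of its values amounts to equivalence of
memberships, and by symmetry one implication is enough. -/
theorem sat_extensionality : M.sat .nil extensionality ↔
    ∀ x y x' y' : M.D .X, norm (x - x') = 0 → norm (y - y') = 0 → Mem y x → Mem y' x' := by
  simp only [extensionality, sat, sat_eqX, eval_var, eval_app, eval_cst, Env.cons_zero,
    Env.cons_succ]
  constructor
  · intro h x y x' y' h₁ h₂ hm
    exact (h x y x' y' ⟨h₁, h₂⟩).symm.trans hm
  · rintro h x y x' y' ⟨h₁, h₂⟩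
    have key : ∀ n : M.D .nat, n ≤ 1 → n = 0 ∨ n = 1 := by
      intro n hn
      rw [← zero_add 1, le_succ_iff, nonpos_iff_eq_zero, zero_add] at hn
      exact hn
    rcases key _ (chi_le_one x y) with h₃ | h₃
    · exact h₃.trans (h x y x' y' h₁ h₂ h₃).symm
    · rcases key _ (chi_le_one x' y') with h₄ | h₄
      · rw [norm_sub_rev] at h₁ h₂
        exact (h x' y' x y h₁ h₂ h₄).trans h₄.symm
      · rw [h₃, h₄]

theorem sat_strongResolvent : M.sat .nil strongResolvent ↔
    ∀ (x p : M.D .X) (γ : M.D .one) (l : M.D .nat), M.toR (M.eps l) < lim γ →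
      norm (p - res γ x) = 0 → Mem (smul (invF l γ) (x - p)) p := by
  simp [strongResolvent, sat]

theorem sat_maximalAccretivity : M.sat .nil maximalAccretivity ↔
    ∀ x u : M.D .X, (∀ (y v : M.D .X) (α : M.D .one), Mem v y →
      norm (x - y) ≤ norm (x - y + smul (absF α) (u - v))) → Mem u x := by
  simp [maximalAccretivity, sat]

theorem sat_strongResolventOne : M.sat .nil strongResolventOne ↔
    ∀ x p : M.D .X, norm (p - res M.one x) = 0 → Mem (x - p) p := by
  simp [strongResolventOne, sat]

theorem sat_maximalAccretivityOne : M.sat .nil maximalAccretivityOne ↔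
    ∀ x u : M.D .X, (∀ y v : M.D .X, Mem v y → norm (x - y) ≤ norm (x - y + (u - v))) →
      Mem u x := by
  simp [maximalAccretivityOne, sat]

/-- Convergence of sequences. -/
def Conv (s : M.D (.fn .nat .X)) (x : M.D .X) : Prop :=
  ∀ k, ∃ n, ∀ m, n ≤ m → norm (M.ap s m - x) ≤ M.toR (M.eps k)

@[simp] theorem sat_convergesX (e : M.Env Γ) (s : Tm Γ (.fn .nat .X)) (x : Tm Γ .X) :
    M.sat e (convergesX s x) ↔ Conv (M.eval e s) (M.eval e x) := by
  simp [convergesX, sat, Conv]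

theorem sat_closedGraph : M.sat .nil closedGraph ↔
    ∀ (x y : M.D .X) (s t : M.D (.fn .nat .X)), Conv s x → Conv t y →
      (∀ n, Mem (M.ap t n) (M.ap s n)) → Mem y x := by
  simp [closedGraph, sat]

/-- The positive factor `1/4` of the inner product does not affect the sign. -/
theorem sat_maximalMonotonicity : M.sat .nil maximalMonotonicity ↔
    ∀ x u : M.D .X, (∀ y v : M.D .X, Mem v y → 0 ≤ M.polar (x - y) (u - v)) → Mem u x := by
  simp [maximalMonotonicity, sat, innerX, toR_eps_pos, polar, sq, -neg_sub]

/-! ### Equivalence of the sentences in a model -/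

/-- Replacing the resolvent by `p` in the resolvent axiom moves both the point and the value by
distance zero; for the value, the norm of the difference is a scalar multiple of `‖p - J_γ x‖ = 0`.
-/
theorem strongResolvent_of_extensionality (h : M.sat .nil extensionality) :
    M.sat .nil strongResolvent := by
  rw [sat_extensionality] at h
  rw [sat_strongResolvent]
  intro x p γ l hγ hp
  refine h _ _ p _ ?_ ?_ (mem_res hγ x)
  · rwa [norm_sub_rev]
  · rw [norm_smul_sub_smul, sub_sub_sub_cancel_left, hp, mul_zero]

theorem strongResolventOne_of_strongResolvent (h : M.sat .nil strongResolvent) :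
    M.sat .nil strongResolventOne := by
  rw [sat_strongResolvent] at h
  rw [sat_strongResolventOne]
  intro x p hp
  -- The choice `l = 1` is admissible since `2^(-1) < 1`; the scalar `(1)⁻¹_1` then disappears by a
  -- literal identity.
  simpa using h x p M.one 1 (by simpa using eps_one_lt) hp

theorem maximalAccretivityOne_of_strongResolventOne (h : M.sat .nil strongResolventOne) :
    M.sat .nil maximalAccretivityOne := by
  rw [sat_strongResolventOne] at h
  rw [sat_maximalAccretivityOne]
  intro x u hu
  -- The hypothesis is tested on the pair given by the resolvent `p` of `x + u`: the right side is
  -- `‖(x - p) + (u - (x + u - p))‖ = 0`, so `x` and `p` have distance zero.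
  have h₁ := hu _ _ (mem_res_one (x + u))
  have h₂ : x - res M.one (x + u) + (u - (x + u - res M.one (x + u))) = 0 := by abel
  rw [h₂, norm_zero] at h₁
  simpa using h (x + u) x (le_antisymm h₁ (norm_nonneg _))

theorem maximalAccretivity_of_maximalAccretivityOne (h : M.sat .nil maximalAccretivityOne) :
    M.sat .nil maximalAccretivity := by
  rw [sat_maximalAccretivityOne] at h
  rw [sat_maximalAccretivity]
  exact fun x u hu => h x u fun y v hv => by simpa using hu y v M.one hv

theorem closedGraph_of_maximalAccretivity (h : M.sat .nil maximalAccretivity) :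
    M.sat .nil closedGraph := by
  rw [sat_maximalAccretivity] at h
  rw [sat_closedGraph]
  intro x u s t hs ht hm
  -- Replacing `x` by its approximation costs `ε` on each side of the accretivity inequality, and
  -- replacing `u` under the scalar costs `|α|ε`.
  refine h x u fun y v α hv => le_of_forall_eps (c := 2 + |lim α|) fun n => ?_
  obtain ⟨i, hi⟩ := hs n
  obtain ⟨j, hj⟩ := ht n
  have hi := hi (max i j) (le_max_left _ _)
  have hj := hj (max i j) (le_max_right _ _)
  have ha := accretive (hm (max i j)) hv α
  generalize M.ap s (max i j) = x' at *
  generalize M.ap t (max i j) = u' at *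
  have h₁ := norm_add_le (x - x') (x' - y)
  have h₂ := norm_add_le (x' - x + (smul (absF α) (u' - v) - smul (absF α) (u - v)))
    (x - y + smul (absF α) (u - v))
  have h₃ := norm_add_le (x' - x) (smul (absF α) (u' - v) - smul (absF α) (u - v))
  rw [norm_smul_sub_smul, sub_sub_sub_cancel_right, lim_absF, abs_abs] at h₃
  have h₄ : x' - x + (smul (absF α) (u' - v) - smul (absF α) (u - v)) +
      (x - y + smul (absF α) (u - v)) = x' - y + smul (absF α) (u' - v) := by abel
  rw [h₄] at h₂
  rw [sub_add_sub_cancel, norm_sub_rev x x'] at h₁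
  have h₅ := mul_le_mul_of_nonneg_left hj (abs_nonneg (lim α))
  linarith

theorem extensionality_of_closedGraph (h : M.sat .nil closedGraph) :
    M.sat .nil extensionality := by
  rw [sat_closedGraph] at h
  rw [sat_extensionality]
  intro x y x' y' hx hy hm
  -- The constant sequence at `z`, built with the combinator `Π`, converges to every point at
  -- distance zero from `z`; its terms are literally `z`, so membership carries over.
  have hc : ∀ {z z' : M.D .X}, norm (z - z') = 0 →
      Conv (M.ap (M.cst (.proj .X .nat)) z) z' := fun {z z'} hz k => ⟨0, fun m _ => by
    rw [ap_proj, hz]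
    exact (toR_eps_pos k).le⟩
  exact h x' y' _ _ (hc hx) (hc hy) fun n => by rwa [ap_proj, ap_proj]

theorem maximalMonotonicity_of_maximalAccretivityOne (h : M.sat .nil maximalAccretivityOne) :
    M.sat .nil maximalMonotonicity := by
  rw [sat_maximalAccretivityOne] at h
  rw [sat_maximalMonotonicity]
  exact fun x u hu => h x u fun y v hv => norm_le_norm_add_of_polar_nonneg (hu y v hv)

/-- The accretivity axiom makes `(x, u)` monotone against the graph. Monotonicity involves only
norms, so it persists for `(x', u')`, and maximality applies. -/
theorem extensionality_of_maximalMonotonicity (h : M.sat .nil maximalMonotonicity) :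
    M.sat .nil extensionality := by
  rw [sat_maximalMonotonicity] at h
  rw [sat_extensionality]
  intro x u x' u' hx hu hm
  refine h x' u' fun y v hv => ?_
  have h₁ := polar_nonneg_of_accretive (accretive hm hv)
  have h₂ : norm (x - y + (u - v)) = norm (x' - y + (u' - v)) := by
    refine norm_congr (le_antisymm ?_ (norm_nonneg _))
    have := norm_add_le (x - x') (u - u')
    rw [hx, hu, add_zero] at this
    convert this using 2
    abel
  have h₃ : norm (x - y - (u - v)) = norm (x' - y - (u' - v)) := by
    refine norm_congr (le_antisymm ?_ (norm_nonneg _))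
    have := norm_add_le (x - x') (u' - u)
    rw [hx, norm_sub_rev, hu, add_zero] at this
    convert this using 2
    abel
  rwa [polar, h₂, h₃] at h₁

theorem sat_item (i j : Fin 7) (h : M.sat .nil (item i)) : M.sat .nil (item j) := by
  have h₁₂ := strongResolvent_of_extensionality (M := M)
  have h₂₄ := strongResolventOne_of_strongResolvent (M := M)
  have h₄₅ := maximalAccretivityOne_of_strongResolventOne (M := M)
  have h₅₃ := maximalAccretivity_of_maximalAccretivityOne (M := M)
  have h₃₆ := closedGraph_of_maximalAccretivity (M := M)
  have h₆₁ := extensionality_of_closedGraph (M := M)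
  have h₅₇ := maximalMonotonicity_of_maximalAccretivityOne (M := M)
  have h₇₁ := extensionality_of_maximalMonotonicity (M := M)
  -- All implications run through extensionality, along the cycle 1, 2, 4, 5, 3, 6, 1 with the
  -- detour 5, 7, 1.
  have h₀ : M.sat .nil extensionality := by
    fin_cases i <;> simp only [item] at h
    exacts [h, h₆₁ (h₃₆ (h₅₃ (h₄₅ (h₂₄ h)))), h₆₁ (h₃₆ h), h₆₁ (h₃₆ (h₅₃ (h₄₅ h))),
      h₆₁ (h₃₆ (h₅₃ h)), h₆₁ h, h₇₁ h]
  have h₅ := h₄₅ (h₂₄ (h₁₂ h₀))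
  fin_cases j
  exacts [h₀, h₁₂ h₀, h₅₃ h₅, h₂₄ (h₁₂ h₀), h₅, h₃₆ (h₅₃ h₅), h₅₇ h₅]

end Interp

end FiniteType

theorem mainTheorem4 : ∀ i j : Fin 7,
    FiniteType.TProves (FiniteType.Fm.iff (FiniteType.item i) (FiniteType.item j)) := by
  refine fun i j => FiniteType.Der.of_models fun M _ e => ?_
  obtain rfl : e = .nil := by
    funext τ x
    nomatch x
  exact ⟨FiniteType.Interp.sat_item i j, FiniteType.Interp.sat_item j i⟩
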